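/- **Setting.** Let $d\ge 1$, let $\mathcal N$ be a $d$-dimensional manifold (the asymptotic boundary) and $M$ a $(d+1)$-dimensional Hausdorff manifold without boundary (a neighbourhood of $\mathcal N$ in the conformally completed spacetime), with a smooth conformal factor $\Phi$ on $M$ that vanishes on $\mathcal N$ and a smooth rigging vector field $\vec v$ with $v(\Phi)=1$. The inclusion $\pi_0:\mathcal N\to M$ is an injective immersion, and the flow $\pi_\upsilon:\mathcal N\to M$, which moves a point $\upsilon$ units along its integral curve of $\vec v$, is smooth and defined for $0\le\upsilon<\upsilon_{\max}$ (on an open neighbourhood of these times in $\mathbb R\times\mathcal N$). Put $\mathcal D=\bigcup_{0<\upsilon<\upsilon_{\max}}\pi_\upsilon(\mathcal N)$. Let $\mathscr S$ be the space of on-shell field configurations (any diffeological space), with exterior derivative $\delta$. Let $L'$ be a smooth function on $\mathscr S$ with values in the $(d+1)$-forms on $\mathcal D$, and $\theta'$ a smooth one-form on $\mathscr S$ with values in the $d$-forms on $\mathcal D$, with $\delta L'=d\theta'$ on $\mathcal D$. For a $d$-form $B$ on $\mathcal D$ depending on the point of $\mathscr S$, and a one-form $\Lambda$ on $\mathscr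 S$ with values in the $(d-1)$-forms on $\mathcal D$, put $$L'_{\rm ren}=L'+dB,\qquad \theta'_{\rm ren}=\theta'+\delta B-d\Lambda .$$ A form $\eta$ on $\mathcal D$ has a finite limit at a point of $\mathcal N$ if all of its components in a chart of $M$ around that point (not only its pullbacks to surfaces of constant $\Phi$) converge as that point is approached in $\mathcal D$; the limit is an alternating form on the tangent space of $M$ there. ($i_v$ of a $0$-form is $0$.) **1. General counterterms.** For every $\upsilon_0\in(0,\upsilon_{\max})$ there are $B$ and $\Lambda$, unique on $\mathcal D$, such that for $0<\upsilon<\upsilon_{\max}$ $$i_vB=0,\quad \pi_\upsilon^*B=\int_\upsilon^{\upsilon_0}\! d\bar\upsilon\;\pi_{\bar\upsilon}^*\,i_vL',\qquad i_v\Lambda=0,\quad \pi_\upsilon^*\Lambda=-\int_\upsilon^{\upsilon_0}\! d\bar\upsilon\;\pi_{\bar\upsilon}^*\,i_v\theta'.$$ They are smooth on $\mathscr S\times\mathcal D$, and $$i_vL'_{\rm ren}=0,\qquad i_v\theta'_{\rm ren}=0,\qquad \pi_\upsilon^*\theta'_{\rm ren}=\pi_{\upsilon_0}^*\theta'\quad(0<\upsilon<\upsilon_{\max}).$$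 Consequently $L'_{\rm ren}$ and $\theta'_{\rm ren}$ have finite limits at every point of $\mathcal N$: the limit of $L'_{\rm ren}$ is $0$, and the limit of $\theta'_{\rm ren}$ is annihilated by $i_v$ and restricts to $\pi_{\upsilon_0}^*\theta'$ on the tangent space of $\mathcal N$. **2. Explicit counterterms for polynomial and logarithmic divergences.** Suppose that for some integer $t\ge 0$ the forms $\upsilon^t\,\pi_\upsilon^*i_vL'$, $\upsilon^t\,\pi_\upsilon^*i_v\theta'$ and $\upsilon^t\,\pi_\upsilon^*\theta'$ are, near $\upsilon=0$, smooth functions of $\upsilon$ and $\upsilon\log\upsilon$ (and of the point of $\mathcal N$ and of the parameters of any smooth finite-dimensional family in $\mathscr S$), and let $\mathcal L^{(p,q)}$, $\theta_I^{(p,q)}$, $\theta_0^{(p,q)}$ ($p\ge -t$, $q\ge0$), which are forms on $\mathcal N$, be the coefficients of $\upsilon^p(\upsilon\log\upsilon)^q$ in the resulting asymptotic (Taylor) series of $\pi_\upsilon^*i_vL'$, $\pi_\upsilon^*i_v\theta'$, $\pi_\upsilon^*\theta'$. Suppose that these coefficients are functions ($\mathcal L^{(p,q)}$), respectively one-forms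 ($\theta_I^{(p,q)}$, $\theta_0^{(p,q)}$), on $\mathscr S$. For coefficients $c^{(p,q)}$ and $K\ge1$ put $$A_K[c]=\sum_{\substack{k=-t+1\\ k\neq0}}^{K}\ \sum_{p=-t+1}^{k}\ \sum_{j=-t}^{\min(p-1,-1)}\frac1k\Big\{\prod_{l=j+1}^{p-1}\Big(\frac lk-1\Big)\Big\}c^{(j,k-j-1)}\,\upsilon^p(\upsilon\log\upsilon)^{k-p}\;-\;\sum_{p=-t}^{-1}\frac1p\,c^{(p,-p-1)}\,\upsilon^p(\upsilon\log\upsilon)^{-p}.$$ Then for every $K\ge 1$: (a) For $c=\mathcal L$ and $c=\theta_I$, $$\partial_\upsilon A_K[c]=\sum_{p=-t}^{-1}\ \sum_{\substack{q\ge0\\ p+q<K}}c^{(p,q)}\,\upsilon^p(\upsilon\log\upsilon)^q\qquad(\upsilon>0).$$ (b) There are smooth $B$ and $\Lambda$ with $i_vB=0$, $i_v\Lambda=0$, $\pi_\upsilon^*B=-A_K[\mathcal L]$, $\pi_\upsilon^*\Lambda=A_K[\theta_I]$ ($0<\upsilon<\upsilon_{\max}$). With them $L'_{\rm ren}$ and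 $\theta'_{\rm ren}$ have finite limits at every point of $\mathcal N$, and, restricted to the tangent space of $\mathcal N$, the limits of $i_vL'_{\rm ren}$, $i_v\theta'_{\rm ren}$ and $\theta'_{\rm ren}$ are the finite parts $\mathcal L^{(0,0)}$, $\theta_I^{(0,0)}$ and $\theta_0^{(0,0)}$. (c) The conclusions of (b) about $L'_{\rm ren}$ and $\theta'_{\rm ren}$ hold for all smooth $B$ and $\Lambda$ with $i_vB=0$, $i_v\Lambda=0$ for which $\upsilon^t\pi_\upsilon^*B$ and $\upsilon^t\pi_\upsilon^*\Lambda$ are smooth functions of $\upsilon$ and $\upsilon\log\upsilon$ in the above sense and the asymptotic series of $\pi_\upsilon^*B$ and $\pi_\upsilon^*\Lambda$ agree with $-A_\infty[\mathcal L]$ and $A_\infty[\theta_I]$ in all terms $\upsilon^p(\upsilon\log\upsilon)^q$ with $p+q\le K$; here $A_\infty[c]$ is the formal series that $A_K[c]$ truncates. -/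

import Mathlib

open Set Filter Topology
open scoped Manifold ContDiff

noncomputable section

namespace HolRen

/-- Euclidean space of dimension `n`, the model space of all manifolds below. -/
abbrev Eu (n : ℕ) : Type := EuclideanSpace ℝ (Fin n)

/-! ### Differential forms on manifolds -/

/-- Differential `k`-forms on an `n`-dimensional manifold `M` (no regularity imposed). In Mathlib
the tangent space `TangentSpace (𝓡 n) x` is by definition the model space `Eu n`. -/
abbrev SpForm (n k : ℕ) (M : Type*) : Type _ := M → (Eu n) [⋀^Fin k]→L[ℝ] ℝ

section Forms

variable {a b n k : ℕ} {X Y M : Type*}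
  [TopologicalSpace X] [ChartedSpace (Eu a) X]
  [TopologicalSpace Y] [ChartedSpace (Eu b) Y]
  [TopologicalSpace M] [ChartedSpace (Eu n) M]

/-- Pullback of an alternating map on `T_{f x} Y` along `d f_x`. -/
def pullAt (f : X → Y) (x : X) (η : (Eu b) [⋀^Fin k]→L[ℝ] ℝ) : (Eu a) [⋀^Fin k]→L[ℝ] ℝ :=
  η.compContinuousLinearMap (mfderiv (𝓡 a) (𝓡 b) f x : Eu a →L[ℝ] Eu b)

/-- The pullback `f^* η` of a differential form. -/
def pullback (f : X → Y) (η : SpForm b k Y) : SpForm a k X :=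
  fun x => pullAt f x (η (f x))

/-- The coordinate expression of a form in the preferred chart at `x₀`. -/
def inChart (x₀ : M) (η : SpForm n k M) : SpForm n k (Eu n) :=
  @pullback n n k (Eu n) M _ (chartedSpaceSelf (Eu n)) _ _ (extChartAt (𝓡 n) x₀).symm η

/-- The exterior derivative `d η`, computed in charts. -/
def dExt (η : SpForm n k M) : SpForm n (k + 1) M :=
  fun x => @pullback n n (k + 1) M (Eu n) _ _ _ (chartedSpaceSelf (Eu n)) (extChartAt (𝓡 n) x)
    (extDeriv (inChart x η)) x

/-- The contraction `i_v η` of a form of positive degree with a vector field. -/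
def interior (v : ∀ x : M, TangentSpace (𝓡 n) x) (η : SpForm n (k + 1) M) : SpForm n k M :=
  fun x => (η x).curryLeft (v x : Eu n)

/-- `i_v η = 0` on `D`, where `i_v` of a `0`-form is zero by convention. -/
def IsHorizontalOn (v : ∀ x : M, TangentSpace (𝓡 n) x) (D : Set M) :
    ∀ {k : ℕ}, SpForm n k M → Prop
  | 0, _ => True
  | _ + 1, η => ∀ x ∈ D, interior v η x = 0

/-- A family of forms on `M`, parametrized by `u ∈ ℝ^r`, is jointly smooth on `ℝ^r × D`. -/
def SmoothFamilyOn {r : ℕ} (D : Set M) (A : Eu r → SpForm n k M) : Prop :=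
  ∀ x₀ : M, ContDiffOn ℝ ∞ (fun z : Eu r × Eu n => inChart x₀ (A z.1) z.2)
    (univ ×ˢ ((extChartAt (𝓡 n) x₀).target ∩ (extChartAt (𝓡 n) x₀).symm ⁻¹' D))

/-- The form `η` (all of its components, in the chart at `x₀`) tends to the alternating map `α` on
`T_{x₀} M` as the point tends to `x₀` inside `D`. -/
def HasLimitAt (D : Set M) (η : SpForm n k M) (x₀ : M) (α : (Eu n) [⋀^Fin k]→L[ℝ] ℝ) : Prop :=
  Tendsto (fun x => inChart x₀ η (extChartAt (𝓡 n) x₀ x)) (𝓝[D] x₀)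
    (𝓝 (@pullAt n n k (Eu n) M _ (chartedSpaceSelf (Eu n)) _ _ (extChartAt (𝓡 n) x₀).symm
      (extChartAt (𝓡 n) x₀ x₀) α))

end Forms

/-! ### Forms on the space `S` of on-shell field configurations

`S` is a diffeological space: its smooth structure is given by its smooth finite-dimensional
families ("plots") `p : ℝ^r → S`. This covers solution spaces of smooth fields, infinite-dimensional
manifolds, and subspaces of these. A function on `S` is smooth if it is so along every plot; a
`1`-form on `S` is a compatible family of `1`-forms on the parameter spaces of the plots. -/

open Diffeology in
/-- A `1`-form on `S` with values in the vector space `V`: `toFun p hp u h` is its value at the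
point `p u` on the variation `δ = d/ds p (u + s h)`. -/
structure FieldOneForm (S : Type*) [DiffeologicalSpace S] (V : Type*) [AddCommGroup V]
    [Module ℝ V] where
  toFun : ∀ {r : ℕ} (p : Eu r → S), IsPlot p → Eu r → Eu r →ₗ[ℝ] V
  compat : ∀ {r s : ℕ} (p : Eu s → S) (hp : IsPlot p) (f : Eu r → Eu s) (hf : ContDiff ℝ ∞ f)
    (u h : Eu r),
    toFun (p ∘ f) (isPlot_reparam hp hf) u h = toFun p hp (f u) (fderiv ℝ f u h)

section Fields

open Diffeology

variable {n k : ℕ} {S M : Type*} [DiffeologicalSpace S]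
  [TopologicalSpace M] [ChartedSpace (Eu n) M]

/-- Smoothness on `S × D` of a function on `S` with values in the `k`-forms on `D ⊆ M`. -/
def SmoothField (D : Set M) (A : S → SpForm n k M) : Prop :=
  ∀ (r : ℕ) (p : Eu r → S), IsPlot p → SmoothFamilyOn D (fun u => A (p u))

/-- Smoothness on `S × D` of a `1`-form on `S` with values in the `k`-forms on `D ⊆ M`. -/
def SmoothFieldOneForm (D : Set M) (A : FieldOneForm S (SpForm n k M)) : Prop :=
  ∀ (r : ℕ) (p : Eu r → S) (hp : IsPlot p) (h : Eu r), SmoothFamilyOn D (fun u => A.toFun p hp u h)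

/-- The field-space exterior derivative `δ A` of a function on `S`, along the plot `p`, at `p u`, on
the variation in the direction `h`. -/
def delta (A : S → SpForm n k M) {r : ℕ} (p : Eu r → S) (u h : Eu r) : SpForm n k M :=
  fun x => fderiv ℝ (fun u' => A (p u') x) u h

/-- `L_ren = L + d B`. -/
def lagRen (L : S → SpForm n (k + 1) M) (B : S → SpForm n k M) (φ : S) : SpForm n (k + 1) M :=
  L φ + dExt (B φ)

/-- `θ_ren = θ + δ B - d Λ`. -/
def thetaRen (θ : FieldOneForm S (SpForm n (k + 1) M)) (B : S → SpForm n (k + 1) M)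
    (Λ : FieldOneForm S (SpForm n k M)) {r : ℕ} (p : Eu r → S) (hp : IsPlot p) (u h : Eu r) :
    SpForm n (k + 1) M :=
  θ.toFun p hp u h + delta B p u h - dExt (Λ.toFun p hp u h)

end Fields

/-! ### The asymptotic boundary, its conformal factor and its rigging vector field -/

/-- A neighbourhood `M` (of dimension `d + 1`, with `d = m + 1`) of the asymptotic boundary `N` (of
dimension `d`), with a conformal factor `Φ` that vanishes on `N`, a rigging vector field `v` with
`v(Φ) = 1`, and the flow of `v` starting on `N`, which is defined at least for the times
`0 ≤ υ < υmax`. The map `flow υ : N → M` is the map `π_υ` that moves a point by `υ` units along its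
integral curve; `flow 0` is the inclusion of `N`. -/
structure RiggedBoundary (m : ℕ) (M N : Type*)
    [TopologicalSpace M] [ChartedSpace (Eu (m + 2)) M] [IsManifold (𝓡 (m + 2)) ∞ M]
    [TopologicalSpace N] [ChartedSpace (Eu (m + 1)) N] where
  Φ : M → ℝ
  v : ∀ x : M, TangentSpace (𝓡 (m + 2)) x
  υmax : ℝ
  flow : ℝ → N → M
  dom : Set (ℝ × N)
  contMDiff_Φ : ContMDiff (𝓡 (m + 2)) 𝓘(ℝ, ℝ) ∞ Φ
  contMDiff_v : ContMDiff (𝓡 (m + 2)) (𝓡 (m + 2)).tangent ∞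
    (fun x => (⟨x, v x⟩ : TangentBundle (𝓡 (m + 2)) M))
  rigging : ∀ x, (mfderiv (𝓡 (m + 2)) 𝓘(ℝ, ℝ) Φ x (v x) : ℝ) = 1
  υmax_pos : 0 < υmax
  isOpen_dom : IsOpen dom
  subset_dom : Ico 0 υmax ×ˢ univ ⊆ dom
  contMDiffOn_flow : ContMDiffOn (𝓘(ℝ, ℝ).prod (𝓡 (m + 1))) (𝓡 (m + 2)) ∞
    (fun z : ℝ × N => flow z.1 z.2) dom
  integralCurve : ∀ q, IsMIntegralCurveOn (fun s => flow s q) v {s | (s, q) ∈ dom}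
  incl_injective : Function.Injective (flow 0)
  incl_immersion : ∀ q, Function.Injective (mfderiv (𝓡 (m + 1)) (𝓡 (m + 2)) (flow 0) q)
  Φ_incl : ∀ q, Φ (flow 0 q) = 0

namespace RiggedBoundary

open Diffeology

variable {m : ℕ} {M N S : Type*} [DiffeologicalSpace S]
  [TopologicalSpace M] [ChartedSpace (Eu (m + 2)) M] [IsManifold (𝓡 (m + 2)) ∞ M]
  [TopologicalSpace N] [ChartedSpace (Eu (m + 1)) N]

/-- The region `D` adjacent to `N` that is swept out by the flow, where `0 < Φ < υmax`. -/
def region (C : RiggedBoundary m M N) : Set M :=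
  (fun z : ℝ × N => C.flow z.1 z.2) '' (Ioo 0 C.υmax ×ˢ univ)

/-- The contraction `i_v η` with the rigging vector field. -/
def iv (C : RiggedBoundary m M N) {k : ℕ} (η : SpForm (m + 2) (k + 1) M) : SpForm (m + 2) k M :=
  interior C.v η

/-- The pullback `π_υ^* η` to `N`. -/
def pull (C : RiggedBoundary m M N) (υ : ℝ) {k : ℕ} (η : SpForm (m + 2) k M) :
    SpForm (m + 1) k N :=
  pullback (C.flow υ) η

/-- The contraction of an alternating map on the tangent space at a point of `N` with `v`. -/
def ivAt (C : RiggedBoundary m M N) (q : N) {k : ℕ} (α : (Eu (m + 2)) [⋀^Fin (k + 1)]→L[ℝ] ℝ) :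
    (Eu (m + 2)) [⋀^Fin k]→L[ℝ] ℝ :=
  α.curryLeft (C.v (C.flow 0 q) : Eu (m + 2))

/-- The restriction to `T_q N` of an alternating map on the tangent space of `M` at `q ∈ N`. -/
def restrictAt (C : RiggedBoundary m M N) (q : N) {k : ℕ}
    (α : (Eu (m + 2)) [⋀^Fin k]→L[ℝ] ℝ) : (Eu (m + 1)) [⋀^Fin k]→L[ℝ] ℝ :=
  pullAt (C.flow 0) q α

/-- The defining equations of the counterterms `B` and `Λ` in terms of integrals along the flow:
`i_v B = 0`, `π_υ^* B = ∫_υ^{υ₀} π_s^* i_v L ds`, `i_v Λ = 0`,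
`π_υ^* Λ = - ∫_υ^{υ₀} π_s^* i_v θ ds`. -/
structure IsCounterterm (C : RiggedBoundary m M N) (υ₀ : ℝ)
    (L : S → SpForm (m + 2) (m + 2) M) (θ : FieldOneForm S (SpForm (m + 2) (m + 1) M))
    (B : S → SpForm (m + 2) (m + 1) M) (Λ : FieldOneForm S (SpForm (m + 2) m M)) : Prop where
  int_B : ∀ φ, IsHorizontalOn C.v C.region (B φ)
  pull_B : ∀ φ, ∀ υ ∈ Ioo 0 C.υmax, ∀ q,
    C.pull υ (B φ) q = ∫ s in υ..υ₀, C.pull s (C.iv (L φ)) q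
  int_Λ : ∀ {r : ℕ} (p : Eu r → S) (hp : IsPlot p) (u h : Eu r),
    IsHorizontalOn C.v C.region (Λ.toFun p hp u h)
  pull_Λ : ∀ {r : ℕ} (p : Eu r → S) (hp : IsPlot p) (u h : Eu r), ∀ υ ∈ Ioo 0 C.υmax, ∀ q,
    C.pull υ (Λ.toFun p hp u h) q = -∫ s in υ..υ₀, C.pull s (C.iv (θ.toFun p hp u h)) q

/-- `L_ren` and `θ_ren` have finite limits at every point of `N`, and the limits of `i_v L_ren`,
`i_v θ_ren` and `θ_ren`, pulled back to `N`, are the forms `L₀`, `θI₀` and `θ₀` on `N`. -/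
def RenormalizesTo (C : RiggedBoundary m M N)
    (L : S → SpForm (m + 2) (m + 2) M) (θ : FieldOneForm S (SpForm (m + 2) (m + 1) M))
    (B : S → SpForm (m + 2) (m + 1) M) (Λ : FieldOneForm S (SpForm (m + 2) m M))
    (L₀ : S → SpForm (m + 1) (m + 1) N) (θI₀ : FieldOneForm S (SpForm (m + 1) m N))
    (θ₀ : FieldOneForm S (SpForm (m + 1) (m + 1) N)) : Prop :=
  (∀ φ q, ∃ α, HasLimitAt C.region (lagRen L B φ) (C.flow 0 q) α ∧
    C.restrictAt q (C.ivAt q α) = L₀ φ q) ∧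
  ∀ {r : ℕ} (p : Eu r → S) (hp : IsPlot p) (u h : Eu r) (q : N),
    ∃ α, HasLimitAt C.region (thetaRen θ B Λ p hp u h) (C.flow 0 q) α ∧
      C.restrictAt q (C.ivAt q α) = θI₀.toFun p hp u h q ∧
      C.restrictAt q α = θ₀.toFun p hp u h q

end RiggedBoundary

/-! ### Expansions in powers of `Φ` and `Φ log Φ` -/

/-- `υ^t f(υ, u)` is a smooth function of `υ` and `υ log υ` (and of the parameter `u` and of the
point of `N`), near `υ = 0`, with Taylor coefficients `c`; that is,
`f(υ, u) ~ ∑_{p ≥ -t} ∑_{q ≥ 0} c^{(p,q)}(u) υ^p (υ log υ)^q` as `υ → 0`. Here `c^{(i - t, j)}`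
is the coefficient of `a^i b^j` in the Taylor series of the smooth function `H(a, b, ·)`. -/
def HasLogExpansion {d k r : ℕ} {N : Type*} [TopologicalSpace N] [ChartedSpace (Eu d) N]
    (t : ℕ) (υmax : ℝ) (f : ℝ → Eu r → SpForm d k N) (c : ℤ → ℕ → Eu r → SpForm d k N) : Prop :=
  ∀ (u₀ : Eu r) (q₀ : N), ∃ (O : Set (ℝ × ℝ × Eu r × Eu d))
    (H : ℝ × ℝ × Eu r × Eu d → (Eu d) [⋀^Fin k]→L[ℝ] ℝ),
    IsOpen O ∧ (0, 0, u₀, extChartAt (𝓡 d) q₀ q₀) ∈ O ∧ ContDiffOn ℝ ∞ H O ∧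
    (∀ υ u y, 0 < υ → υ < υmax → y ∈ (extChartAt (𝓡 d) q₀).target →
      (υ, υ * Real.log υ, u, y) ∈ O →
      υ ^ t • inChart q₀ (f υ u) y = H (υ, υ * Real.log υ, u, y)) ∧
    ∀ u y, y ∈ (extChartAt (𝓡 d) q₀).target → (0, 0, u, y) ∈ O → ∀ i j : ℕ,
      inChart q₀ (c ((i : ℤ) - t) j u) y = ((Nat.factorial i : ℝ)⁻¹ * (Nat.factorial j : ℝ)⁻¹) •
        iteratedDeriv i (fun a : ℝ => iteratedDeriv j (fun b : ℝ => H (a, b, u, y)) 0) 0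

section Coefficients

variable {V : Type*} [AddCommGroup V] [Module ℝ V]

/-- The function `υ^p (υ log υ)^q`. -/
def logMonomial (p : ℤ) (q : ℕ) (υ : ℝ) : ℝ := υ ^ p * (υ * Real.log υ) ^ q

/-- For `k ≠ 0`:
`∑_{j = -t}^{min (p - 1, -1)} (1/k) {∏_{l = j + 1}^{p - 1} (l/k - 1)} c^{(j, k - j - 1)}`. -/
def powCoeff (t : ℕ) (c : ℤ → ℕ → V) (k p : ℤ) : V :=
  ∑ j ∈ Finset.Icc (-(t : ℤ)) (min (p - 1) (-1)),
    ((1 / (k : ℝ)) * ∏ l ∈ Finset.Icc (j + 1) (p - 1), ((l : ℝ) / (k : ℝ) - 1)) •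
      c j (k - j - 1).toNat

/-- `-(1/p) c^{(p, -p - 1)}`, the coefficient for `k = 0`. -/
def logCoeff (c : ℤ → ℕ → V) (p : ℤ) : V :=
  (-(1 / (p : ℝ))) • c p (-p - 1).toNat

/-- The coefficient of `υ^p (υ log υ)^q` in the antiderivative of
`∑_{p = -t}^{-1} ∑_{q ≥ 0} c^{(p,q)} υ^p (υ log υ)^q`. -/
def primCoeff (t : ℕ) (c : ℤ → ℕ → V) (p : ℤ) (q : ℕ) : V :=
  if p + q = 0 then (if p ∈ Finset.Icc (-(t : ℤ)) (-1) then logCoeff c p else 0)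
  else powCoeff t c (p + q) p

/-- The antiderivative of the divergent terms, with the series truncated at `k ≤ K`:
`∑_{k = -t+1, k ≠ 0}^{K} ∑_{p = -t+1}^{k} powCoeff k p υ^p (υ log υ)^{k-p}
  - ∑_{p = -t}^{-1} (1/p) c^{(p,-p-1)} υ^p (υ log υ)^{-p}`. -/
def primSum (t : ℕ) (K : ℤ) (c : ℤ → ℕ → V) (υ : ℝ) : V :=
  (∑ k ∈ (Finset.Icc (-(t : ℤ) + 1) K).erase 0, ∑ p ∈ Finset.Icc (-(t : ℤ) + 1) k,
    logMonomial p (k - p).toNat υ • powCoeff t c k p) +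
  ∑ p ∈ Finset.Icc (-(t : ℤ)) (-1), logMonomial p (-p).toNat υ • logCoeff c p

/-- The terms `p + q < K` of the divergent part `∑_{p = -t}^{-1} ∑_{q ≥ 0} c^{(p,q)} υ^p
(υ log υ)^q`. -/
def divSum (t : ℕ) (K : ℤ) (c : ℤ → ℕ → V) (υ : ℝ) : V :=
  ∑ p ∈ Finset.Icc (-(t : ℤ)) (-1), ∑ q ∈ Finset.range (K - p).toNat,
    logMonomial p q υ • c p q

end Coefficients

end HolRen

end

open HolRen Diffeology

/-! Everything is read in flow coordinates `(s, y)`: start at the point of `N` with coordinates `y`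
and follow `v` for the time `s`. Since `v(Φ) = 1` and `Φ = 0` on `N`, the flow time equals `Φ`; with
uniqueness of integral curves this makes the flow injective (`flow_injective`). Variations of the
flow solve a linear ODE, so they cannot start to vanish, and the coordinates form a local
diffeomorphism up to and including `s = 0` (`dpar_injective`). Convergence of a form in flow
coordinates therefore implies convergence of all its components in a chart of `M`
(`exists_hasLimitAt`).

In these coordinates `v` is `∂_s`, and a form amounts to its tangential part `π_s^* η` and its
normal part `π_s^* i_v η`; it has a limit as soon as both parts converge. The homotopy formula
`π_s^* i_v d η = ∂_s π_s^* η - d π_s^* i_v η` (`norml_extDeriv`) shows that horizontal counterterms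
change the normal parts by flow derivatives only: `π_s^* i_v L_ren = π_s^* i_v L + ∂_s π_s^* B` and
`π_s^* i_v θ_ren = π_s^* i_v θ - ∂_s π_s^* Λ`. The form `L_ren` has top degree and hence no
tangential part. For `θ_ren` the equation `δ L = d θ` gives `∂_s π_s^* θ_ren = δ π_s^* i_v L_ren + d
π_s^* i_v θ_ren` (`hasDerivAt_tang_thetaRen`), so control of the normal parts controls the
tangential part.

For the integral counterterms the fundamental theorem of calculus cancels the normal parts exactly.
Then `π_s^* θ_ren` is independent of `s`, and it is evaluated at `υ₀`, where `B` and `Λ` pull back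
to zero.

For the explicit counterterms only the divergent terms are cancelled. Differentiation of `s^p (s log
s)^q` couples coefficients with the same `p + q`, and `powCoeff` and `logCoeff` solve the resulting
recursion (`primCoeff_rec`). The normal parts are then free of negative powers `p` for all `p + q <
K`, and since `K ≥ 1` the remainder, a positive power of `s` times powers of the logarithm, tends to
zero. This cancellation holds on a neighbourhood in the parameters and in the points of `N`, so `δ`
and `d` of the normal parts converge too (`IsFlat.fderiv`) and `∂_s π_s^* θ_ren` is bounded. Hence
`π_s^* θ_ren` converges although its own divergent terms are never computed. A limit of a log-smooth
expansion must be its finite part (`tcoef_eq_of_tendsto`), and the counterterms do not change that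
part because their series have no constant term (`primCoeff_zero_zero`). -/

namespace HolRen

noncomputable section

/-! ### Alternating forms on a product with a line -/

section Alternating

open ContinuousAlternatingMap

variable {E F : Type*} [NormedAddCommGroup E] [NormedSpace ℝ E]
  [NormedAddCommGroup F] [NormedSpace ℝ F] {k : ℕ}

instance finiteDimensional_continuousAlternatingMap [FiniteDimensional ℝ E] :
    FiniteDimensional ℝ (E [⋀^Fin k]→L[ℝ] ℝ) := by
  let Φ : (E [⋀^Fin k]→L[ℝ] ℝ) →ₗ[ℝ] MultilinearMap ℝ (fun _ : Fin k => E) ℝ :=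
    { toFun := fun α => α.toMultilinearMap
      map_add' := fun _ _ => rfl
      map_smul' := fun _ _ => rfl }
  refine FiniteDimensional.of_injective Φ fun α β h => ?_
  ext v
  exact congrArg (fun f : MultilinearMap ℝ (fun _ : Fin k => E) ℝ => f v) h

instance finiteDimensional_continuousMultilinearMap [FiniteDimensional ℝ E] :
    FiniteDimensional ℝ (ContinuousMultilinearMap ℝ (fun _ : Fin k => E) ℝ) := by
  let Φ : (ContinuousMultilinearMap ℝ (fun _ : Fin k => E) ℝ) →ₗ[ℝ]
      MultilinearMap ℝ (fun _ : Fin k => E) ℝ :=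
    { toFun := fun α => α.toMultilinearMap
      map_add' := fun _ _ => rfl
      map_smul' := fun _ _ => rfl }
  refine FiniteDimensional.of_injective Φ fun α β h => ?_
  ext v
  exact congrArg (fun f : MultilinearMap ℝ (fun _ : Fin k => E) ℝ => f v) h

/-- An injective continuous linear map between finite-dimensional spaces has a continuous linear
left inverse. -/
lemma exists_continuous_leftInverse {V W : Type*} [NormedAddCommGroup V] [NormedSpace ℝ V]
    [NormedAddCommGroup W] [NormedSpace ℝ W] [FiniteDimensional ℝ W] (T : V →L[ℝ] W)
    (hT : ∀ v, T v = 0 → v = 0) : ∃ R : W →L[ℝ] V, ∀ v, R (T v) = v := by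
  obtain ⟨R, hR⟩ := LinearMap.exists_leftInverse_of_injective (T : V →ₗ[ℝ] W)
    (LinearMap.ker_eq_bot'.2 hT)
  exact ⟨LinearMap.toContinuousLinearMap R, fun v => congrArg (fun f : V →ₗ[ℝ] V => f v) hR⟩

/-- Composition of alternating forms with linear maps depends smoothly on both. -/
lemma contDiff_compContinuousLinearMap [FiniteDimensional ℝ E] [FiniteDimensional ℝ F]
    {n : WithTop ℕ∞} :
    ContDiff ℝ n (fun x : (F [⋀^Fin k]→L[ℝ] ℝ) × (E →L[ℝ] F) =>
      x.1.compContinuousLinearMap x.2) := by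
  obtain ⟨R, hR⟩ := exists_continuous_leftInverse
    (toContinuousMultilinearMapCLM ℝ : (E [⋀^Fin k]→L[ℝ] ℝ) →L[ℝ] _)
    (fun v hv => toContinuousMultilinearMap_injective hv)
  have h1 : ContDiff ℝ n (fun x : (F [⋀^Fin k]→L[ℝ] ℝ) × (E →L[ℝ] F) =>
      (ContinuousMultilinearMap.compContinuousLinearMapContinuousMultilinear ℝ
        (fun _ : Fin k => E) (fun _ : Fin k => F) ℝ (fun _ => x.2))
        (toContinuousMultilinearMapCLM ℝ x.1)) := by
    refine ContDiff.clm_apply ?_ ?_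
    · exact (ContinuousMultilinearMap.contDiff _).comp (contDiff_pi.2 fun _ => contDiff_snd)
    · exact (ContinuousLinearMap.contDiff _).comp contDiff_fst
  convert R.contDiff.comp h1 using 1
  funext x
  exact (hR (x.1.compContinuousLinearMap x.2)).symm

/-- The part of a form on `ℝ × E` that is tangent to the slices. -/
def tang (k : ℕ) (E : Type*) [NormedAddCommGroup E] [NormedSpace ℝ E] :
    ((ℝ × E) [⋀^Fin k]→L[ℝ] ℝ) →L[ℝ] (E [⋀^Fin k]→L[ℝ] ℝ) :=
  compContinuousLinearMapCLM (ContinuousLinearMap.inr ℝ ℝ E)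

/-- Contraction of a form with a fixed vector, as a continuous linear map. -/
def contract (k : ℕ) (e : E) : (E [⋀^Fin (k + 1)]→L[ℝ] ℝ) →L[ℝ] (E [⋀^Fin k]→L[ℝ] ℝ) :=
  (ContinuousLinearMap.apply ℝ (E [⋀^Fin k]→L[ℝ] ℝ) e).comp
    (curryLeftLI (𝕜 := ℝ) (E := E) (F := ℝ) (n := k)).toContinuousLinearMap

/-- The part of a form on `ℝ × E` that is normal to the slices. -/
def norml (k : ℕ) (E : Type*) [NormedAddCommGroup E] [NormedSpace ℝ E] :
    ((ℝ × E) [⋀^Fin (k + 1)]→L[ℝ] ℝ) →L[ℝ] (E [⋀^Fin k]→L[ℝ] ℝ) :=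
  (tang k E).comp (contract k ((1, 0) : ℝ × E))

lemma tang_apply_apply (α : (ℝ × E) [⋀^Fin k]→L[ℝ] ℝ) (w : Fin k → E) :
    tang k E α w = α fun i => (0, w i) := rfl

lemma norml_apply (α : (ℝ × E) [⋀^Fin (k + 1)]→L[ℝ] ℝ) :
    norml k E α = tang k E (α.curryLeft (1, 0)) := rfl

/-- A form whose contraction with the direction of the line vanishes. -/
def IsHorizontal : ∀ {k : ℕ}, ((ℝ × E) [⋀^Fin k]→L[ℝ] ℝ) → Prop
  | 0, _ => True
  | _ + 1, α => α.curryLeft (1, 0) = 0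

lemma IsHorizontal.vecCons {α : (ℝ × E) [⋀^Fin (k + 1)]→L[ℝ] ℝ} (h : IsHorizontal α)
    (w : Fin k → ℝ × E) : α (Matrix.vecCons (1, 0) w) = 0 := by
  rw [← curryLeft_apply_apply]
  rw [show α.curryLeft (1, 0) = 0 from h]
  rfl

/-- Alternation moves slot `i` to the front, up to sign. -/
lemma IsHorizontal.apply_eq_zero {α : (ℝ × E) [⋀^Fin k]→L[ℝ] ℝ} (h : IsHorizontal α)
    (w : Fin k → ℝ × E) (i : Fin k) (c : ℝ) (hi : w i = (c, 0)) : α w = 0 := by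
  cases k with
  | zero => exact i.elim0
  | succ k =>
    have hw : w = i.insertNth (c • ((1, 0) : ℝ × E)) (i.removeNth w) := by
      rw [show c • ((1, 0) : ℝ × E) = w i by rw [hi]; simp]
      exact (Fin.insertNth_self_removeNth i w).symm
    rw [hw, map_insertNth, vecCons_smul, h.vecCons]
    simp

/-- Split every argument into its slice and line components and expand multilinearly. Any term
containing a line component vanishes, so only the term with slice components in all slots remains.
-/
lemma IsHorizontal.eq_comp_snd {α : (ℝ × E) [⋀^Fin k]→L[ℝ] ℝ} (h : IsHorizontal α) :
    α = (tang k E α).compContinuousLinearMap (ContinuousLinearMap.snd ℝ ℝ E) := by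
  classical
  ext v
  have hv : v = (fun i => ((0, (v i).2) : ℝ × E)) + fun i => ((v i).1, (0 : E)) := by
    ext i <;> simp
  conv_lhs => rw [hv, map_add_univ]
  rw [Finset.sum_eq_single Finset.univ]
  · simp [tang_apply_apply, Finset.piecewise_univ]
  · intro s _ hs
    obtain ⟨i, hi⟩ : ∃ i, i ∉ s := by
      by_contra! hc
      exact hs (Finset.eq_univ_iff_forall.2 hc)
    exact h.apply_eq_zero _ i (v i).1 (by simp [Finset.piecewise, hi])
  · simp

/-- Contracting twice with the line direction gives zero, so the contraction is itself horizontal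
and is determined by its tangential part, which is `norml`. When that vanishes the form is
horizontal, hence determined by `tang`. -/
lemma eq_zero_of_tang_norml {α : (ℝ × E) [⋀^Fin (k + 1)]→L[ℝ] ℝ} (ht : tang (k + 1) E α = 0)
    (hn : norml k E α = 0) : α = 0 := by
  have h1 : IsHorizontal (α.curryLeft (1, 0)) := by
    cases k with
    | zero => trivial
    | succ k => exact curryLeft_same α _
  have h2 : IsHorizontal α := by
    change α.curryLeft (1, 0) = 0
    rw [h1.eq_comp_snd, ← norml_apply, hn]
    ext; simp
  rw [h2.eq_comp_snd, ht]
  ext; simp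

lemma isHorizontal_of_norml {α : (ℝ × E) [⋀^Fin (k + 1)]→L[ℝ] ℝ}
    (hn : norml k E α = 0) : α.curryLeft (1, 0) = 0 := by
  have h1 : IsHorizontal (α.curryLeft (1, 0)) := by
    cases k with
    | zero => trivial
    | succ k => exact curryLeft_same α _
  rw [h1.eq_comp_snd, ← norml_apply, hn]
  ext; simp

lemma isHorizontal_comp_snd (β : E [⋀^Fin k]→L[ℝ] ℝ) :
    IsHorizontal (β.compContinuousLinearMap (ContinuousLinearMap.snd ℝ ℝ E)) := by
  cases k with
  | zero => trivial
  | succ k =>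
    change ContinuousAlternatingMap.curryLeft _ _ = 0
    ext v
    simp only [curryLeft_apply_apply, compContinuousLinearMap_apply]
    exact β.map_coord_zero 0 (by simp)

lemma tang_comp_snd (β : E [⋀^Fin k]→L[ℝ] ℝ) :
    tang k E (β.compContinuousLinearMap (ContinuousLinearMap.snd ℝ ℝ E)) = β := by
  ext v; rfl

/-- A form is recovered, by a continuous linear map, from its tangential and normal parts. -/
lemma exists_recon [FiniteDimensional ℝ E] :
    ∃ R : (E [⋀^Fin (k + 1)]→L[ℝ] ℝ) × (E [⋀^Fin k]→L[ℝ] ℝ) →L[ℝ] (ℝ × E) [⋀^Fin (k + 1)]→L[ℝ] ℝ,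
      ∀ α, R (tang (k + 1) E α, norml k E α) = α :=
  exists_continuous_leftInverse ((tang (k + 1) E).prod (norml k E)) fun α hα => by
    simp only [ContinuousLinearMap.prod_apply, Prod.mk_eq_zero] at hα
    exact eq_zero_of_tang_norml hα.1 hα.2

/-- Forms of degree above the dimension vanish. -/
lemma eq_zero_of_finrank_lt [FiniteDimensional ℝ E] (hk : Module.finrank ℝ E < k)
    (α : E [⋀^Fin k]→L[ℝ] ℝ) : α = 0 := by
  ext v
  have : ¬ LinearIndependent ℝ v := fun h => by
    have := h.fintype_card_le_finrank
    simp at this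
    omega
  exact α.toAlternatingMap.map_linearDependent v this

/-! ### Exterior derivatives on a product with a line -/

lemma fderiv_clm_comp {X V W : Type*} [NormedAddCommGroup X] [NormedSpace ℝ X]
    [NormedAddCommGroup V] [NormedSpace ℝ V] [NormedAddCommGroup W] [NormedSpace ℝ W]
    (T : V →L[ℝ] W) {f : X → V} {x : X} (hf : DifferentiableAt ℝ f x) :
    fderiv ℝ (fun x => T (f x)) x = T.comp (fderiv ℝ f x) :=
  (T.hasFDerivAt.comp x hf.hasFDerivAt).fderiv

/-- The exterior derivative is an alternating sum over the vector along which one differentiates. If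
all vectors are tangent to the slice, only slice derivatives of the tangential part occur. -/
lemma tang_extDeriv {η : ℝ × E → (ℝ × E) [⋀^Fin k]→L[ℝ] ℝ} {z : ℝ × E}
    (hη : DifferentiableAt ℝ η z) :
    tang (k + 1) E (extDeriv η z) =
      alternatizeUncurryFin ((fderiv ℝ (fun z => tang k E (η z)) z).comp
        (ContinuousLinearMap.inr ℝ ℝ E)) := by
  rw [fderiv_clm_comp (tang k E) hη]
  ext w
  rw [tang_apply_apply, extDeriv, alternatizeUncurryFin_apply, alternatizeUncurryFin_apply]
  rfl

/-- The homotopy formula `π_s^* i_v d η = ∂_s π_s^* η - d π_s^* i_v η`. -/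
lemma norml_extDeriv {η : ℝ × E → (ℝ × E) [⋀^Fin (k + 1)]→L[ℝ] ℝ} {z : ℝ × E}
    (hη : DifferentiableAt ℝ η z) :
    norml (k + 1) E (extDeriv η z) = fderiv ℝ (fun z => tang (k + 1) E (η z)) z (1, 0) -
      alternatizeUncurryFin ((fderiv ℝ (fun z => norml k E (η z)) z).comp
        (ContinuousLinearMap.inr ℝ ℝ E)) := by
  rw [fderiv_clm_comp (tang (k + 1) E) hη, fderiv_clm_comp (norml k E) hη]
  ext w
  -- The summand of index `0` differentiates along the line and gives the first term. In the others
  -- `(1, 0)` stays in the first slot, and the shift of the index by one produces the minus sign.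
  rw [norml_apply, tang_apply_apply, curryLeft_apply_apply, extDeriv, alternatizeUncurryFin_apply,
    ContinuousAlternatingMap.sub_apply, alternatizeUncurryFin_apply, Fin.sum_univ_succ]
  simp only [Fin.val_zero, pow_zero, one_smul, Fin.val_succ, pow_succ, mul_neg, mul_one, neg_smul,
    Finset.sum_neg_distrib, sub_eq_add_neg]
  refine congrArg₂ (fun a b : ℝ => a + -b) rfl (Finset.sum_congr rfl fun i _ => ?_)
  refine congrArg (fun a : ℝ => (-1 : ℤ) ^ (i : ℕ) • a) ?_
  change fderiv ℝ η z (0, w i) _ = fderiv ℝ η z (0, w i) (Matrix.vecCons (1, 0) _)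
  congr 1
  ext1 j
  cases j using Fin.cases with
  | zero => simp [Fin.removeNth]
  | succ j => simp [Fin.removeNth]

/-- The second term of the homotopy formula drops out because the normal part vanishes on a
neighbourhood, not only at `z`. Degree `0` is treated directly, since the formula needs a normal
part and hence positive degree. -/
lemma norml_extDeriv_of_isHorizontal {η : ℝ × E → (ℝ × E) [⋀^Fin k]→L[ℝ] ℝ} {z : ℝ × E}
    (hη : DifferentiableAt ℝ η z) (hh : ∀ᶠ z' in 𝓝 z, IsHorizontal (η z')) :
    norml k E (extDeriv η z) = fderiv ℝ (fun z => tang k E (η z)) z (1, 0) := by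
  cases k with
  | zero =>
    rw [fderiv_clm_comp (tang 0 E) hη]
    ext w
    rw [norml_apply, tang_apply_apply, curryLeft_apply_apply, extDeriv,
      alternatizeUncurryFin_apply]
    simp only [Nat.reduceAdd, Finset.univ_unique, Finset.sum_singleton]
    simp
    rfl
  | succ k =>
    have h0 : (fun z => norml k E (η z)) =ᶠ[𝓝 z] fun _ => 0 := by
      filter_upwards [hh] with z' hz'
      rw [norml_apply, show (η z').curryLeft (1, 0) = 0 from hz', _root_.map_zero]
    rw [norml_extDeriv hη, h0.fderiv_eq]
    simp only [fderiv_fun_const, Pi.zero_apply, ContinuousLinearMap.zero_comp]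
    rw [← alternatizeUncurryFinCLM_apply, _root_.map_zero, sub_zero]

end Alternating

end

end HolRen

namespace HolRen

noncomputable section

/-! ### Smooth dependence of integrals on parameters -/

section ParametricIntegral

open MeasureTheory
open scoped Interval

universe u

/-- Tube lemma for the compact interval `[0, 1]`. -/
lemma isOpen_slab {Z : Type*} [TopologicalSpace Z] {W : Set (ℝ × Z)} (hW : IsOpen W) :
    IsOpen {z : Z | ∀ τ ∈ Icc (0 : ℝ) 1, (τ, z) ∈ W} := by
  rw [isOpen_iff_eventually]
  intro z hz
  exact isCompact_Icc.eventually_forall_of_forall_eventually fun τ hτ =>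
    (continuous_swap.tendsto (z, τ)).eventually (hW.mem_nhds (hz τ hτ))

variable {Z V : Type u} [NormedAddCommGroup Z] [NormedSpace ℝ Z] [FiniteDimensional ℝ Z]
  [NormedAddCommGroup V] [NormedSpace ℝ V]

/-- Differentiation under the integral sign. The derivative is bounded on the compact set `[0, 1] ×
closedBall z₀ ε`, and this bound is the dominating function. -/
lemma hasFDerivAt_integral_unit {W : Set (ℝ × Z)} (hW : IsOpen W) {f : ℝ × Z → V}
    (hf : ContDiffOn ℝ ∞ f W) {z₀ : Z} (hz₀ : ∀ τ ∈ Icc (0 : ℝ) 1, (τ, z₀) ∈ W) :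
    HasFDerivAt (fun z => ∫ τ in (0 : ℝ)..1, f (τ, z))
      (∫ τ in (0 : ℝ)..1, (fderiv ℝ f (τ, z₀)).comp (ContinuousLinearMap.inr ℝ ℝ Z)) z₀ := by
  have := FiniteDimensional.proper ℝ Z
  obtain ⟨ε, hε, hball⟩ := Metric.nhds_basis_closedBall.mem_iff.1
    ((isOpen_slab hW).mem_nhds hz₀)
  have hd : ContinuousOn (fun w : ℝ × Z =>
      (fderiv ℝ f w).comp (ContinuousLinearMap.inr ℝ ℝ Z)) W := by
    have h1 := hf.continuousOn_fderiv_of_isOpen hW (by simp)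
    exact h1.clm_comp continuousOn_const
  have hcomp : IsCompact (Icc (0 : ℝ) 1 ×ˢ Metric.closedBall z₀ ε) :=
    isCompact_Icc.prod (isCompact_closedBall _ _)
  have hsub : Icc (0 : ℝ) 1 ×ˢ Metric.closedBall z₀ ε ⊆ W := fun w hw => hball hw.2 w.1 hw.1
  obtain ⟨C, hC⟩ := hcomp.exists_bound_of_continuousOn (hd.mono hsub)
  have hcont : ∀ z ∈ Metric.closedBall z₀ ε, ContinuousOn (fun τ => f (τ, z)) (Icc 0 1) :=
    fun z hz => hf.continuousOn.comp (by fun_prop) fun τ hτ => hsub ⟨hτ, hz⟩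
  have hIoc : Ι (0 : ℝ) 1 ⊆ Icc 0 1 := by
    rw [uIoc_of_le zero_le_one]; exact Ioc_subset_Icc_self
  have hmeas : MeasurableSet (Ι (0 : ℝ) 1) := measurableSet_uIoc
  have hz₀' : z₀ ∈ Metric.closedBall z₀ ε := Metric.mem_closedBall_self hε.le
  refine intervalIntegral.hasFDerivAt_integral_of_dominated_of_fderiv_le
    (F := fun z τ => f (τ, z))
    (F' := fun z τ => (fderiv ℝ f (τ, z)).comp (ContinuousLinearMap.inr ℝ ℝ Z))
    (bound := fun _ => C) (Metric.closedBall_mem_nhds z₀ hε) ?_ ?_ ?_ ?_ ?_ ?_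
  · filter_upwards [Metric.closedBall_mem_nhds z₀ hε] with z hz
    exact ((hcont z hz).mono hIoc).aestronglyMeasurable hmeas
  · exact (hcont z₀ hz₀').intervalIntegrable_of_Icc zero_le_one
  · refine ContinuousOn.aestronglyMeasurable ?_ hmeas
    exact hd.comp (f := fun τ : ℝ => (τ, z₀)) (by fun_prop) fun τ hτ => hsub ⟨hIoc hτ, hz₀'⟩
  · exact ae_of_all _ fun τ hτ z hz => hC (τ, z) ⟨hIoc hτ, hz⟩
  · exact intervalIntegrable_const
  · refine ae_of_all _ fun τ hτ z hz => ?_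
    have h1 : HasFDerivAt f (fderiv ℝ f (τ, z)) (τ, z) :=
      ((hf.contDiffAt (hW.mem_nhds (hsub ⟨hIoc hτ, hz⟩))).differentiableAt (by simp)).hasFDerivAt
    exact h1.comp z (hasFDerivAt_prodMk_right τ z)

/-- Induction on the order of smoothness: the derivative is an integral of the same kind with values
in `Z →L[ℝ] V`. The target is therefore generalized in the induction, and `Z` and `V` share a
universe so that the new target is admissible. -/
lemma contDiffOn_integral_unit {W : Set (ℝ × Z)} (hW : IsOpen W) {f : ℝ × Z → V}
    (hf : ContDiffOn ℝ ∞ f W) :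
    ContDiffOn ℝ ∞ (fun z => ∫ τ in (0 : ℝ)..1, f (τ, z))
      {z : Z | ∀ τ ∈ Icc (0 : ℝ) 1, (τ, z) ∈ W} := by
  have hO := isOpen_slab hW
  rw [contDiffOn_infty]
  intro n
  induction n generalizing V with
  | zero =>
    rw [Nat.cast_zero, contDiffOn_zero]
    exact fun z hz => (hasFDerivAt_integral_unit hW hf hz).continuousAt.continuousWithinAt
  | succ n ih =>
    rw [Nat.cast_succ, contDiffOn_succ_iff_fderiv_of_isOpen hO]
    refine ⟨fun z hz =>
      (hasFDerivAt_integral_unit hW hf hz).differentiableAt.differentiableWithinAt, by simp, ?_⟩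
    refine (ih (f := fun w => (fderiv ℝ f w).comp (ContinuousLinearMap.inr ℝ ℝ Z)) ?_).congr
      fun z hz => (hasFDerivAt_integral_unit hW hf hz).fderiv
    exact (hf.fderiv_of_isOpen hW (by simp)).clm_comp contDiffOn_const

/-- An integral from a variable to a fixed endpoint depends smoothly on the variable and on the
parameters. -/
lemma contDiffOn_integral_left {I : Set ℝ} (hI : IsOpen I) (hIc : I.OrdConnected) {s₀ : ℝ}
    (hs₀ : s₀ ∈ I) {O : Set Z} (hO : IsOpen O) {f : ℝ × Z → V}
    (hf : ContDiffOn ℝ ∞ f (I ×ˢ O)) {Y : Type u} [NormedAddCommGroup Y] [NormedSpace ℝ Y]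
    [FiniteDimensional ℝ Y] (σ : Y →L[ℝ] ℝ) (ζ : Y →L[ℝ] Z) :
    ContDiffOn ℝ ∞ (fun y => ∫ s in (σ y)..s₀, f (s, ζ y)) (σ ⁻¹' I ∩ ζ ⁻¹' O) := by
  -- The substitution `s = σ y + τ (s₀ - σ y)` replaces the variable endpoint by the fixed interval
  -- `[0, 1]`.
  let c : ℝ × Y → ℝ × Z := fun w => (σ w.2 + w.1 * (s₀ - σ w.2), ζ w.2)
  have hc : ContDiff ℝ ∞ c := by
    refine ContDiff.prodMk ?_ (ζ.contDiff.comp contDiff_snd)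
    have h2 : ContDiff ℝ ∞ (fun w : ℝ × Y => σ w.2) := σ.contDiff.comp contDiff_snd
    exact h2.add (contDiff_fst.mul (contDiff_const.sub h2))
  have h1 : ContDiffOn ℝ ∞ (fun w => (s₀ - σ w.2) • f (c w)) (c ⁻¹' (I ×ˢ O)) := by
    refine ContDiffOn.smul ?_ (hf.comp hc.contDiffOn fun w hw => hw)
    exact (contDiff_const.sub (σ.contDiff.comp contDiff_snd)).contDiffOn
  refine ((contDiffOn_integral_unit ((hI.prod hO).preimage hc.continuous) h1).congr
    fun y _ => ?_).mono ?_
  · by_cases h : s₀ - σ y = 0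
    · simp only [c, sub_eq_zero.1 h, sub_self, zero_smul, intervalIntegral.integral_zero,
        intervalIntegral.integral_same]
    · have h3 := intervalIntegral.smul_integral_comp_add_mul (a := 0) (b := 1)
        (fun s => f (s, ζ y)) (s₀ - σ y) (σ y)
      simp only [c]
      rw [intervalIntegral.integral_smul]
      simp only [mul_comm _ (s₀ - σ y)]
      rw [h3]
      congr 1 <;> ring
  · rintro y ⟨hy1, hy2⟩ τ hτ
    refine ⟨?_, hy2⟩
    -- The substituted times stay in `I`, because `I` is order-connected and contains both
    -- endpoints.
    have := hIc.uIcc_subset hy1 hs₀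
    refine this ?_
    have h4 : σ y + τ * (s₀ - σ y) ∈ segment ℝ (σ y) s₀ :=
      ⟨1 - τ, τ, by linarith [hτ.2], hτ.1, by ring, by simp [smul_eq_mul]; ring⟩
    rwa [segment_eq_uIcc] at h4

end ParametricIntegral

end

end HolRen

namespace HolRen

noncomputable section

/-! ### Directional derivatives of smooth functions -/

section DirectionalDerivatives

variable {X V : Type*} [NormedAddCommGroup X] [NormedSpace ℝ X]
  [NormedAddCommGroup V] [NormedSpace ℝ V]

/-- The derivative of `H` in the constant direction `e`. -/
def dDir (e : X) (H : X → V) : X → V := fun w => fderiv ℝ H w e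

lemma contDiff_dDir (e : X) {H : X → V} (hH : ContDiff ℝ ∞ H) : ContDiff ℝ ∞ (dDir e H) :=
  (hH.fderiv_right (by simp)).clm_apply contDiff_const

lemma contDiff_iterate_dDir (e : X) {H : X → V} (hH : ContDiff ℝ ∞ H) (n : ℕ) :
    ContDiff ℝ ∞ ((dDir e)^[n] H) := by
  induction n with
  | zero => exact hH
  | succ n ih => rw [Function.iterate_succ_apply']; exact contDiff_dDir e ih

lemma two_le_infty : (2 : WithTop ℕ∞) ≤ ∞ := WithTop.coe_le_coe.2 le_top

lemma fderiv_fderiv_apply_comm {H : X → V} {w : X} (hH : ContDiffAt ℝ ∞ H w) (e e' : X) :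
    fderiv ℝ (fun w => fderiv ℝ H w e') w e = fderiv ℝ (fun w => fderiv ℝ H w e) w e' := by
  have hd : DifferentiableAt ℝ (fderiv ℝ H) w :=
    (hH.fderiv_right (m := 1) (by simpa [one_add_one_eq_two] using two_le_infty)).differentiableAt (by simp)
  have h := hH.isSymmSndFDerivAt (by simpa using two_le_infty) e e'
  rw [fderiv_clm_apply hd (differentiableAt_const _), fderiv_clm_apply hd (differentiableAt_const _)]
  simpa using h

lemma dDir_comm {H : X → V} (hH : ContDiff ℝ ∞ H) (e e' : X) :
    dDir e (dDir e' H) = dDir e' (dDir e H) :=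
  funext fun _ => fderiv_fderiv_apply_comm hH.contDiffAt e e'

lemma dDir_iterate_comm {H : X → V} (hH : ContDiff ℝ ∞ H) (e e' : X) (n : ℕ) :
    dDir e ((dDir e')^[n] H) = (dDir e')^[n] (dDir e H) := by
  induction n generalizing H with
  | zero => rfl
  | succ n ih =>
    rw [Function.iterate_succ_apply, Function.iterate_succ_apply, ih (contDiff_dDir e' hH),
      dDir_comm hH]

lemma iterate_dDir_add (e : X) {H G : X → V} (hH : ContDiff ℝ ∞ H) (hG : ContDiff ℝ ∞ G) (n : ℕ) :
    (dDir e)^[n] (fun w => H w + G w) = fun w => (dDir e)^[n] H w + (dDir e)^[n] G w := by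
  induction n generalizing H G with
  | zero => rfl
  | succ n ih =>
    simp only [Function.iterate_succ_apply]
    rw [← ih (contDiff_dDir e hH) (contDiff_dDir e hG)]
    congr 1
    funext w
    have h1 := hH.contDiffAt (x := w) |>.differentiableAt (by simp)
    have h2 := hG.contDiffAt (x := w) |>.differentiableAt (by simp)
    simp only [dDir]
    rw [fderiv_fun_add h1 h2]
    rfl

lemma iterate_dDir_clm {V' : Type*} [NormedAddCommGroup V'] [NormedSpace ℝ V'] (T : V →L[ℝ] V')
    (e : X) {H : X → V} (hH : ContDiff ℝ ∞ H) (n : ℕ) :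
    (dDir e)^[n] (fun w => T (H w)) = fun w => T ((dDir e)^[n] H w) := by
  induction n generalizing H with
  | zero => rfl
  | succ n ih =>
    simp only [Function.iterate_succ_apply]
    rw [← ih (contDiff_dDir e hH)]
    congr 1
    funext w
    simp only [dDir]
    rw [fderiv_clm_comp T (hH.contDiffAt.differentiableAt (by simp))]
    rfl

/-- Leibniz rule: a linear factor has no second derivative, so only two terms survive. For `n = 0`
the factor `n` makes the truncated index `n - 1` harmless. -/
lemma iterate_dDir_smul (ℓ : X →L[ℝ] ℝ) (e : X) {H : X → V} (hH : ContDiff ℝ ∞ H) (n : ℕ) :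
    (dDir e)^[n] (fun w => ℓ w • H w) =
      fun w => ℓ w • (dDir e)^[n] H w + (n * ℓ e) • (dDir e)^[n - 1] H w := by
  induction n with
  | zero => simp
  | succ n ih =>
    rw [Function.iterate_succ_apply', ih]
    funext w
    have h1 : DifferentiableAt ℝ ((dDir e)^[n] H) w :=
      (contDiff_iterate_dDir e hH n).contDiffAt.differentiableAt (by simp)
    have h2 : DifferentiableAt ℝ ((dDir e)^[n - 1] H) w :=
      (contDiff_iterate_dDir e hH (n - 1)).contDiffAt.differentiableAt (by simp)
    simp only [dDir]
    have h5 : DifferentiableAt ℝ (fun w => ℓ w • (dDir e)^[n] H w) w := ℓ.differentiableAt.smul h1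
    have h6 : DifferentiableAt ℝ (fun w => (n * ℓ e) • (dDir e)^[n - 1] H w) w := h2.const_smul _
    rw [fderiv_fun_add h5 h6, fderiv_fun_smul ℓ.differentiableAt h1, fderiv_fun_const_smul h2]
    simp only [ContinuousLinearMap.fderiv, add_apply,
      smul_apply, ContinuousLinearMap.smulRight_apply, Nat.add_sub_cancel]
    have h3 : fderiv ℝ ((dDir e)^[n] H) w e = (dDir e)^[n + 1] H w := by
      rw [Function.iterate_succ_apply']; rfl
    have h4 : (n * ℓ e) • fderiv ℝ ((dDir e)^[n - 1] H) w e = (n * ℓ e) • (dDir e)^[n] H w := by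
      cases n with
      | zero => simp
      | succ n => rw [Function.iterate_succ_apply' _ n]; rfl
    rw [h4]
    change ℓ w • fderiv ℝ ((dDir e)^[n] H) w e + ℓ e • (dDir e)^[n] H w + _ = _
    rw [h3]
    push_cast
    module

lemma iterate_dDir_fderiv_apply (e e' : X) {H : X → V} (hH : ContDiff ℝ ∞ H) (n : ℕ) (w : X) :
    (dDir e)^[n] (fderiv ℝ H) w e' = fderiv ℝ ((dDir e)^[n] H) w e' := by
  have h := iterate_dDir_clm (ContinuousLinearMap.apply ℝ V e') e
    (hH.fderiv_right (m := ∞) (by simp)) n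
  have h2 := congrFun (dDir_iterate_comm hH e' e n) w
  have h3 := congrFun h w
  exact h3.symm.trans h2.symm

/-- A function that is smooth near a point agrees near this point with a globally smooth one. -/
lemma exists_contDiff_eventuallyEq [FiniteDimensional ℝ X] {O : Set X} (hO : IsOpen O) {x : X}
    (hx : x ∈ O) {H : X → V} (hH : ContDiffOn ℝ ∞ H O) :
    ∃ G : X → V, ContDiff ℝ ∞ G ∧ G =ᶠ[𝓝 x] H := by
  obtain ⟨ε, hε, hb⟩ := Metric.nhds_basis_closedBall.mem_iff.1 (hO.mem_nhds hx)
  -- A bump function that is one on the ball of radius `ε / 2` and vanishes outside the ball of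
  -- radius `ε`, near which `H` is smooth.
  let χ : ContDiffBump x := ⟨ε / 2, ε, half_pos hε, half_lt_self hε⟩
  refine ⟨fun w => χ w • H w, ?_, ?_⟩
  · rw [contDiff_iff_contDiffAt]
    intro w
    by_cases hw : w ∈ Metric.closedBall x ε
    · exact χ.contDiff.contDiffAt.smul (hH.contDiffAt (hO.mem_nhds (hb hw)))
    · have : (fun w => χ w • H w) =ᶠ[𝓝 w] fun _ => 0 := by
        filter_upwards [Metric.isClosed_closedBall.isOpen_compl.mem_nhds hw] with y hy
        rw [χ.zero_of_le_dist, zero_smul]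
        simp only [mem_compl_iff, Metric.mem_closedBall, not_le] at hy
        exact hy.le
      exact contDiffAt_const.congr_of_eventuallyEq this
  · filter_upwards [χ.eventuallyEq_one] with w hw
    simp only [Pi.one_apply] at hw
    rw [hw, one_smul]

end DirectionalDerivatives

/-! ### Taylor coefficients in two of the variables -/

section TaylorCoefficients

variable {Z V V' : Type*} [NormedAddCommGroup Z] [NormedSpace ℝ Z]
  [NormedAddCommGroup V] [NormedSpace ℝ V] [NormedAddCommGroup V'] [NormedSpace ℝ V']

/-- The coefficient of `a^i b^j` in the Taylor series of `H(a, b, z)`. -/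
def tcoef {Z : Type*} (i j : ℕ) (H : ℝ × ℝ × Z → V) (z : Z) : V :=
  ((Nat.factorial i : ℝ)⁻¹ * (Nat.factorial j : ℝ)⁻¹) •
    iteratedDeriv i (fun a : ℝ => iteratedDeriv j (fun b : ℝ => H (a, b, z)) 0) 0

/-- The direction of the first variable. -/
def eA : ℝ × ℝ × Z := (1, 0, 0)

/-- The direction of the second variable. -/
def eB : ℝ × ℝ × Z := (0, 1, 0)

lemma hasDerivAt_dDir_eA {H : ℝ × ℝ × Z → V} (hH : ContDiff ℝ ∞ H) (a b : ℝ) (z : Z) :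
    HasDerivAt (fun a => H (a, b, z)) (dDir eA H (a, b, z)) a := by
  have h1 : HasFDerivAt H (fderiv ℝ H (a, b, z)) (a, b, z) :=
    (hH.contDiffAt.differentiableAt (by simp)).hasFDerivAt
  exact h1.comp_hasDerivAt a ((hasDerivAt_id a).prodMk (hasDerivAt_const a (b, z)))

lemma hasDerivAt_dDir_eB {H : ℝ × ℝ × Z → V} (hH : ContDiff ℝ ∞ H) (a b : ℝ) (z : Z) :
    HasDerivAt (fun b => H (a, b, z)) (dDir eB H (a, b, z)) b := by
  have h1 : HasFDerivAt H (fderiv ℝ H (a, b, z)) (a, b, z) :=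
    (hH.contDiffAt.differentiableAt (by simp)).hasFDerivAt
  exact h1.comp_hasDerivAt b
    ((hasDerivAt_const b a).prodMk ((hasDerivAt_id b).prodMk (hasDerivAt_const b z)))

/-- Iterated directional derivatives are again smooth in all variables, and they commute. In this
form the rules for Taylor coefficients follow from linearity, the Leibniz rule and commutation. -/
lemma tcoef_eq {H : ℝ × ℝ × Z → V} (hH : ContDiff ℝ ∞ H) (i j : ℕ) (z : Z) :
    tcoef i j H z = ((Nat.factorial i : ℝ)⁻¹ * (Nat.factorial j : ℝ)⁻¹) •
      ((dDir eA)^[i] ((dDir eB)^[j] H)) (0, 0, z) := by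
  have h1 : ∀ (j : ℕ) (H : ℝ × ℝ × Z → V), ContDiff ℝ ∞ H → ∀ a, iteratedDeriv j
      (fun b : ℝ => H (a, b, z)) = fun b => ((dDir eB)^[j] H) (a, b, z) := by
    intro j
    induction j with
    | zero => intro H _ a; simp
    | succ j ih =>
      intro H hH a
      rw [iteratedDeriv_succ', Function.iterate_succ_apply, ← ih _ (contDiff_dDir _ hH)]
      congr 1
      funext b
      exact (hasDerivAt_dDir_eB hH a b z).deriv
  have h2 : ∀ (i : ℕ) (H : ℝ × ℝ × Z → V), ContDiff ℝ ∞ H → ∀ b, iteratedDeriv i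
      (fun a : ℝ => H (a, b, z)) = fun a => ((dDir eA)^[i] H) (a, b, z) := by
    intro i
    induction i with
    | zero => intro H _ b; simp
    | succ i ih =>
      intro H hH b
      rw [iteratedDeriv_succ', Function.iterate_succ_apply, ← ih _ (contDiff_dDir _ hH)]
      congr 1
      funext a
      exact (hasDerivAt_dDir_eA hH a b z).deriv
  rw [tcoef]
  congr 1
  simp only [h1 j H hH]
  rw [h2 i _ (contDiff_iterate_dDir _ hH j)]

lemma contDiff_tcoef {H : ℝ × ℝ × Z → V} (hH : ContDiff ℝ ∞ H) (i j : ℕ) :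
    ContDiff ℝ ∞ (tcoef i j H) := by
  rw [funext (tcoef_eq hH i j)]
  have := contDiff_iterate_dDir eA (contDiff_iterate_dDir eB hH j) i
  exact contDiff_const.smul (this.comp
    (contDiff_const.prodMk (contDiff_const.prodMk contDiff_id)))

lemma tcoef_congr {Z : Type*} [TopologicalSpace Z] {H G : ℝ × ℝ × Z → V} {z : Z} (h : H =ᶠ[𝓝 (0, 0, z)] G) (i j : ℕ) :
    tcoef i j H z = tcoef i j G z := by
  have h1 : (fun a : ℝ => iteratedDeriv j (fun b : ℝ => H (a, b, z)) 0) =ᶠ[𝓝 0]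
      fun a : ℝ => iteratedDeriv j (fun b : ℝ => G (a, b, z)) 0 := by
    have h2 : ∀ᶠ p : ℝ × ℝ in 𝓝 (0, 0), H (p.1, p.2, z) = G (p.1, p.2, z) := by
      have hc : ContinuousAt (fun p : ℝ × ℝ => (p.1, p.2, z)) (0, 0) := by fun_prop
      exact hc.tendsto.eventually h
    rw [nhds_prod_eq] at h2
    filter_upwards [h2.curry] with a ha
    exact Filter.EventuallyEq.iteratedDeriv_eq j ha
  rw [tcoef, tcoef, h1.iteratedDeriv_eq]

lemma tcoef_add {H G : ℝ × ℝ × Z → V} (hH : ContDiff ℝ ∞ H) (hG : ContDiff ℝ ∞ G) (i j : ℕ)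
    (z : Z) : tcoef i j (fun w => H w + G w) z = tcoef i j H z + tcoef i j G z := by
  rw [tcoef_eq hH, tcoef_eq hG, tcoef_eq (hH.add hG), iterate_dDir_add eB hH hG,
    iterate_dDir_add eA (contDiff_iterate_dDir _ hH j) (contDiff_iterate_dDir _ hG j), smul_add]

lemma tcoef_clm (T : V →L[ℝ] V') {H : ℝ × ℝ × Z → V} (hH : ContDiff ℝ ∞ H) (i j : ℕ)
    (z : Z) : tcoef i j (fun w => T (H w)) z = T (tcoef i j H z) := by
  have hT : ContDiff ℝ ∞ (fun w => T (H w)) := T.contDiff.comp hH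
  rw [tcoef_eq hH, tcoef_eq hT, iterate_dDir_clm T eB hH,
    iterate_dDir_clm T eA (contDiff_iterate_dDir _ hH j), map_smul]

lemma tcoef_const_smul (c : ℝ) {H : ℝ × ℝ × Z → V} (hH : ContDiff ℝ ∞ H) (i j : ℕ)
    (z : Z) : tcoef i j (fun w => c • H w) z = c • tcoef i j H z :=
  tcoef_clm (c • ContinuousLinearMap.id ℝ V) hH i j z

lemma tcoef_dDir_eA {H : ℝ × ℝ × Z → V} (hH : ContDiff ℝ ∞ H) (i j : ℕ) (z : Z) :
    tcoef i j (dDir eA H) z = ((i : ℝ) + 1) • tcoef (i + 1) j H z := by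
  rw [tcoef_eq hH, tcoef_eq (contDiff_dDir _ hH), ← dDir_iterate_comm hH, smul_smul,
    ← Function.iterate_succ_apply]
  congr 1
  rw [Nat.factorial_succ]
  push_cast
  have : (Nat.factorial i : ℝ) ≠ 0 := by positivity
  have : (i : ℝ) + 1 ≠ 0 := by positivity
  field_simp

lemma tcoef_dDir_eB {H : ℝ × ℝ × Z → V} (hH : ContDiff ℝ ∞ H) (i j : ℕ) (z : Z) :
    tcoef i j (dDir eB H) z = ((j : ℝ) + 1) • tcoef i (j + 1) H z := by
  rw [tcoef_eq hH, tcoef_eq (contDiff_dDir _ hH), ← Function.iterate_succ_apply, smul_smul]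
  congr 1
  rw [Nat.factorial_succ]
  push_cast
  have : (Nat.factorial j : ℝ) ≠ 0 := by positivity
  have : (j : ℝ) + 1 ≠ 0 := by positivity
  field_simp

/-- At the origin the Leibniz term that keeps the factor `a` drops out. The other one carries the
number `i + 1`, which turns the inverse of `(i + 1)!` into that of `i!`. -/
lemma tcoef_fst_smul_succ {H : ℝ × ℝ × Z → V} (hH : ContDiff ℝ ∞ H) (i j : ℕ) (z : Z) :
    tcoef (i + 1) j (fun w => w.1 • H w) z = tcoef i j H z := by
  have hs : ContDiff ℝ ∞ (fun w : ℝ × ℝ × Z => w.1 • H w) := contDiff_fst.smul hH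
  rw [tcoef_eq hH, tcoef_eq hs]
  have h1 := iterate_dDir_smul (ContinuousLinearMap.fst ℝ ℝ (ℝ × Z)) eB hH j
  have h2 := iterate_dDir_smul (ContinuousLinearMap.fst ℝ ℝ (ℝ × Z)) eA
    (contDiff_iterate_dDir eB hH j) (i + 1)
  simp only [ContinuousLinearMap.coe_fst', eA, eB, mul_zero, zero_smul, add_zero, mul_one,
    Nat.add_sub_cancel] at h1 h2
  simp only [eA, eB]
  rw [h1, h2]
  simp only [zero_smul, zero_add, smul_smul]
  congr 1
  rw [Nat.factorial_succ]
  push_cast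
  have : (Nat.factorial i : ℝ) ≠ 0 := by positivity
  have : (i : ℝ) + 1 ≠ 0 := by positivity
  field_simp

lemma tcoef_fst_smul_zero {H : ℝ × ℝ × Z → V} (hH : ContDiff ℝ ∞ H) (j : ℕ) (z : Z) :
    tcoef 0 j (fun w => w.1 • H w) z = 0 := by
  have hs : ContDiff ℝ ∞ (fun w : ℝ × ℝ × Z => w.1 • H w) := contDiff_fst.smul hH
  rw [tcoef_eq hs]
  have h1 := iterate_dDir_smul (ContinuousLinearMap.fst ℝ ℝ (ℝ × Z)) eB hH j
  simp only [ContinuousLinearMap.coe_fst', eB, mul_zero, zero_smul, add_zero] at h1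
  simp only [eB]
  rw [h1]
  simp

lemma tcoef_snd_smul_succ {H : ℝ × ℝ × Z → V} (hH : ContDiff ℝ ∞ H) (i j : ℕ) (z : Z) :
    tcoef i (j + 1) (fun w => w.2.1 • H w) z = tcoef i j H z := by
  have hs : ContDiff ℝ ∞ (fun w : ℝ × ℝ × Z => w.2.1 • H w) :=
    (contDiff_fst.comp contDiff_snd).smul hH
  rw [tcoef_eq hH, tcoef_eq hs]
  let ℓ : ℝ × ℝ × Z →L[ℝ] ℝ :=
    (ContinuousLinearMap.fst ℝ ℝ Z).comp (ContinuousLinearMap.snd ℝ ℝ (ℝ × Z))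
  have h1 := iterate_dDir_smul ℓ eB hH (j + 1)
  have h2 := iterate_dDir_smul ℓ eA (contDiff_iterate_dDir eB hH (j + 1)) i
  have hB : ℓ eB = 1 := rfl
  have hA : ℓ eA = 0 := rfl
  have hℓ : ∀ w, ℓ w = w.2.1 := fun _ => rfl
  simp only [hA, hB, hℓ, mul_zero, zero_smul, add_zero, mul_one, Nat.add_sub_cancel] at h1 h2
  have hc1 : ContDiff ℝ ∞ (fun w : ℝ × ℝ × Z => w.2.1 • (dDir eB)^[j + 1] H w) :=
    (contDiff_fst.comp contDiff_snd).smul (contDiff_iterate_dDir eB hH (j + 1))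
  have h3 : (dDir eA)^[i] (fun w => ((j + 1 : ℕ) : ℝ) • (dDir eB)^[j] H w) =
      fun w => ((j + 1 : ℕ) : ℝ) • (dDir eA)^[i] ((dDir eB)^[j] H) w :=
    iterate_dDir_clm (((j + 1 : ℕ) : ℝ) • ContinuousLinearMap.id ℝ V) eA
      (contDiff_iterate_dDir eB hH j) i
  have hc2 : ContDiff ℝ ∞ (fun w : ℝ × ℝ × Z => ((j + 1 : ℕ) : ℝ) • (dDir eB)^[j] H w) :=
    contDiff_const.smul (contDiff_iterate_dDir eB hH j)
  rw [h1, iterate_dDir_add eA hc1 hc2, h2, h3]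
  simp only [zero_smul, zero_add, smul_smul]
  congr 1
  rw [Nat.factorial_succ]
  push_cast
  have : (Nat.factorial j : ℝ) ≠ 0 := by positivity
  have : (j : ℝ) + 1 ≠ 0 := by positivity
  field_simp

lemma tcoef_snd_smul_zero {H : ℝ × ℝ × Z → V} (hH : ContDiff ℝ ∞ H) (i : ℕ) (z : Z) :
    tcoef i 0 (fun w => w.2.1 • H w) z = 0 := by
  have hs : ContDiff ℝ ∞ (fun w : ℝ × ℝ × Z => w.2.1 • H w) :=
    (contDiff_fst.comp contDiff_snd).smul hH
  rw [tcoef_eq hs]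
  let ℓ : ℝ × ℝ × Z →L[ℝ] ℝ :=
    (ContinuousLinearMap.fst ℝ ℝ Z).comp (ContinuousLinearMap.snd ℝ ℝ (ℝ × Z))
  have h2 := iterate_dDir_smul ℓ eA hH i
  have hA : ℓ eA = 0 := rfl
  have hℓ : ∀ w, ℓ w = w.2.1 := fun _ => rfl
  simp only [hA, hℓ, mul_zero, zero_smul, add_zero] at h2
  simp only [Function.iterate_zero, id_eq]
  rw [h2]
  simp

/-- Taylor coefficients commute with derivatives with respect to the remaining variables. -/
lemma tcoef_fderiv {H : ℝ × ℝ × Z → V} (hH : ContDiff ℝ ∞ H) (i j : ℕ) (z : Z) :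
    tcoef i j (fun w => (fderiv ℝ H w).comp
      ((ContinuousLinearMap.inr ℝ ℝ (ℝ × Z)).comp (ContinuousLinearMap.inr ℝ ℝ Z))) z =
      fderiv ℝ (tcoef i j H) z := by
  have hF : ContDiff ℝ ∞ (fderiv ℝ H) := hH.fderiv_right (by simp)
  have h0 := tcoef_clm ((ContinuousLinearMap.compL ℝ Z (ℝ × ℝ × Z) V).flip
    ((ContinuousLinearMap.inr ℝ ℝ (ℝ × Z)).comp (ContinuousLinearMap.inr ℝ ℝ Z))) hF i j z
  refine h0.trans ?_
  ext x
  rw [funext (tcoef_eq hH i j), tcoef_eq hF]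
  have hI := contDiff_iterate_dDir eA (contDiff_iterate_dDir eB hH j) i
  have hc : HasFDerivAt (fun z : Z => ((0, 0, z) : ℝ × ℝ × Z))
      ((ContinuousLinearMap.inr ℝ ℝ (ℝ × Z)).comp (ContinuousLinearMap.inr ℝ ℝ Z)) z :=
    ((ContinuousLinearMap.inr ℝ ℝ (ℝ × Z)).comp (ContinuousLinearMap.inr ℝ ℝ Z)).hasFDerivAt
  have hd : HasFDerivAt ((dDir eA)^[i] ((dDir eB)^[j] H))
      (fderiv ℝ ((dDir eA)^[i] ((dDir eB)^[j] H)) (0, 0, z)) (0, 0, z) :=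
    (hI.contDiffAt.differentiableAt (by simp)).hasFDerivAt
  have h1 := (HasFDerivAt.comp z hd hc).const_smul
    ((Nat.factorial i : ℝ)⁻¹ * (Nat.factorial j : ℝ)⁻¹)
  have h1' : fderiv ℝ (fun z : Z => ((Nat.factorial i : ℝ)⁻¹ * (Nat.factorial j : ℝ)⁻¹) •
      (dDir eA)^[i] ((dDir eB)^[j] H) (0, 0, z)) z = _ := h1.fderiv
  rw [h1']
  simp only [map_smul, smul_apply]
  congr 1
  -- It remains to commute the iterated derivatives with the derivative in the fixed direction `(0,
  -- 0, x)`, once for each of the two variables.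
  have h2 : (dDir eA)^[i] ((dDir eB)^[j] (fderiv ℝ H)) (0, 0, z) (0, 0, x) =
      fderiv ℝ ((dDir eA)^[i] ((dDir eB)^[j] H)) (0, 0, z) (0, 0, x) := by
    rw [← iterate_dDir_fderiv_apply eA (0, 0, x) (contDiff_iterate_dDir eB hH j)]
    have h3 : ∀ w, ContinuousLinearMap.apply ℝ V ((0, 0, x) : ℝ × ℝ × Z)
        ((dDir eB)^[j] (fderiv ℝ H) w) =
        ContinuousLinearMap.apply ℝ V ((0, 0, x) : ℝ × ℝ × Z) (fderiv ℝ ((dDir eB)^[j] H) w) :=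
      fun w => iterate_dDir_fderiv_apply eB (0, 0, x) hH j w
    have h4 := iterate_dDir_clm (ContinuousLinearMap.apply ℝ V ((0, 0, x) : ℝ × ℝ × Z)) eA
      (contDiff_iterate_dDir eB hF j) i
    have h5 := iterate_dDir_clm (ContinuousLinearMap.apply ℝ V ((0, 0, x) : ℝ × ℝ × Z)) eA
      ((contDiff_iterate_dDir eB hH j).fderiv_right (m := ∞) (by simp)) i
    rw [funext h3] at h4
    exact congrFun (h4.symm.trans h5) (0, 0, z)
  exact h2

end TaylorCoefficients

end

end HolRen

namespace HolRen

noncomputable section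

/-! ### Polynomials in two variables -/

section Polynomials

variable {V : Type*} [NormedAddCommGroup V] [NormedSpace ℝ V]

/-- The polynomial `∑_{i + j < n} a^i b^j g_{ij}`. -/
def pol (n : ℕ) (g : ℕ → ℕ → V) (a b : ℝ) : V :=
  ∑ k ∈ Finset.range n, ∑ p ∈ Finset.HasAntidiagonal.antidiagonal k, (a ^ p.1 * b ^ p.2) • g p.1 p.2

/-- The coefficients of the derivative with respect to the first variable. -/
def shiftA (g : ℕ → ℕ → V) : ℕ → ℕ → V := fun i j => ((i : ℝ) + 1) • g (i + 1) j

/-- The coefficients of the derivative with respect to the second variable. -/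
def shiftB (g : ℕ → ℕ → V) : ℕ → ℕ → V := fun i j => ((j : ℝ) + 1) • g i (j + 1)

lemma pol_zero_zero (n : ℕ) (g : ℕ → ℕ → V) : pol (n + 1) g 0 0 = g 0 0 := by
  rw [pol, Finset.sum_eq_single 0]
  · simp
  · intro k _ hk
    refine Finset.sum_eq_zero fun p hp => ?_
    rw [Finset.HasAntidiagonal.mem_antidiagonal] at hp
    rcases Nat.eq_zero_or_pos p.1 with h1 | h1
    · have : p.2 ≠ 0 := by omega
      simp [this]
    · simp [h1.ne']
  · simp

/-- Differentiation lowers the total degree by one, which accounts for the drop from `n + 1` to `n`;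
reindexing the antidiagonals gives the shifted coefficients. -/
lemma hasDerivAt_pol (n : ℕ) (g : ℕ → ℕ → V) {α β : ℝ → ℝ} {α' β' x : ℝ}
    (hα : HasDerivAt α α' x) (hβ : HasDerivAt β β' x) :
    HasDerivAt (fun x => pol (n + 1) g (α x) (β x))
      (α' • pol n (shiftA g) (α x) (β x) + β' • pol n (shiftB g) (α x) (β x)) x := by
  have h1 : HasDerivAt (fun x => pol (n + 1) g (α x) (β x))
      (∑ k ∈ Finset.range (n + 1), ∑ p ∈ Finset.HasAntidiagonal.antidiagonal k,
        (p.1 * α x ^ (p.1 - 1) * α' * β x ^ p.2 + α x ^ p.1 * (p.2 * β x ^ (p.2 - 1) * β')) •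
          g p.1 p.2) x := by
    refine HasDerivAt.fun_sum fun k _ => HasDerivAt.fun_sum fun p _ => ?_
    exact ((hα.fun_pow p.1).mul (hβ.fun_pow p.2)).smul_const _
  convert h1 using 1
  rw [Finset.sum_range_succ']
  simp only [pol, Finset.smul_sum, ← Finset.sum_add_distrib]
  have h0 : (∑ p ∈ Finset.HasAntidiagonal.antidiagonal (0 : ℕ),
        ((p.1 : ℝ) * α x ^ (p.1 - 1) * α' * β x ^ p.2 + α x ^ p.1 * (p.2 * β x ^ (p.2 - 1) * β')) •
          g p.1 p.2) = 0 := by simp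
  rw [h0, add_zero]
  refine Finset.sum_congr rfl fun k _ => ?_
  simp only [add_smul, Finset.sum_add_distrib]
  congr 1
  · rw [Finset.Nat.sum_antidiagonal_succ]
    simp only [Nat.cast_zero, zero_mul, zero_smul, zero_add, shiftA, smul_smul, Nat.add_sub_cancel]
    refine Finset.sum_congr rfl fun p _ => ?_
    congr 1
    push_cast
    ring
  · rw [Finset.Nat.sum_antidiagonal_succ']
    simp only [Nat.cast_zero, zero_mul, mul_zero, zero_smul, zero_add, shiftB, smul_smul,
      Nat.add_sub_cancel]
    refine Finset.sum_congr rfl fun p _ => ?_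
    congr 1
    push_cast
    ring

lemma pol_clm {V' : Type*} [NormedAddCommGroup V'] [NormedSpace ℝ V'] (T : V →L[ℝ] V') (n : ℕ)
    (g : ℕ → ℕ → V) (a b : ℝ) : T (pol n g a b) = pol n (fun i j => T (g i j)) a b := by
  simp [pol, map_sum, map_smul]

lemma iteratedDeriv_pol_right (j : ℕ) : ∀ (n : ℕ) (g : ℕ → ℕ → V) (a : ℝ),
    iteratedDeriv j (fun b => pol (n + j) g a b) = fun b => pol n (shiftB^[j] g) a b := by
  induction j with
  | zero => intro n g a; simp
  | succ j ih =>
    intro n g a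
    rw [iteratedDeriv_succ', Function.iterate_succ_apply, ← ih]
    congr 1
    funext b
    have := (hasDerivAt_pol (n + j) g (hasDerivAt_const b a) (hasDerivAt_id b)).deriv
    simpa [add_assoc] using this

lemma iteratedDeriv_pol_left (i : ℕ) : ∀ (n : ℕ) (g : ℕ → ℕ → V) (b : ℝ),
    iteratedDeriv i (fun a => pol (n + i) g a b) = fun a => pol n (shiftA^[i] g) a b := by
  induction i with
  | zero => intro n g a; simp
  | succ i ih =>
    intro n g b
    rw [iteratedDeriv_succ', Function.iterate_succ_apply, ← ih]
    congr 1
    funext a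
    have := (hasDerivAt_pol (n + i) g (hasDerivAt_id a) (hasDerivAt_const a b)).deriv
    simpa [add_assoc] using this

lemma shiftB_iterate (j : ℕ) : ∀ (g : ℕ → ℕ → V) (i l : ℕ),
    shiftB^[j] g i l = (((l + j).factorial : ℝ) / (l.factorial : ℝ)) • g i (l + j) := by
  induction j with
  | zero =>
    intro g i l
    have : (l.factorial : ℝ) ≠ 0 := by positivity
    simp [this]
  | succ j ih =>
    intro g i l
    rw [Function.iterate_succ_apply, ih, shiftB, smul_smul, ← add_assoc, Nat.factorial_succ]
    congr 1
    push_cast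
    ring

lemma shiftA_iterate (i : ℕ) : ∀ (g : ℕ → ℕ → V) (l j : ℕ),
    shiftA^[i] g l j = (((l + i).factorial : ℝ) / (l.factorial : ℝ)) • g (l + i) j := by
  induction i with
  | zero =>
    intro g l j
    have : (l.factorial : ℝ) ≠ 0 := by positivity
    simp [this]
  | succ j ih =>
    intro g i l
    rw [Function.iterate_succ_apply, ih, shiftA, smul_smul, ← add_assoc, Nat.factorial_succ]
    congr 1
    push_cast
    ring

lemma pol_eq_of_le {n n' : ℕ} (hn : n ≤ n') {g : ℕ → ℕ → V} (hg : ∀ i j, n ≤ i + j → g i j = 0) :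
    pol n g = pol n' g := by
  funext a b
  refine Finset.sum_subset (Finset.range_mono hn) fun k _ hk => ?_
  refine Finset.sum_eq_zero fun p hp => ?_
  rw [Finset.HasAntidiagonal.mem_antidiagonal] at hp
  rw [hg _ _ (by simp at hk; omega), smul_zero]

/-- The Taylor coefficients of a polynomial whose coefficients depend on parameters. -/
lemma tcoef_pol {Z : Type*} (n : ℕ) (g : Z → ℕ → ℕ → V)
    (hg : ∀ z i j, n ≤ i + j → g z i j = 0) (i j : ℕ) (z : Z) :
    tcoef i j (fun w : ℝ × ℝ × Z => pol n (g w.2.2) w.1 w.2.1) z = g z i j := by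
  -- The degree bound is padded so that the constant term survives `i + j` differentiations whatever
  -- `n` is.
  have h1 : pol n (g z) = pol (n + 1 + i + j) (g z) := pol_eq_of_le (by omega) (hg z)
  rw [tcoef]
  simp only [h1]
  have h2 : (fun a : ℝ => iteratedDeriv j (fun b => pol (n + 1 + i + j) (g z) a b) 0) =
      fun a => pol (n + 1 + i) (shiftB^[j] (g z)) a 0 :=
    funext fun a => congrFun (iteratedDeriv_pol_right j (n + 1 + i) (g z) a) 0
  rw [h2, iteratedDeriv_pol_left]
  beta_reduce
  rw [pol_zero_zero, shiftA_iterate, shiftB_iterate, smul_smul, smul_smul]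
  have hi : (i.factorial : ℝ) ≠ 0 := by positivity
  have hj : (j.factorial : ℝ) ≠ 0 := by positivity
  simp only [zero_add, Nat.factorial_zero, Nat.cast_one, div_one]
  rw [show (i.factorial : ℝ)⁻¹ * (j.factorial : ℝ)⁻¹ * i.factorial * j.factorial = 1 by field_simp,
    one_smul]

end Polynomials

/-! ### Taylor's theorem and asymptotics in `s` and `s log s` -/

section Asymptotics

variable {Z V : Type*} [NormedAddCommGroup Z] [NormedSpace ℝ Z]
  [NormedAddCommGroup V] [NormedSpace ℝ V]

/-- Induction on the order. Along `τ ↦ (τ a, τ b)` the derivative of the remainder of order `n + 1`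
is `a` times the remainder of order `n` of `∂_a G` plus `b` times that of `∂_b G`, because
differentiation shifts Taylor coefficients. The mean value inequality then gains one power of `|a| +
|b|`. The parameter `z` is not expanded, so the bound is uniform near `z₀`. -/
lemma taylor_bound (n : ℕ) : ∀ {G : ℝ × ℝ × Z → V}, ContDiff ℝ ∞ G → ∀ z₀ : Z,
    ∃ C : ℝ, 0 ≤ C ∧ ∃ ε > 0, ∀ a b z, |a| < ε → |b| < ε → dist z z₀ < ε →
      ‖G (a, b, z) - pol n (fun i j => tcoef i j G z) a b‖ ≤ C * (|a| + |b|) ^ n := by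
  induction n with
  | zero =>
    intro G hG z₀
    have hc : ∀ᶠ w in 𝓝 ((0, 0, z₀) : ℝ × ℝ × Z), ‖G w‖ < ‖G (0, 0, z₀)‖ + 1 :=
      hG.continuous.norm.continuousAt.eventually (gt_mem_nhds (by linarith))
    obtain ⟨ε, hε, hb⟩ := Metric.eventually_nhds_iff.1 hc
    refine ⟨‖G (0, 0, z₀)‖ + 1, by positivity, ε, hε, fun a b z ha hb' hz => ?_⟩
    have := hb (y := (a, b, z)) (by simp [Prod.dist_eq, ha, hb', hz])
    simpa [pol] using this.le
  | succ n ih =>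
    intro G hG z₀
    obtain ⟨C₁, hC₁, ε₁, hε₁, h₁⟩ := ih (contDiff_dDir eA hG) z₀
    obtain ⟨C₂, hC₂, ε₂, hε₂, h₂⟩ := ih (contDiff_dDir eB hG) z₀
    refine ⟨C₁ + C₂, by positivity, min ε₁ ε₂, lt_min hε₁ hε₂, fun a b z ha hb hz => ?_⟩
    rw [lt_min_iff] at ha hb hz
    let R : ℝ → V := fun τ =>
      G (τ * a, τ * b, z) - pol (n + 1) (fun i j => tcoef i j G z) (τ * a) (τ * b)
    have hA : ∀ z, shiftA (fun i j => tcoef i j G z) = fun i j => tcoef i j (dDir eA G) z :=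
      fun z => funext fun i => funext fun j => (tcoef_dDir_eA hG i j z).symm
    have hB : ∀ z, shiftB (fun i j => tcoef i j G z) = fun i j => tcoef i j (dDir eB G) z :=
      fun z => funext fun i => funext fun j => (tcoef_dDir_eB hG i j z).symm
    let DA : ℝ → V := fun τ => dDir eA G (τ * a, τ * b, z) -
      pol n (fun i j => tcoef i j (dDir eA G) z) (τ * a) (τ * b)
    let DB : ℝ → V := fun τ => dDir eB G (τ * a, τ * b, z) -
      pol n (fun i j => tcoef i j (dDir eB G) z) (τ * a) (τ * b)
    have hd : ∀ τ, HasDerivAt R (a • DA τ + b • DB τ) τ := by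
      intro τ
      have hα : HasDerivAt (fun τ : ℝ => τ * a) a τ := by simpa using (hasDerivAt_id τ).mul_const a
      have hβ : HasDerivAt (fun τ : ℝ => τ * b) b τ := by simpa using (hasDerivAt_id τ).mul_const b
      have h3 := hasDerivAt_pol n (fun i j => tcoef i j G z) hα hβ
      rw [hA, hB] at h3
      have h4 : HasFDerivAt G (fderiv ℝ G (τ * a, τ * b, z)) (τ * a, τ * b, z) :=
        (hG.contDiffAt.differentiableAt (by simp)).hasFDerivAt
      have h5 := h4.comp_hasDerivAt τ (hα.prodMk (hβ.prodMk (hasDerivAt_const τ z)))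
      refine (h5.sub h3).congr_deriv ?_
      have h6 : ((a, b, 0) : ℝ × ℝ × Z) = a • eA + b • eB := by simp [eA, eB]
      rw [h6, map_add, map_smul, map_smul]
      simp only [DA, DB, dDir, smul_sub]
      abel
    have hbound : ∀ τ ∈ Icc (0 : ℝ) 1, ‖a • DA τ + b • DB τ‖ ≤
        (C₁ + C₂) * (|a| + |b|) ^ (n + 1) := by
      intro τ hτ
      have hτa : ∀ c : ℝ, |τ * c| ≤ |c| := fun c => by
        rw [abs_mul, abs_of_nonneg hτ.1]
        exact mul_le_of_le_one_left (abs_nonneg _) hτ.2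
      have e1 := h₁ (τ * a) (τ * b) z ((hτa a).trans_lt ha.1) ((hτa b).trans_lt hb.1) hz.1
      have e2 := h₂ (τ * a) (τ * b) z ((hτa a).trans_lt ha.2) ((hτa b).trans_lt hb.2) hz.2
      have e3 : (|τ * a| + |τ * b|) ^ n ≤ (|a| + |b|) ^ n :=
        pow_le_pow_left₀ (by positivity) (add_le_add (hτa a) (hτa b)) n
      calc ‖a • DA τ + b • DB τ‖ ≤ |a| * ‖DA τ‖ + |b| * ‖DB τ‖ := by
            refine (norm_add_le _ _).trans ?_
            rw [norm_smul, norm_smul, Real.norm_eq_abs, Real.norm_eq_abs]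
        _ ≤ |a| * (C₁ * (|a| + |b|) ^ n) + |b| * (C₂ * (|a| + |b|) ^ n) := by
            gcongr
            · exact e1.trans (by gcongr)
            · exact e2.trans (by gcongr)
        _ ≤ (|a| + |b|) * (C₁ * (|a| + |b|) ^ n) + (|a| + |b|) * (C₂ * (|a| + |b|) ^ n) := by
            gcongr
            · linarith [abs_nonneg b]
            · linarith [abs_nonneg a]
        _ = _ := by ring
    have hmv := norm_image_sub_le_of_norm_deriv_le_segment_01'
      (fun τ _ => (hd τ).hasDerivWithinAt) fun τ hτ => hbound τ (Ico_subset_Icc_self hτ)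
    have hR0 : R 0 = 0 := by
      simp only [R, zero_mul, pol_zero_zero]
      simp [tcoef]
    rw [hR0, sub_zero] at hmv
    simpa [R] using hmv

/-- For `m > 0` the product is the `m`-th power of `s^{1/m} (1 + |log s|)`, and a positive power of
`s` beats one logarithm. -/
lemma tendsto_mul_one_add_abs_log_pow (m : ℕ) :
    Tendsto (fun s : ℝ => s * (1 + |Real.log s|) ^ m) (𝓝[>] 0) (𝓝 0) := by
  rcases Nat.eq_zero_or_pos m with rfl | hm
  · simpa using (tendsto_nhdsWithin_of_tendsto_nhds tendsto_id : Tendsto (fun s : ℝ => s) (𝓝[>] 0) (𝓝 0))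
  have hr : (0 : ℝ) < 1 / m := by positivity
  have h1 := (tendsto_log_mul_rpow_nhdsGT_zero hr).abs
  have h2 : Tendsto (fun s : ℝ => s ^ (1 / m : ℝ)) (𝓝[>] 0) (𝓝 0) := by
    have := (Real.continuousAt_rpow_const 0 (1 / m : ℝ) (Or.inr hr.le)).tendsto
    rw [Real.zero_rpow hr.ne'] at this
    exact tendsto_nhdsWithin_of_tendsto_nhds this
  have h3 := (h2.add h1).pow m
  simp only [abs_zero, add_zero] at h3
  rw [zero_pow hm.ne'] at h3
  refine h3.congr' ?_
  filter_upwards [self_mem_nhdsWithin] with s hs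
  have hs0 : (0 : ℝ) < s := hs
  rw [abs_mul, abs_of_pos (Real.rpow_pos_of_pos hs0 _)]
  rw [show s ^ (1 / m : ℝ) + |Real.log s| * s ^ (1 / m : ℝ) =
    s ^ (1 / m : ℝ) * (1 + |Real.log s|) by ring, mul_pow, ← Real.rpow_natCast, ← Real.rpow_mul hs0.le,
    one_div_mul_cancel (by positivity), Real.rpow_one]

lemma tendsto_pow_mul_one_add_abs_log_pow {K : ℕ} (hK : 1 ≤ K) (m : ℕ) :
    Tendsto (fun s : ℝ => s ^ K * (1 + |Real.log s|) ^ m) (𝓝[>] 0) (𝓝 0) := by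
  obtain ⟨K, rfl⟩ : ∃ K', K = K' + 1 := ⟨K - 1, by omega⟩
  have h1 : Tendsto (fun s : ℝ => s ^ K) (𝓝[>] 0) (𝓝 (0 ^ K)) :=
    tendsto_nhdsWithin_of_tendsto_nhds ((continuous_pow K).tendsto 0)
  have := h1.mul (tendsto_mul_one_add_abs_log_pow m)
  rw [mul_zero] at this
  refine this.congr fun s => by ring

lemma tendsto_pow_mul_log_pow {K : ℕ} (hK : 1 ≤ K) (m : ℕ) :
    Tendsto (fun s : ℝ => s ^ K * Real.log s ^ m) (𝓝[>] 0) (𝓝 0) := by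
  refine squeeze_zero_norm' ?_ (tendsto_pow_mul_one_add_abs_log_pow hK m)
  filter_upwards [self_mem_nhdsWithin] with s hs
  have hs0 : (0 : ℝ) < s := hs
  rw [norm_mul, norm_pow, norm_pow, Real.norm_eq_abs, Real.norm_eq_abs, abs_of_pos hs0]
  gcongr
  linarith

lemma tendsto_self_mul_log : Tendsto (fun s : ℝ => s * Real.log s) (𝓝[>] 0) (𝓝 0) := by
  simpa using tendsto_pow_mul_log_pow le_rfl 1

/-- The remainder in Taylor's theorem, evaluated at `(s, s log s)`. -/
lemma tendsto_taylor_remainder {G : ℝ × ℝ × Z → V} (hG : ContDiff ℝ ∞ G) (z₀ : Z) (t : ℕ) {K : ℕ}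
    (hK : 1 ≤ K) :
    Tendsto (fun p : ℝ × Z => (p.1 ^ t)⁻¹ • (G (p.1, p.1 * Real.log p.1, p.2) -
      pol (t + K) (fun i j => tcoef i j G p.2) p.1 (p.1 * Real.log p.1)))
      (𝓝[>] 0 ×ˢ 𝓝 z₀) (𝓝 0) := by
  obtain ⟨C, hC, ε, hε, hb⟩ := taylor_bound (t + K) hG z₀
  have h1 : Tendsto (fun p : ℝ × Z => C * (p.1 ^ K * (1 + |Real.log p.1|) ^ (t + K)))
      (𝓝[>] 0 ×ˢ 𝓝 z₀) (𝓝 0) := by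
    have := ((tendsto_pow_mul_one_add_abs_log_pow hK (t + K)).const_mul C).comp
      (tendsto_fst (f := 𝓝[>] (0 : ℝ)) (g := 𝓝 z₀))
    rw [mul_zero] at this
    exact this
  refine squeeze_zero_norm' ?_ h1
  have e1 : ∀ᶠ s in 𝓝[>] (0 : ℝ), 0 < s ∧ |s| < ε ∧ |s * Real.log s| < ε := by
    have e2 : ∀ᶠ s in 𝓝[>] (0 : ℝ), |s * Real.log s| < ε :=
      (tendsto_self_mul_log.abs).eventually (gt_mem_nhds (by simpa using hε))
    have e3 : ∀ᶠ s in 𝓝[>] (0 : ℝ), |s| < ε :=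
      (tendsto_nhdsWithin_of_tendsto_nhds (continuous_abs.tendsto 0)).eventually
        (gt_mem_nhds (by simpa using hε))
    filter_upwards [self_mem_nhdsWithin, e2, e3] with s h1 h2 h3 using ⟨h1, h3, h2⟩
  filter_upwards [e1.prod_mk (Metric.ball_mem_nhds z₀ hε)] with p ⟨⟨hp0, hp1, hp2⟩, hp3⟩
  have hbd := hb p.1 (p.1 * Real.log p.1) p.2 hp1 hp2 hp3
  rw [norm_smul, norm_inv, norm_pow, Real.norm_eq_abs, abs_of_pos hp0]
  -- Since `|s| + |s log s| = s (1 + |log s|)`, the factor `s^t` cancels and `s^K` is left.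
  calc (p.1 ^ t)⁻¹ * _ ≤ (p.1 ^ t)⁻¹ * (C * (|p.1| + |p.1 * Real.log p.1|) ^ (t + K)) := by
        gcongr
    _ = C * (p.1 ^ K * (1 + |Real.log p.1|) ^ (t + K)) := by
        rw [abs_mul, abs_of_pos hp0, show p.1 + p.1 * |Real.log p.1| =
          p.1 * (1 + |Real.log p.1|) by ring, mul_pow, pow_add]
        have : p.1 ^ t ≠ 0 := by positivity
        field_simp

/-- If the Taylor coefficients `g_{ij}` with `i ≤ t` vanish up to a sufficiently high order, then
`s^{-t-1} G(s, s log s, z)` converges. -/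
lemma tendsto_of_tcoef_eq_zero {G : ℝ × ℝ × Z → V} (hG : ContDiff ℝ ∞ G) (z₀ : Z) (t : ℕ) {K : ℕ}
    (hK : 1 ≤ K)
    (hz : ∀ᶠ z in 𝓝 z₀, ∀ i j, i ≤ t → i + j ≤ t + K → tcoef i j G z = 0) :
    Tendsto (fun p : ℝ × Z => (p.1 ^ (t + 1))⁻¹ • G (p.1, p.1 * Real.log p.1, p.2))
      (𝓝[>] 0 ×ˢ 𝓝 z₀) (𝓝 (tcoef (t + 1) 0 G z₀)) := by
  have hrem := tendsto_taylor_remainder hG z₀ (t + 1) hK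
  have hpol : Tendsto (fun p : ℝ × Z => (p.1 ^ (t + 1))⁻¹ •
      pol (t + 1 + K) (fun i j => tcoef i j G p.2) p.1 (p.1 * Real.log p.1))
      (𝓝[>] 0 ×ˢ 𝓝 z₀) (𝓝 (tcoef (t + 1) 0 G z₀)) := by
    have hsum : ∑ k ∈ Finset.range (t + 1 + K), ∑ p ∈ Finset.HasAntidiagonal.antidiagonal k,
        (if p = (t + 1, 0) then tcoef (t + 1) 0 G z₀ else 0) = tcoef (t + 1) 0 G z₀ := by
      rw [Finset.sum_eq_single (t + 1)]
      · rw [Finset.sum_ite_eq' (Finset.HasAntidiagonal.antidiagonal (t + 1))]; simp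
      · intro k _ hk
        refine Finset.sum_eq_zero fun p hp => if_neg ?_
        rintro rfl
        simp at hp
        exact hk hp.symm
      · intro h; simp at h; omega
    simp only [pol, Finset.smul_sum]
    rw [← hsum]
    refine tendsto_finsetSum _ fun k hk => tendsto_finsetSum _ fun q hq => ?_
    rw [Finset.HasAntidiagonal.mem_antidiagonal] at hq
    rw [Finset.mem_range] at hk
    have hev : ∀ᶠ p : ℝ × Z in 𝓝[>] 0 ×ˢ 𝓝 z₀, 0 < p.1 ∧
        ∀ i j, i ≤ t → i + j ≤ t + K → tcoef i j G p.2 = 0 :=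
      Filter.Eventually.prod_mk (la := 𝓝[>] (0 : ℝ)) (pa := fun s => 0 < s) self_mem_nhdsWithin hz
    -- Terms with `i ≤ t` vanish by hypothesis. For `i = t + 1 + l`, division by `s^{t+1}` leaves
    -- `s^{l+j} (log s)^j`, which tends to zero unless `(i, j) = (t + 1, 0)`.
    by_cases hqt : q.1 ≤ t
    · have hne : q ≠ (t + 1, 0) := by rintro rfl; simp at hqt
      rw [if_neg hne]
      refine tendsto_const_nhds.congr' ?_
      filter_upwards [hev] with p hp
      rw [hp.2 q.1 q.2 hqt (by omega), smul_zero, smul_zero]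
    · obtain ⟨l, hl⟩ : ∃ l, q.1 = t + 1 + l := ⟨q.1 - (t + 1), by omega⟩
      have hT : Tendsto (fun p : ℝ × Z => tcoef q.1 q.2 G p.2) (𝓝[>] 0 ×ˢ 𝓝 z₀)
          (𝓝 (tcoef q.1 q.2 G z₀)) :=
        ((contDiff_tcoef hG q.1 q.2).continuous.tendsto z₀).comp tendsto_snd
      have hform : ∀ᶠ p : ℝ × Z in 𝓝[>] 0 ×ˢ 𝓝 z₀,
          (p.1 ^ (l + q.2) * Real.log p.1 ^ q.2) • tcoef q.1 q.2 G p.2 = (p.1 ^ (t + 1))⁻¹ •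
            (p.1 ^ q.1 * (p.1 * Real.log p.1) ^ q.2) • tcoef q.1 q.2 G p.2 := by
        filter_upwards [hev] with p hp
        rw [smul_smul, hl]
        congr 1
        have : p.1 ≠ 0 := hp.1.ne'
        rw [mul_pow]
        field_simp
        ring
      by_cases hq0 : q = (t + 1, 0)
      · have hl0 : l = 0 := by rw [hq0] at hl; simp at hl; omega
        rw [if_pos hq0]
        refine Tendsto.congr' hform ?_
        subst hl0
        rw [hq0] at hT ⊢
        simpa using hT
      · rw [if_neg hq0]
        have hl1 : 1 ≤ l + q.2 := by
          by_contra hc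
          exact hq0 (Prod.ext (by simp; omega) (by simp; omega))
        have := ((tendsto_pow_mul_log_pow hl1 q.2).comp
          (tendsto_fst (f := 𝓝[>] (0 : ℝ)) (g := 𝓝 z₀))).smul hT
        rw [zero_smul] at this
        exact this.congr' hform
  have := hrem.add hpol
  rw [zero_add] at this
  refine this.congr fun p => ?_
  rw [← smul_add, sub_add_cancel]

open Polynomial in
-- With `s = e^{-x}` this concerns the polynomial `P(-x)` as `x → ∞`, and a polynomial with a finite
-- limit at infinity is constant.
lemma polynomial_eq_C_of_tendsto (P : ℝ[X]) {w : ℝ}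
    (h : Tendsto (fun s : ℝ => P.eval (Real.log s)) (𝓝[>] 0) (𝓝 w)) : P = C w := by
  have h1 : Tendsto (fun x : ℝ => (P.comp (-X)).eval x) atTop (𝓝 w) := by
    have h2 : Tendsto (fun x : ℝ => Real.exp (-x)) atTop (𝓝[>] 0) :=
      tendsto_nhdsWithin_iff.2 ⟨Real.tendsto_exp_neg_atTop_nhds_zero,
        Eventually.of_forall fun x => Real.exp_pos _⟩
    refine (h.comp h2).congr fun x => ?_
    simp
  rw [Polynomial.tendsto_nhds_iff] at h1
  have h3 : P.comp (-X) = C w := by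
    rw [Polynomial.eq_C_of_degree_le_zero h1.2, ← h1.1, Polynomial.leadingCoeff,
      Polynomial.natDegree_eq_zero_iff_degree_le_zero.2 h1.2]
  have h4 := congrArg (fun Q : ℝ[X] => Q.comp (-X)) h3
  simpa [Polynomial.comp_assoc] using h4

open Polynomial in
-- Induction on `t`. After multiplication by the power of `s` in the denominator the whole sum tends
-- to zero, and so does each term with a positive power of `s`. Hence `P 0` evaluated at `log s`
-- tends to zero, so `P 0 = 0`, and a factor `s` cancels.
lemma polynomial_eq_C_of_tendsto_sum (t : ℕ) : ∀ (P : ℕ → ℝ[X]) {w : ℝ},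
    Tendsto (fun s : ℝ => (s ^ t)⁻¹ * ∑ k ∈ Finset.range (t + 1), s ^ k * (P k).eval (Real.log s))
      (𝓝[>] 0) (𝓝 w) → P t = C w := by
  have hsmall : ∀ (Q : ℝ[X]) (k : ℕ), 1 ≤ k →
      Tendsto (fun s : ℝ => s ^ k * Q.eval (Real.log s)) (𝓝[>] 0) (𝓝 0) := by
    intro Q k hk
    have h1 : Tendsto (fun s : ℝ => ∑ i ∈ Finset.range (Q.natDegree + 1),
        Q.coeff i * (s ^ k * Real.log s ^ i)) (𝓝[>] 0)
        (𝓝 (∑ i ∈ Finset.range (Q.natDegree + 1), Q.coeff i * 0)) :=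
      tendsto_finsetSum _ fun i _ => (tendsto_pow_mul_log_pow hk i).const_mul _
    simp only [mul_zero, Finset.sum_const_zero] at h1
    refine h1.congr fun s => ?_
    rw [Polynomial.eval_eq_sum_range, Finset.mul_sum]
    exact Finset.sum_congr rfl fun i _ => by ring
  induction t with
  | zero =>
    intro P w h
    refine polynomial_eq_C_of_tendsto _ (h.congr fun s => ?_)
    simp
  | succ t ih =>
    intro P w h
    have hP0 : P 0 = 0 := by
      have h1 : Tendsto (fun s : ℝ => s ^ (t + 1)) (𝓝[>] 0) (𝓝 0) := by
        simpa using tendsto_pow_mul_log_pow (K := t + 1) (by omega) 0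
      have h2 := h1.mul h
      have h3 : Tendsto (fun s : ℝ => ∑ k ∈ Finset.range (t + 1),
          s ^ (k + 1) * (P (k + 1)).eval (Real.log s)) (𝓝[>] 0) (𝓝 0) := by
        have := tendsto_finsetSum (Finset.range (t + 1)) fun k _ =>
          hsmall (P (k + 1)) (k + 1) (by omega)
        simpa using this
      have h4 := h2.sub h3
      rw [zero_mul, sub_zero] at h4
      rw [polynomial_eq_C_of_tendsto (P 0) (w := 0) ?_, map_zero]
      refine h4.congr' ?_
      filter_upwards [self_mem_nhdsWithin] with s hs
      have hs0 : (s : ℝ) ≠ 0 := ne_of_gt hs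
      rw [Finset.sum_range_succ']
      field_simp
      ring
    refine ih (fun k => P (k + 1)) (h.congr' ?_)
    filter_upwards [self_mem_nhdsWithin] with s hs
    have hs0 : (s : ℝ) ≠ 0 := ne_of_gt hs
    rw [Finset.sum_range_succ', hP0]
    simp only [eval_zero, mul_zero, add_zero, Finset.mul_sum]
    refine Finset.sum_congr rfl fun k _ => ?_
    field_simp
    ring

/-- The finite part of `s^{-t} H(s, s log s, z)` is its limit, if there is one. -/
lemma tcoef_eq_of_tendsto {H : ℝ × ℝ × Z → V} (hH : ContDiff ℝ ∞ H) (z : Z) (t : ℕ) {w : V}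
    (h : Tendsto (fun s : ℝ => (s ^ t)⁻¹ • H (s, s * Real.log s, z)) (𝓝[>] 0) (𝓝 w)) :
    tcoef t 0 H z = w := by
  have hrem := (tendsto_taylor_remainder hH z t le_rfl).comp
    (tendsto_id.prodMk (tendsto_const_nhds (x := z) (f := 𝓝[>] (0 : ℝ))))
  have h1 := h.sub hrem
  rw [sub_zero] at h1
  -- Continuous functionals separate points, which reduces the claim to scalar polynomials in `log
  -- s`.
  refine (SeparatingDual.eq_iff_forall_dual_eq (R := ℝ)).2 fun φ => ?_
  have h2 := (φ.continuous.tendsto w).comp h1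
  -- The terms of total degree `k` add up to `s^k` times `P k` at `log s`; the constant coefficient
  -- of `P k` comes from the Taylor coefficient `(k, 0)`.
  let P : ℕ → Polynomial ℝ := fun k => ∑ q ∈ Finset.HasAntidiagonal.antidiagonal k,
    Polynomial.C (φ (tcoef q.1 q.2 H z)) * Polynomial.X ^ q.2
  have h3 := polynomial_eq_C_of_tendsto_sum t P (w := φ w) (h2.congr' ?_)
  · have h4 := congrArg (fun Q : Polynomial ℝ => Q.coeff 0) h3
    simp only [P, Polynomial.finsetSum_coeff, Polynomial.coeff_C_mul, Polynomial.coeff_X_pow,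
      Polynomial.coeff_C_zero] at h4
    rw [Finset.Nat.sum_antidiagonal_eq_sum_range_succ_mk, Finset.sum_range_succ,
      Finset.sum_eq_zero] at h4
    · simpa using h4
    · intro k hk
      rw [Finset.mem_range] at hk
      rw [if_neg (by simp; omega), mul_zero]
  · filter_upwards [self_mem_nhdsWithin] with s hs
    have hs0 : (s : ℝ) ≠ 0 := ne_of_gt hs
    simp only [Function.comp, id, ← smul_sub, sub_sub_cancel]
    rw [map_smul, pol_clm, smul_eq_mul, pol]
    congr 1
    refine Finset.sum_congr rfl fun k _ => ?_
    simp only [P, Polynomial.eval_finsetSum, Finset.mul_sum]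
    refine Finset.sum_congr rfl fun q hq => ?_
    rw [Finset.HasAntidiagonal.mem_antidiagonal] at hq
    simp only [Polynomial.eval_mul, Polynomial.eval_C, Polynomial.eval_pow, Polynomial.eval_X,
      smul_eq_mul, ← hq, mul_pow, pow_add]
    ring

end Asymptotics

end

end HolRen

namespace HolRen

noncomputable section

/-! ### The antiderivative of the divergent terms -/

section PrimCoeff

variable {V : Type*} [AddCommGroup V] [Module ℝ V]

/-- The derivative of `s^p (s log s)^q` is `(p + q) s^{p-1} (s log s)^q + q s^p (s log s)^{q-1}`, so
with `k = p + q` fixed the left side is the coefficient of `s^{p-1} (s log s)^{k-p}` in the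
derivative of the series. A summand with `l ≤ p - 2` has the extra factor `(p - 1)/k - 1` in
`powCoeff t c k p`, and `k ((p - 1)/k - 1) + (k - (p - 1)) = 0` cancels it. Only the new summand `l
= p - 1`, with its empty product, survives; it is present exactly when `p ≤ 0`. -/
lemma powCoeff_rec (t : ℕ) (c : ℤ → ℕ → V) {k p : ℤ} (hk : k ≠ 0) (hp : -(t : ℤ) < p) :
    (k : ℝ) • powCoeff t c k p + ((k : ℝ) - (p - 1 : ℤ)) • powCoeff t c k (p - 1) =
      if p ≤ 0 then c (p - 1) (k - p).toNat else 0 := by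
  have hk' : (k : ℝ) ≠ 0 := by exact_mod_cast hk
  have hprod : ∀ l ≤ p - 2, ∏ i ∈ Finset.Icc (l + 1) (p - 1), ((i : ℝ) / k - 1) =
      (∏ i ∈ Finset.Icc (l + 1) (p - 1 - 1), ((i : ℝ) / k - 1)) * (((p - 1 : ℤ) : ℝ) / k - 1) := by
    intro l hl
    have h1 : Finset.Icc (l + 1) (p - 1) = insert (p - 1) (Finset.Icc (l + 1) (p - 1 - 1)) := by
      ext x; simp only [Finset.mem_Icc, Finset.mem_insert]; omega
    rw [h1, Finset.prod_insert (by simp), mul_comm]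
  have hcancel : ∑ l ∈ Finset.Icc (-(t : ℤ)) (min (p - 1 - 1) (-1)), ((k : ℝ) •
      ((1 / (k : ℝ)) * ∏ i ∈ Finset.Icc (l + 1) (p - 1), ((i : ℝ) / k - 1)) •
        c l (k - l - 1).toNat + ((k : ℝ) - (p - 1 : ℤ)) •
      ((1 / (k : ℝ)) * ∏ i ∈ Finset.Icc (l + 1) (p - 1 - 1), ((i : ℝ) / k - 1)) •
        c l (k - l - 1).toNat) = 0 := by
    refine Finset.sum_eq_zero fun l hl => ?_
    rw [Finset.mem_Icc, le_min_iff] at hl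
    rw [hprod l (by omega), smul_smul, smul_smul, ← add_smul]
    convert zero_smul ℝ _ using 2
    field_simp
    ring
  rw [Finset.sum_add_distrib, ← Finset.smul_sum, ← Finset.smul_sum] at hcancel
  simp only [powCoeff] at hcancel ⊢
  by_cases h0 : p ≤ 0
  · have h1 : Finset.Icc (-(t : ℤ)) (min (p - 1) (-1)) =
        insert (p - 1) (Finset.Icc (-(t : ℤ)) (min (p - 1 - 1) (-1))) := by
      ext x; simp only [Finset.mem_Icc, Finset.mem_insert, le_min_iff]; omega
    have h2 : p - 1 ∉ Finset.Icc (-(t : ℤ)) (min (p - 1 - 1) (-1)) := by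
      simp only [Finset.mem_Icc, le_min_iff]; omega
    rw [h1, Finset.sum_insert h2, smul_add, add_assoc, hcancel, add_zero, if_pos h0, smul_smul,
      Finset.Icc_eq_empty (by omega), Finset.prod_empty, mul_one, mul_one_div_cancel hk', one_smul]
    congr 2
    omega
  · have h1 : min (p - 1) (-1) = min (p - 1 - 1) (-1) := by omega
    rw [h1, if_neg h0, hcancel]

lemma powCoeff_bot (t : ℕ) (c : ℤ → ℕ → V) (k : ℤ) : powCoeff t c k (-(t : ℤ)) = 0 := by
  rw [powCoeff, Finset.Icc_eq_empty, Finset.sum_empty]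
  rw [le_min_iff]
  omega

/-- The recursion of `powCoeff_rec` in the shifted indices `i = p + t`. On the exceptional line,
where the total exponent is zero, the first factor vanishes and `logCoeff` is the solution of what
remains. -/
lemma primCoeff_rec (t : ℕ) (c : ℤ → ℕ → V) (i j : ℕ) :
    ((i : ℝ) + 1 + j - t) • primCoeff t c (((i + 1 : ℕ) : ℤ) - t) j +
      ((j : ℝ) + 1) • primCoeff t c ((i : ℤ) - t) (j + 1) =
      if i < t then c ((i : ℤ) - t) j else 0 := by
  by_cases hk : (i : ℤ) + 1 + j - t = 0
  · have h1 : (i : ℝ) + 1 + j - t = 0 := by exact_mod_cast hk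
    rw [h1, zero_smul, zero_add, primCoeff, if_pos (by push_cast; omega), logCoeff]
    by_cases hi : i < t
    · rw [if_pos hi, if_pos (by rw [Finset.mem_Icc]; omega), smul_smul,
        show (-((i : ℤ) - t) - 1).toNat = j by omega]
      have h2 : (((i : ℤ) - t : ℤ) : ℝ) = -((j : ℝ) + 1) := by
        push_cast; linarith
      have h3 : (j : ℝ) + 1 ≠ 0 := by positivity
      rw [h2]
      convert one_smul ℝ _ using 2
      field_simp
    · rw [if_neg hi, if_neg (by rw [Finset.mem_Icc]; omega), smul_zero]
  · rw [primCoeff, if_neg (by push_cast; omega), primCoeff, if_neg (by push_cast; omega)]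
    have h := powCoeff_rec t c (k := (i : ℤ) + 1 + j - t) (p := ((i + 1 : ℕ) : ℤ) - t) hk
      (by push_cast; omega)
    have e1 : ((i + 1 : ℕ) : ℤ) - t - 1 = (i : ℤ) - t := by push_cast; ring
    have e2 : ((i + 1 : ℕ) : ℤ) - t + j = (i : ℤ) + 1 + j - t := by push_cast; ring
    have e3 : (i : ℤ) - t + ((j + 1 : ℕ) : ℤ) = (i : ℤ) + 1 + j - t := by push_cast; ring
    have e4 : ((i : ℤ) + 1 + j - t - (((i + 1 : ℕ) : ℤ) - t)).toNat = j := by push_cast; omega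
    have e5 : (((i + 1 : ℕ) : ℤ) - t ≤ 0) = (i < t) := by
      apply propext; push_cast; omega
    have e6 : (((i : ℤ) + 1 + j - t : ℤ) : ℝ) = (i : ℝ) + 1 + j - t := by push_cast; ring
    have e7 : (((i : ℤ) - t : ℤ) : ℝ) = (i : ℝ) - t := by push_cast; ring
    simp only [e1, e4, e5, e6, e7] at h
    rw [e2, e3, ← h]
    congr 2
    ring

/-- Differentiation produces no term with the power `s^{-t-1}`: either the factor `j - t` is zero,
or the sum defining `powCoeff` at `p = -t` is empty. -/
lemma primCoeff_bot (t : ℕ) (c : ℤ → ℕ → V) (j : ℕ) :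
    ((j : ℝ) - t) • primCoeff t c (((0 : ℕ) : ℤ) - t) j = 0 := by
  by_cases hk : (j : ℤ) - t = 0
  · have h1 : (j : ℝ) - t = 0 := by exact_mod_cast hk
    rw [h1, zero_smul]
  · rw [primCoeff, if_neg (by push_cast; omega), Nat.cast_zero, zero_sub, powCoeff_bot, smul_zero]

/-- The antiderivative is normalized to have no constant term; this is why the counterterms leave
the finite part of `θ` unchanged. -/
lemma primCoeff_zero_zero (t : ℕ) (c : ℤ → ℕ → V) : primCoeff t c 0 0 = 0 := by
  rw [primCoeff, if_pos (by simp), if_neg (by simp)]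

lemma primCoeff_map {V' : Type*} [AddCommGroup V'] [Module ℝ V'] (T : V →ₗ[ℝ] V') (t : ℕ)
    (c : ℤ → ℕ → V) (p : ℤ) (q : ℕ) :
    T (primCoeff t c p q) = primCoeff t (fun i j => T (c i j)) p q := by
  unfold primCoeff powCoeff logCoeff
  split_ifs <;> simp [map_sum, map_smul]

/-- Used for the evaluation at a point of `N` or on a variation, for the passage to a chart, and for
signs. -/
lemma primSum_map {V' : Type*} [AddCommGroup V'] [Module ℝ V'] (T : V →ₗ[ℝ] V') (t : ℕ) (K : ℤ)
    (c : ℤ → ℕ → V) (s : ℝ) :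
    T (primSum t K c s) = primSum t K (fun i j => T (c i j)) s := by
  simp [primSum, powCoeff, logCoeff, map_sum, map_add, map_smul]

end PrimCoeff

/-! ### The truncated antiderivative as a polynomial in `s` and `s log s` -/

section PrimSum

variable {V : Type*} [NormedAddCommGroup V] [NormedSpace ℝ V]

lemma pol_succ_of_left {n : ℕ} {g : ℕ → ℕ → V} (hg : ∀ j, g 0 j = 0) (a b : ℝ) :
    pol (n + 1) g a b = a • pol n (fun i j => g (i + 1) j) a b := by
  rw [pol, Finset.sum_range_succ']
  have h0 : ∑ p ∈ Finset.HasAntidiagonal.antidiagonal (0 : ℕ), (a ^ p.1 * b ^ p.2) • g p.1 p.2 = 0 := by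
    simp [hg]
  rw [h0, add_zero]
  simp only [pol, Finset.smul_sum]
  refine Finset.sum_congr rfl fun k _ => ?_
  rw [Finset.Nat.sum_antidiagonal_succ]
  simp only [hg, smul_zero, zero_add, smul_smul]
  exact Finset.sum_congr rfl fun p _ => by congr 1; ring

lemma pol_succ_of_right {n : ℕ} {g : ℕ → ℕ → V} (hg : ∀ i, g i 0 = 0) (a b : ℝ) :
    pol (n + 1) g a b = b • pol n (fun i j => g i (j + 1)) a b := by
  rw [pol, Finset.sum_range_succ']
  have h0 : ∑ p ∈ Finset.HasAntidiagonal.antidiagonal (0 : ℕ), (a ^ p.1 * b ^ p.2) • g p.1 p.2 = 0 := by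
    simp [hg]
  rw [h0, add_zero]
  simp only [pol, Finset.smul_sum]
  refine Finset.sum_congr rfl fun k _ => ?_
  rw [Finset.Nat.sum_antidiagonal_succ']
  simp only [hg, smul_zero, zero_add, smul_smul]
  refine Finset.sum_congr rfl fun p _ => ?_
  rw [pow_succ]
  congr 1
  ring

lemma pol_add (n : ℕ) (g g' : ℕ → ℕ → V) (a b : ℝ) :
    pol n (fun i j => g i j + g' i j) a b = pol n g a b + pol n g' a b := by
  simp [pol, smul_add, Finset.sum_add_distrib]

lemma pol_smul (n : ℕ) (r : ℝ) (g : ℕ → ℕ → V) (a b : ℝ) :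
    pol n (fun i j => r • g i j) a b = r • pol n g a b := by
  simp only [pol, Finset.smul_sum]
  exact Finset.sum_congr rfl fun _ _ => Finset.sum_congr rfl fun _ _ => smul_comm _ _ _

lemma logMonomial_eq {s : ℝ} (hs : 0 < s) (t i : ℕ) (p : ℤ) (hp : p = (i : ℤ) - t) (q : ℕ) :
    logMonomial p q s = (s ^ t)⁻¹ * (s ^ i * (s * Real.log s) ^ q) := by
  rw [logMonomial, hp, zpow_sub₀ hs.ne', zpow_natCast, zpow_natCast]
  field_simp

/-- In the indices `i = p + t`, `j = q` the lines `p + q = k` become antidiagonals of total degree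
`k + t`, and `k ≤ K` gives the bound `t + K + 1`. The line `k = 0` is the sum with `logCoeff`. On
the others the missing entries `p = -t`, and with them the line `k = -t`, may be added because
`powCoeff` vanishes there. -/
lemma primSum_eq_pol (t K : ℕ) (c : ℤ → ℕ → V) {s : ℝ} (hs : 0 < s) :
    primSum t (K : ℤ) c s = (s ^ t)⁻¹ •
      pol (t + K + 1) (fun i j => primCoeff t c ((i : ℤ) - t) j) s (s * Real.log s) := by
  let F : ℤ → V := fun k => ∑ p ∈ Finset.Icc (-(t : ℤ)) k,
    logMonomial p (k - p).toNat s • primCoeff t c p (k - p).toNat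
  have h1 : (s ^ t)⁻¹ • pol (t + K + 1) (fun i j => primCoeff t c ((i : ℤ) - t) j) s
      (s * Real.log s) = ∑ k ∈ Finset.Icc (-(t : ℤ)) K, F k := by
    rw [pol, Finset.smul_sum]
    refine Finset.sum_nbij' (fun n : ℕ => (n : ℤ) - t) (fun k => (k + t).toNat) ?_ ?_ ?_ ?_ ?_
    · intro n hn; simp only [Finset.mem_range, Finset.mem_Icc] at hn ⊢; omega
    · intro k hk; simp only [Finset.mem_range, Finset.mem_Icc] at hk ⊢; omega
    · intro n _; simp
    · intro k hk; simp only [Finset.mem_Icc] at hk; omega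
    · intro n _
      rw [Finset.smul_sum]
      refine Finset.sum_nbij' (fun q : ℕ × ℕ => (q.1 : ℤ) - t)
        (fun p => ((p + t).toNat, (n - t - p).toNat)) ?_ ?_ ?_ ?_ ?_
      · intro q hq
        simp only [Finset.HasAntidiagonal.mem_antidiagonal, Finset.mem_Icc] at hq ⊢; omega
      · intro p hp
        simp only [Finset.HasAntidiagonal.mem_antidiagonal, Finset.mem_Icc] at hp ⊢; omega
      · intro q hq
        simp only [Finset.HasAntidiagonal.mem_antidiagonal] at hq
        ext <;> simp; omega
      · intro p hp; simp only [Finset.mem_Icc] at hp; dsimp only; omega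
      · intro q hq
        simp only [Finset.HasAntidiagonal.mem_antidiagonal] at hq
        rw [logMonomial_eq hs t q.1 _ rfl, smul_smul,
          show ((n : ℤ) - t - (q.1 - t)).toNat = q.2 by omega]
  have h2 : F 0 = ∑ p ∈ Finset.Icc (-(t : ℤ)) (-1), logMonomial p (-p).toNat s • logCoeff c p := by
    symm
    simp only [F, zero_sub]
    have hsub : Finset.Icc (-(t : ℤ)) (-1) ⊆ Finset.Icc (-(t : ℤ)) 0 :=
      Finset.Icc_subset_Icc le_rfl (by norm_num)
    rw [← Finset.sum_subset hsub]
    · refine Finset.sum_congr rfl fun p hp => ?_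
      have hp' := Finset.mem_Icc.1 hp
      rw [primCoeff, if_pos (by omega), if_pos hp]
    · intro p hp hp'
      have hp'' := Finset.mem_Icc.1 hp
      rw [primCoeff, if_pos (by omega), if_neg hp', smul_zero]
  have h3 : ∀ k ∈ (Finset.Icc (-(t : ℤ)) K).erase 0, F k =
      ∑ p ∈ Finset.Icc (-(t : ℤ) + 1) k, logMonomial p (k - p).toNat s • powCoeff t c k p := by
    intro k hk
    have hk' := Finset.mem_erase.1 hk
    have hk'' := Finset.mem_Icc.1 hk'.2
    have e : ∀ p ∈ Finset.Icc (-(t : ℤ)) k, primCoeff t c p (k - p).toNat = powCoeff t c k p := by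
      intro p hp
      have hp' := Finset.mem_Icc.1 hp
      have : p + ((k - p).toNat : ℤ) = k := by omega
      rw [primCoeff, this, if_neg hk'.1]
    symm
    refine (Finset.sum_subset (Finset.Icc_subset_Icc (by omega) le_rfl) ?_).trans
      (Finset.sum_congr rfl fun p hp => by rw [e p hp])
    intro p hp hp'
    have : p = -(t : ℤ) := by simp only [Finset.mem_Icc] at hp hp'; omega
    rw [this, powCoeff_bot, smul_zero]
  rw [h1, ← Finset.add_sum_erase _ F (a := 0) (by simp), h2, Finset.sum_congr rfl h3, primSum,
    add_comm]
  congr 1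
  refine Finset.sum_subset (Finset.erase_subset_erase _
    (Finset.Icc_subset_Icc (by omega) le_rfl)) fun k hk hk' => ?_
  have : k = -(t : ℤ) := by
    simp only [Finset.mem_erase, Finset.mem_Icc] at hk hk'; omega
  rw [this, Finset.Icc_eq_empty (by omega), Finset.sum_empty]

/-- Negative exponents `p` are the indices `i < t`, and `p + q < K` becomes `i + j < t + K`; the
rest is the exchange of rows and antidiagonals. -/
lemma divSum_eq_pol (t K : ℕ) (c : ℤ → ℕ → V) {s : ℝ} (hs : 0 < s) :
    divSum t (K : ℤ) c s = (s ^ t)⁻¹ •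
      pol (t + K) (fun i j => if i < t then c ((i : ℤ) - t) j else 0) s (s * Real.log s) := by
  simp only [pol, Finset.Nat.sum_antidiagonal_eq_sum_range_succ_mk]
  rw [Finset.sum_range_diag_flip (t + K) (fun i j => (s ^ i * (s * Real.log s) ^ j) •
    (if i < t then c ((i : ℤ) - t) j else 0))]
  rw [← Finset.sum_subset (Finset.range_mono (Nat.le_add_right t K)), divSum, Finset.smul_sum]
  · symm
    refine Finset.sum_nbij' (fun n : ℕ => (n : ℤ) - t) (fun k => (k + t).toNat) ?_ ?_ ?_ ?_ ?_
    · intro n hn; simp only [Finset.mem_range, Finset.mem_Icc] at hn ⊢; omega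
    · intro k hk; simp only [Finset.mem_range, Finset.mem_Icc] at hk ⊢; omega
    · intro n _; simp
    · intro k hk; simp only [Finset.mem_Icc] at hk; omega
    · intro n hn
      rw [Finset.mem_range] at hn
      rw [Finset.smul_sum, show ((K : ℤ) - (n - t)).toNat = t + K - n by omega]
      refine Finset.sum_congr rfl fun j _ => ?_
      rw [logMonomial_eq hs t n _ rfl, smul_smul, if_pos hn]
  · intro i _ hi
    rw [Finset.mem_range] at hi
    refine Finset.sum_eq_zero fun j _ => ?_
    rw [if_neg hi, smul_zero]

/-- The truncated series is an antiderivative of the divergent terms. -/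
lemma hasDerivAt_primSum (t K : ℕ) (c : ℤ → ℕ → V) {s : ℝ} (hs : 0 < s) :
    HasDerivAt (primSum t (K : ℤ) c) (divSum t (K : ℤ) c s) s := by
  set e : ℕ → ℕ → V := fun i j => primCoeff t c ((i : ℤ) - t) j with he
  have hs0 := hs.ne'
  have h1 : primSum t (K : ℤ) c =ᶠ[𝓝 s] fun s => (s ^ t)⁻¹ • pol (t + K + 1) e s
      (s * Real.log s) := by
    filter_upwards [lt_mem_nhds hs] with x hx using primSum_eq_pol t K c hx
  have hlog : HasDerivAt (fun s => s * Real.log s) (Real.log s + 1) s := by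
    have := (hasDerivAt_id' s).fun_mul (Real.hasDerivAt_log hs0)
    simpa [hs0] using this
  have hpow : HasDerivAt (fun s : ℝ => (s ^ t)⁻¹) (-t * (s ^ (t + 1))⁻¹) s := by
    refine ((hasDerivAt_pow t s).fun_inv (by positivity)).congr_deriv ?_
    rcases Nat.eq_zero_or_pos t with rfl | ht
    · simp
    · obtain ⟨t, rfl⟩ : ∃ t', t = t' + 1 := ⟨t - 1, by omega⟩
      simp only [Nat.add_sub_cancel]
      field_simp
      ring
  refine HasDerivAt.congr_of_eventuallyEq ?_ h1
  refine (hpow.smul (hasDerivAt_pol (t + K) e (hasDerivAt_id s) hlog)).congr_deriv ?_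
  rw [divSum_eq_pol t K c hs]
  simp only [id_eq, one_smul]
  set a := s
  set b := s * Real.log s with hb
  -- With `a = s` and `b = s log s` the derivative of `s^{-t} P(a, b)` is `s^{-t-1} (a P_a + b P_b -
  -- t P + a P_b)`. The operator `a ∂_a + b ∂_b - t` multiplies the coefficient `(i, j)` by `i + j -
  -- t`; the last term comes from the `1` in the derivative `log s + 1` of `s log s`.
  have k1 : a • pol (t + K) (shiftA e) a b = pol (t + K + 1) (fun i j => (i : ℝ) • e i j) a b := by
    rw [pol_succ_of_left (by simp)]
    rw [show shiftA e = fun i j => ((i + 1 : ℕ) : ℝ) • e (i + 1) j by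
      funext i j; simp [shiftA]]
  have k2 : b • pol (t + K) (shiftB e) a b = pol (t + K + 1) (fun i j => (j : ℝ) • e i j) a b := by
    rw [pol_succ_of_right (by simp)]
    rw [show shiftB e = fun i j => ((j + 1 : ℕ) : ℝ) • e i (j + 1) by
      funext i j; simp [shiftB]]
  have k3 : pol (t + K + 1) (fun i j => ((i : ℝ) + j - t) • e i j) a b =
      a • pol (t + K) (fun i j => ((i : ℝ) + 1 + j - t) • e (i + 1) j) a b := by
    rw [pol_succ_of_left]
    · push_cast; rfl
    · intro j
      have := primCoeff_bot t c j
      simpa [he] using this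
  have k4 : pol (t + K) (fun i j => if i < t then c ((i : ℤ) - t) j else 0) a b =
      pol (t + K) (fun i j => ((i : ℝ) + 1 + j - t) • e (i + 1) j) a b +
        pol (t + K) (shiftB e) a b := by
    rw [← pol_add]
    congr 1
    funext i j
    exact (primCoeff_rec t c i j).symm
  have k5 : pol (t + K + 1) (fun i j => ((i : ℝ) + j - t) • e i j) a b =
      a • pol (t + K) (shiftA e) a b + b • pol (t + K) (shiftB e) a b +
        (-(t : ℝ)) • pol (t + K + 1) e a b := by
    rw [k1, k2, ← pol_smul, ← pol_add, ← pol_add]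
    congr 1
    funext i j
    module
  have k6 : a • pol (t + K) (fun i j => if i < t then c ((i : ℤ) - t) j else 0) a b =
      a • pol (t + K) (shiftA e) a b + b • pol (t + K) (shiftB e) a b +
        (-(t : ℝ)) • pol (t + K + 1) e a b + a • pol (t + K) (shiftB e) a b := by
    rw [k4, smul_add, ← k3, k5]
  have q1 : (a ^ (t + 1))⁻¹ * a = (a ^ t)⁻¹ := by rw [pow_succ]; field_simp
  have k7 : (a ^ t)⁻¹ • pol (t + K) (fun i j => if i < t then c ((i : ℤ) - t) j else 0) a b =
      (a ^ (t + 1))⁻¹ • a • pol (t + K) (fun i j => if i < t then c ((i : ℤ) - t) j else 0) a b := by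
    rw [smul_smul, q1]
  rw [k7, k6]
  simp only [smul_add, smul_smul, add_smul]
  have q2 : (a ^ (t + 1))⁻¹ * b = (a ^ t)⁻¹ * Real.log a := by rw [hb, ← mul_assoc, q1]
  rw [q1, q2, mul_comm _ (-(t : ℝ))]
  module

end PrimSum

end

end HolRen

namespace HolRen

noncomputable section

/-! ### Limits of renormalized quantities -/

section RenormalizedLimits

variable {Z V : Type*} [NormedAddCommGroup Z] [NormedSpace ℝ Z]
  [NormedAddCommGroup V] [NormedSpace ℝ V]

lemma eventually_box {Z : Type*} [PseudoMetricSpace Z] {P : ℝ × Z → Prop} {z₀ : Z}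
    (h : ∀ᶠ p in 𝓝[>] 0 ×ˢ 𝓝 z₀, P p) :
    ∃ ε > 0, ∀ s z, 0 < s → s < ε → dist z z₀ < ε → P (s, z) := by
  obtain ⟨⟨a, b⟩, ⟨ha, hb⟩, hab⟩ :=
    ((nhdsGT_basis (0 : ℝ)).prod (Metric.nhds_basis_ball (x := z₀))).eventually_iff.1 h
  refine ⟨min a b, lt_min ha hb, fun s z h1 h2 h3 => hab ⟨⟨h1, ?_⟩, ?_⟩⟩
  · exact h2.trans_le (min_le_left _ _)
  · exact h3.trans_le (min_le_right _ _)

lemma eventually_of_box {Z : Type*} [PseudoMetricSpace Z] {P : ℝ × Z → Prop} {z₀ : Z} {ε : ℝ}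
    (hε : 0 < ε) (h : ∀ s z, 0 < s → s < ε → dist z z₀ < ε → P (s, z)) :
    ∀ᶠ p in 𝓝[>] 0 ×ˢ 𝓝 z₀, P p :=
  ((nhdsGT_basis (0 : ℝ)).prod (Metric.nhds_basis_ball (x := z₀))).eventually_iff.2
    ⟨(ε, ε), ⟨hε, hε⟩, fun p hp => h p.1 p.2 hp.1.1 hp.1.2 hp.2⟩

/-- `s^t f(s, z)` is near `(0, z₀)` the smooth function `H` of `s`, `s log s` and `z`. -/
def IsLogSmooth (t : ℕ) (z₀ : Z) (f : ℝ → Z → V) (H : ℝ × ℝ × Z → V) : Prop :=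
  ContDiff ℝ ∞ H ∧ ∀ᶠ p : ℝ × Z in 𝓝[>] 0 ×ˢ 𝓝 z₀,
    p.1 ^ t • f p.1 p.2 = H (p.1, p.1 * Real.log p.1, p.2)

/-- The Taylor coefficients `g_{ij}`, `i ≤ t`, `i + j ≤ t + K`, of `G` vanish near `z₀`. -/
def IsFlat (t K : ℕ) (z₀ : Z) (G : ℝ × ℝ × Z → V) : Prop :=
  ∀ᶠ z in 𝓝 z₀, ∀ i j, i ≤ t → i + j ≤ t + K → tcoef i j G z = 0

lemma contDiff_comp_clm_const {W : Type*} [NormedAddCommGroup W] [NormedSpace ℝ W]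
    {G : ℝ × ℝ × Z → V} (hG : ContDiff ℝ ∞ G) (T : W →L[ℝ] ℝ × ℝ × Z) :
    ContDiff ℝ ∞ (fun w => (fderiv ℝ G w).comp T) :=
  (hG.fderiv_right (by simp)).clm_comp contDiff_const

/-- The direction of the parameters. -/
def inZ (Z : Type*) [NormedAddCommGroup Z] [NormedSpace ℝ Z] : Z →L[ℝ] ℝ × ℝ × Z :=
  (ContinuousLinearMap.inr ℝ ℝ (ℝ × Z)).comp (ContinuousLinearMap.inr ℝ ℝ Z)

/-- The coefficients vanish on a neighbourhood of `z₀`, and Taylor coefficients commute with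
parameter derivatives. This is what later controls `δ` and `d` of the renormalized normal parts. -/
lemma IsFlat.fderiv {t K : ℕ} {z₀ : Z} {G : ℝ × ℝ × Z → V} (hG : ContDiff ℝ ∞ G)
    (h : IsFlat t K z₀ G) : IsFlat t K z₀ (fun w => (fderiv ℝ G w).comp (inZ Z)) := by
  filter_upwards [eventually_eventually_nhds.2 h] with z hz i j hi hij
  have h1 : tcoef i j G =ᶠ[𝓝 z] fun _ => 0 := hz.mono fun z' hz' => hz' i j hi hij
  rw [inZ, tcoef_fderiv hG, h1.fderiv_eq]
  simp

/-- The weight `s^t` and the arguments `s` and `s log s` do not involve `z`, so the derivative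
passes directly to `H`. -/
lemma IsLogSmooth.fderiv {t : ℕ} {z₀ : Z} {f : ℝ → Z → V} {H : ℝ × ℝ × Z → V}
    (h : IsLogSmooth t z₀ f H) :
    IsLogSmooth t z₀ (fun s z => fderiv ℝ (f s) z) (fun w => (fderiv ℝ H w).comp (inZ Z)) := by
  refine ⟨contDiff_comp_clm_const h.1 _, ?_⟩
  obtain ⟨ε, hε, hb⟩ := eventually_box h.2
  refine eventually_of_box hε fun s z hs hs' hz => ?_
  have hs0 : s ^ t ≠ 0 := by positivity
  have h1 : f s =ᶠ[𝓝 z] fun z => (s ^ t)⁻¹ • H (s, s * Real.log s, z) := by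
    filter_upwards [Metric.isOpen_ball.mem_nhds (show z ∈ Metric.ball z₀ ε from hz)] with z' hz'
    rw [← hb s z' hs hs' hz', smul_smul, inv_mul_cancel₀ hs0, one_smul]
  have h2 : HasFDerivAt (fun z => H (s, s * Real.log s, z))
      ((_root_.fderiv ℝ H (s, s * Real.log s, z)).comp (inZ Z)) z := by
    have h3 : HasFDerivAt (fun z : Z => (s, s * Real.log s, z)) (inZ Z) z :=
      (hasFDerivAt_prodMk_right s _).comp z (hasFDerivAt_prodMk_right (s * Real.log s) z)
    exact ((h.1.contDiffAt.differentiableAt (by simp)).hasFDerivAt).comp z h3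
  dsimp only
  rw [h1.fderiv_eq, (h2.fun_const_smul ((s ^ t)⁻¹)).fderiv, smul_smul, mul_inv_cancel₀ hs0, one_smul]

lemma IsLogSmooth.clm {V' : Type*} [NormedAddCommGroup V'] [NormedSpace ℝ V'] {t : ℕ} {z₀ : Z}
    {f : ℝ → Z → V} {H : ℝ × ℝ × Z → V} (h : IsLogSmooth t z₀ f H) (T : V →L[ℝ] V') :
    IsLogSmooth t z₀ (fun s z => T (f s z)) (fun w => T (H w)) := by
  refine ⟨T.contDiff.comp h.1, ?_⟩
  filter_upwards [h.2] with p hp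
  rw [← map_smul, hp]

lemma IsLogSmooth.add {t : ℕ} {z₀ : Z} {f g : ℝ → Z → V} {H G : ℝ × ℝ × Z → V}
    (h : IsLogSmooth t z₀ f H) (h' : IsLogSmooth t z₀ g G) :
    IsLogSmooth t z₀ (fun s z => f s z + g s z) (fun w => H w + G w) := by
  refine ⟨h.1.add h'.1, ?_⟩
  filter_upwards [h.2, h'.2] with p hp hp'
  rw [smul_add, hp, hp']

lemma IsLogSmooth.tendsto {t K : ℕ} (hK : 1 ≤ K) {z₀ : Z} {f : ℝ → Z → V} {G : ℝ × ℝ × Z → V}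
    (h : IsLogSmooth (t + 1) z₀ f G) (hG : IsFlat t K z₀ G) :
    Tendsto (fun p : ℝ × Z => f p.1 p.2) (𝓝[>] 0 ×ˢ 𝓝 z₀) (𝓝 (tcoef (t + 1) 0 G z₀)) := by
  refine (tendsto_of_tcoef_eq_zero h.1 z₀ t hK hG).congr' ?_
  have h0 : ∀ᶠ p : ℝ × Z in 𝓝[>] 0 ×ˢ 𝓝 z₀, 0 < p.1 :=
    eventually_of_box one_pos fun s z hs _ _ => hs
  filter_upwards [h.2, h0] with p hp hp0
  have : p.1 ^ (t + 1) ≠ 0 := by positivity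
  rw [← hp, smul_smul, inv_mul_cancel₀ this, one_smul]

/-- If the expansion of `b` cancels the divergent terms in the expansion of `f`, then `f + ∂_s b` is
free of divergent terms up to a certain order, and its finite part is that of `f`. -/
lemma exists_isFlat_add_deriv {t K : ℕ} (hK : 1 ≤ K) {z₀ : Z} {f b : ℝ → Z → V}
    {Hf Hb : ℝ × ℝ × Z → V} {c : Z → ℤ → ℕ → V} (hf : IsLogSmooth t z₀ f Hf)
    (hb : IsLogSmooth t z₀ b Hb)
    (cf : ∀ᶠ z in 𝓝 z₀, ∀ i j : ℕ, tcoef i j Hf z = c z ((i : ℤ) - t) j)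
    (cb : ∀ᶠ z in 𝓝 z₀, ∀ i j : ℕ, i + j ≤ t + K →
      tcoef i j Hb z = -primCoeff t (c z) ((i : ℤ) - t) j) :
    ∃ G, IsLogSmooth (t + 1) z₀ (fun s z => f s z + deriv (fun s => b s z) s) G ∧
      IsFlat t K z₀ G ∧ tcoef (t + 1) 0 G z₀ = c z₀ 0 0 := by
  have hA := contDiff_dDir eA hb.1
  have hB := contDiff_dDir eB hb.1
  -- In terms of `a = s` and `b = s log s` these are the summands of `s^{t+1} (f + ∂_s (s^{-t}
  -- Hb))`; `G4 + G5` stems from `∂_s (s log s) = log s + 1`.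
  let G1 : ℝ × ℝ × Z → V := fun w => w.1 • Hf w
  let G2 : ℝ × ℝ × Z → V := fun w => (-(t : ℝ)) • Hb w
  let G3 : ℝ × ℝ × Z → V := fun w => w.1 • dDir eA Hb w
  let G4 : ℝ × ℝ × Z → V := fun w => w.2.1 • dDir eB Hb w
  let G5 : ℝ × ℝ × Z → V := fun w => w.1 • dDir eB Hb w
  have c1 : ContDiff ℝ ∞ G1 := contDiff_fst.smul hf.1
  have c2 : ContDiff ℝ ∞ G2 := contDiff_const.smul hb.1
  have c3 : ContDiff ℝ ∞ G3 := contDiff_fst.smul hA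
  have c4 : ContDiff ℝ ∞ G4 := (contDiff_fst.comp contDiff_snd).smul hB
  have c5 : ContDiff ℝ ∞ G5 := contDiff_fst.smul hB
  let G : ℝ × ℝ × Z → V := fun w => G1 w + (G2 w + (G3 w + (G4 w + G5 w)))
  have hG : ContDiff ℝ ∞ G := c1.add (c2.add (c3.add (c4.add c5)))
  have hT : ∀ i j z, tcoef i j G z = tcoef i j G1 z + (tcoef i j G2 z + (tcoef i j G3 z +
      (tcoef i j G4 z + tcoef i j G5 z))) := fun i j z => by
    rw [tcoef_add c1 (c2.add (c3.add (c4.add c5))), tcoef_add c2 (c3.add (c4.add c5)),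
      tcoef_add c3 (c4.add c5), tcoef_add c4 c5]
  have hT4 : ∀ i j z, tcoef i j G4 z = (j : ℝ) • tcoef i j Hb z := by
    intro i j z
    cases j with
    | zero => simp only [G4]; rw [tcoef_snd_smul_zero hB]; simp
    | succ j =>
      simp only [G4]
      rw [tcoef_snd_smul_succ hB, tcoef_dDir_eB hb.1]
      push_cast; rfl
  have hTs : ∀ i j z, tcoef (i + 1) j G z = tcoef i j Hf z +
      (((i : ℝ) + 1 + j - t) • tcoef (i + 1) j Hb z + ((j : ℝ) + 1) • tcoef i (j + 1) Hb z) := by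
    intro i j z
    rw [hT, hT4]
    simp only [G1, G2, G3, G5]
    rw [tcoef_fst_smul_succ hf.1, tcoef_const_smul _ hb.1, tcoef_fst_smul_succ hA,
      tcoef_dDir_eA hb.1, tcoef_fst_smul_succ hB, tcoef_dDir_eB hb.1]
    module
  have hT0 : ∀ j z, tcoef 0 j G z = ((j : ℝ) - t) • tcoef 0 j Hb z := by
    intro j z
    rw [hT, hT4]
    simp only [G1, G2, G3, G5]
    rw [tcoef_fst_smul_zero hf.1, tcoef_const_smul _ hb.1, tcoef_fst_smul_zero hA,
      tcoef_fst_smul_zero hB]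
    module
  have hmain : ∀ z, (∀ i j : ℕ, tcoef i j Hf z = c z ((i : ℤ) - t) j) →
      (∀ i j : ℕ, i + j ≤ t + K → tcoef i j Hb z = -primCoeff t (c z) ((i : ℤ) - t) j) →
      ∀ i j : ℕ, i + 1 + j ≤ t + K → tcoef (i + 1) j G z =
        if i < t then 0 else c z ((i : ℤ) - t) j := by
    intro z h1 h2 i j hij
    -- By `primCoeff_rec` the counterterm contributes minus the coefficient of `f` for `i < t` and
    -- nothing for `i ≥ t`, so the finite part of `f` is untouched.
    rw [hTs, h1, h2 _ _ hij, h2 i (j + 1) (by omega), smul_neg, smul_neg, ← neg_add,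
      primCoeff_rec]
    split_ifs <;> simp
  refine ⟨G, ⟨hG, ?_⟩, ?_, ?_⟩
  · obtain ⟨ε, hε, hbx⟩ := eventually_box hb.2
    obtain ⟨ε', hε', hfx⟩ := eventually_box hf.2
    refine eventually_of_box (lt_min hε hε') fun s z hs hs' hz => ?_
    rw [lt_min_iff] at hs' hz
    have hs0 : s ≠ 0 := hs.ne'
    have h1 : (fun s => b s z) =ᶠ[𝓝 s] fun s => (s ^ t)⁻¹ • Hb (s, s * Real.log s, z) := by
      filter_upwards [Ioo_mem_nhds hs hs'.1] with x hx
      have hx0 : x ^ t ≠ 0 := pow_ne_zero _ hx.1.ne'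
      rw [← hbx x z hx.1 hx.2 hz.1, smul_smul, inv_mul_cancel₀ hx0, one_smul]
    have hlog : HasDerivAt (fun s => s * Real.log s) (Real.log s + 1) s := by
      have := (hasDerivAt_id' s).fun_mul (Real.hasDerivAt_log hs0)
      simpa [hs0] using this
    have hpow : HasDerivAt (fun s : ℝ => (s ^ t)⁻¹) (-t * (s ^ (t + 1))⁻¹) s := by
      refine ((hasDerivAt_pow t s).fun_inv (by positivity)).congr_deriv ?_
      rcases Nat.eq_zero_or_pos t with rfl | ht
      · simp
      · obtain ⟨t, rfl⟩ : ∃ t', t = t' + 1 := ⟨t - 1, by omega⟩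
        simp only [Nat.add_sub_cancel]
        field_simp
        ring
    have h4 : HasFDerivAt Hb (fderiv ℝ Hb (s, s * Real.log s, z)) (s, s * Real.log s, z) :=
      (hb.1.contDiffAt.differentiableAt (by simp)).hasFDerivAt
    have h5 := h4.comp_hasDerivAt s ((hasDerivAt_id' s).prodMk (hlog.prodMk (hasDerivAt_const s z)))
    have h6 : ((1, Real.log s + 1, 0) : ℝ × ℝ × Z) = eA + (Real.log s + 1) • eB := by
      simp [eA, eB]
    rw [h6, map_add, map_smul] at h5
    have h7 := (hpow.smul h5).deriv
    dsimp only
    rw [h1.deriv_eq]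
    have h8 : deriv (fun s => (s ^ t)⁻¹ • Hb (s, s * Real.log s, z)) s = _ := h7
    rw [h8]
    have hf' := hfx s z hs hs'.2 hz.2
    dsimp only at hf'
    simp only [G, G1, G2, G3, G4, G5]
    rw [← hf']
    simp only [dDir, Function.comp, smul_add, smul_smul]
    have q1 : s ^ (t + 1) * (s ^ t)⁻¹ = s := by rw [pow_succ]; field_simp
    have q2 : s ^ (t + 1) * (-(t : ℝ) * (s ^ (t + 1))⁻¹) = -t := by field_simp
    have q3 : s ^ (t + 1) * ((s ^ t)⁻¹ * (Real.log s + 1)) = s * Real.log s + s := by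
      rw [← mul_assoc, q1]; ring
    rw [q1, q2, q3, pow_succ, mul_comm (s ^ t) s]
    module
  · filter_upwards [cf, cb] with z h1 h2 i j hi hij
    cases i with
    | zero =>
      rw [hT0, h2 0 j hij, smul_neg, primCoeff_bot, neg_zero]
    | succ i => rw [hmain z h1 h2 i j hij, if_pos (by omega)]
  -- Here `1 ≤ K` enters: the finite part sits at order `t + 1` of `G`, which must not exceed `t +
  -- K`.
  · rw [hmain z₀ cf.self_of_nhds cb.self_of_nhds t 0 (by omega), if_neg (lt_irrefl t), sub_self]

/-- If `s^t f(s, z)` is a smooth function of `s`, `s log s` and `z`, and `∂_s f` is bounded, then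
`f` converges to the finite part of its expansion. -/
lemma IsLogSmooth.tendsto_of_bounded_deriv [CompleteSpace V] {t : ℕ} {z₀ : Z} {f : ℝ → Z → V}
    {H : ℝ × ℝ × Z → V} (h : IsLogSmooth t z₀ f H) {C : ℝ}
    (hd : ∀ᶠ p : ℝ × Z in 𝓝[>] 0 ×ˢ 𝓝 z₀,
      DifferentiableAt ℝ (fun s => f s p.2) p.1 ∧ ‖deriv (fun s => f s p.2) p.1‖ ≤ C) :
    Tendsto (fun p : ℝ × Z => f p.1 p.2) (𝓝[>] 0 ×ˢ 𝓝 z₀) (𝓝 (tcoef t 0 H z₀)) := by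
  obtain ⟨ε₁, hε₁, h₁⟩ := eventually_box h.2
  obtain ⟨ε₂, hε₂, h₂⟩ := eventually_box hd
  obtain ⟨ε, hε, hε₁', hε₂'⟩ : ∃ ε > 0, ε ≤ ε₁ ∧ ε ≤ ε₂ :=
    ⟨min ε₁ ε₂, lt_min hε₁ hε₂, min_le_left _ _, min_le_right _ _⟩
  -- By the mean value inequality `f` is Lipschitz in `s`, uniformly in `z`. Hence `f` is Cauchy as
  -- `s → 0` for each `z`, and the convergence has the uniform rate `C * s`.
  have hC : ∀ z, dist z z₀ < ε → ∀ s ∈ Ioo 0 ε, ∀ s' ∈ Ioo 0 ε,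
      ‖f s z - f s' z‖ ≤ C * ‖s - s'‖ := by
    intro z hz s hs s' hs'
    refine (convex_Ioo 0 ε).norm_image_sub_le_of_norm_deriv_le (f := fun s => f s z)
      (fun x hx => ?_) (fun x hx => ?_) hs' hs
    · exact (h₂ x z hx.1 (hx.2.trans_le hε₂') (hz.trans_le hε₂')).1
    · exact (h₂ x z hx.1 (hx.2.trans_le hε₂') (hz.trans_le hε₂')).2
  have hC0 : 0 ≤ C := (norm_nonneg _).trans
    (h₂ (ε / 2) z₀ (by linarith) (by linarith) (by simpa using hε₂)).2
  have hIoo : Ioo 0 ε ∈ 𝓝[>] (0 : ℝ) := Ioo_mem_nhdsGT hε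
  have hlim : ∀ z, dist z z₀ < ε → Tendsto (fun s => f s z) (𝓝[>] 0) (𝓝 (tcoef t 0 H z)) := by
    intro z hz
    have hcau : Cauchy (map (fun s => f s z) (𝓝[>] 0)) := by
      rw [Metric.cauchy_iff]
      refine ⟨inferInstance, fun δ hδ => ?_⟩
      obtain ⟨r, hr, hrε, hrδ⟩ : ∃ r > 0, r ≤ ε ∧ C * r < δ := by
        refine ⟨min ε (δ / (2 * (C + 1))), lt_min hε (by positivity), min_le_left _ _, ?_⟩
        calc C * min ε (δ / (2 * (C + 1))) ≤ C * (δ / (2 * (C + 1))) := by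
              gcongr; exact min_le_right _ _
          _ < δ := by
            rw [mul_div_assoc', div_lt_iff₀ (by positivity)]
            nlinarith
      refine ⟨(fun s => f s z) '' Ioo 0 r, image_mem_map (Ioo_mem_nhdsGT hr), ?_⟩
      rintro _ ⟨s, hs, rfl⟩ _ ⟨s', hs', rfl⟩
      rw [dist_eq_norm]
      refine (hC z hz s ⟨hs.1, hs.2.trans_le hrε⟩ s' ⟨hs'.1, hs'.2.trans_le hrε⟩).trans_lt
        (lt_of_le_of_lt ?_ hrδ)
      gcongr
      rw [Real.norm_eq_abs, abs_le]
      constructor <;> linarith [hs.1, hs.2, hs'.1, hs'.2]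
    obtain ⟨w, hw⟩ := cauchy_map_iff_exists_tendsto.1 hcau
    -- Once a limit exists, it can only be the finite part of the expansion.
    rw [tcoef_eq_of_tendsto h.1 z t (w := w) (hw.congr' ?_)]
    · exact hw
    · filter_upwards [hIoo] with s hs
      have hs0 : s ^ t ≠ 0 := pow_ne_zero _ hs.1.ne'
      have := h₁ s z hs.1 (hs.2.trans_le hε₁') (hz.trans_le hε₁')
      dsimp only at this
      rw [← this, smul_smul, inv_mul_cancel₀ hs0, one_smul]
  have hunif : ∀ z, dist z z₀ < ε → ∀ s ∈ Ioo 0 ε, ‖f s z - tcoef t 0 H z‖ ≤ C * s := by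
    intro z hz s hs
    have h3 : Tendsto (fun s' => ‖f s z - f s' z‖) (𝓝[>] 0) (𝓝 ‖f s z - tcoef t 0 H z‖) :=
      (tendsto_const_nhds.sub (hlim z hz)).norm
    have h4 : Tendsto (fun s' => C * ‖s - s'‖) (𝓝[>] 0) (𝓝 (C * ‖s - 0‖)) :=
      (tendsto_nhdsWithin_of_tendsto_nhds (by fun_prop : Continuous fun s' : ℝ => ‖s - s'‖).continuousAt.tendsto).const_mul C
    have h5 := le_of_tendsto_of_tendsto h3 h4 (by
      filter_upwards [hIoo] with s' hs' using hC z hz s hs s' hs')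
    rwa [sub_zero, Real.norm_eq_abs, abs_of_pos hs.1] at h5
  have hT : Tendsto (fun p : ℝ × Z => tcoef t 0 H p.2) (𝓝[>] 0 ×ˢ 𝓝 z₀) (𝓝 (tcoef t 0 H z₀)) :=
    ((contDiff_tcoef h.1 t 0).continuous.tendsto z₀).comp tendsto_snd
  have hdiff : Tendsto (fun p : ℝ × Z => f p.1 p.2 - tcoef t 0 H p.2) (𝓝[>] 0 ×ˢ 𝓝 z₀) (𝓝 0) := by
    have h6 : Tendsto (fun p : ℝ × Z => C * p.1) (𝓝[>] 0 ×ˢ 𝓝 z₀) (𝓝 0) := by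
      have h7 : Tendsto (fun s : ℝ => C * s) (𝓝[>] 0) (𝓝 (C * 0)) :=
        tendsto_nhdsWithin_of_tendsto_nhds ((continuous_const.mul continuous_id).tendsto 0)
      rw [mul_zero] at h7
      exact h7.comp tendsto_fst
    refine squeeze_zero_norm' (eventually_of_box hε fun s z hs hs' hz => ?_) h6
    exact hunif z hz s ⟨hs, hs'⟩
  have := hdiff.add hT
  rw [zero_add] at this
  exact this.congr fun p => by rw [sub_add_cancel]

end RenormalizedLimits

end

end HolRen

namespace HolRen

noncomputable section

/-! ### The flow of the rigging vector field -/

namespace RiggedBoundary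

variable {m : ℕ} {M N : Type*}
  [TopologicalSpace M] [ChartedSpace (Eu (m + 2)) M] [IsManifold (𝓡 (m + 2)) ∞ M]
  [TopologicalSpace N] [ChartedSpace (Eu (m + 1)) N] (C : RiggedBoundary m M N)

lemma mem_dom {s : ℝ} (hs : s ∈ Ico 0 C.υmax) (q : N) : (s, q) ∈ C.dom :=
  C.subset_dom ⟨hs, mem_univ q⟩

lemma isOpen_slice (q : N) : IsOpen {s | (s, q) ∈ C.dom} :=
  C.isOpen_dom.preimage (by fun_prop : Continuous fun s : ℝ => (s, q))

lemma exists_Ioo_subset (q : N) : ∃ ε > 0, ∀ s ∈ Ioo (-ε) C.υmax, (s, q) ∈ C.dom := by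
  have h0 : {s | (s, q) ∈ C.dom} ∈ 𝓝 (0 : ℝ) :=
    (C.isOpen_slice q).mem_nhds (C.mem_dom ⟨le_rfl, C.υmax_pos⟩ q)
  obtain ⟨ε, hε, h⟩ := Metric.mem_nhds_iff.1 h0
  refine ⟨ε, hε, fun s hs => ?_⟩
  rcases lt_or_ge s 0 with h1 | h1
  · exact h (by rw [Metric.mem_ball, Real.dist_eq, sub_zero, abs_lt]; constructor <;> linarith [hs.1])
  · exact C.mem_dom ⟨h1, hs.2⟩ q

lemma hasMFDerivAt_flow {s : ℝ} {q : N} (h : (s, q) ∈ C.dom) :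
    HasMFDerivAt 𝓘(ℝ, ℝ) (𝓡 (m + 2)) (fun s => C.flow s q) s
      ((1 : ℝ →L[ℝ] ℝ).smulRight (C.v (C.flow s q))) :=
  (C.integralCurve q s h).hasMFDerivAt ((C.isOpen_slice q).mem_nhds h)

lemma hasDerivAt_Φ_flow {s : ℝ} {q : N} (h : (s, q) ∈ C.dom) :
    HasDerivAt (fun s => C.Φ (C.flow s q)) 1 s := by
  have h1 : HasMFDerivAt (𝓡 (m + 2)) 𝓘(ℝ, ℝ) C.Φ (C.flow s q) _ :=
    (C.contMDiff_Φ.mdifferentiable (by simp) _).hasMFDerivAt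
  let T : Eu (m + 2) →L[ℝ] ℝ := mfderiv (𝓡 (m + 2)) 𝓘(ℝ, ℝ) C.Φ (C.flow s q)
  let w : Eu (m + 2) := C.v (C.flow s q)
  have hT : T w = 1 := C.rigging (C.flow s q)
  have h2 : HasFDerivAt (fun s => C.Φ (C.flow s q)) (T.comp ((1 : ℝ →L[ℝ] ℝ).smulRight w)) s :=
    (h1.comp s (C.hasMFDerivAt_flow h)).hasFDerivAt
  exact h2.hasDerivAt.congr_deriv (by simp [hT])

/-- `Φ` grows at unit rate along `v` and vanishes on `N`. Flow lines extend to slightly negative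
times, so the time `0` lies inside an open interval on which `Φ - s` has zero derivative. -/
lemma Φ_flow {s : ℝ} (hs : s ∈ Ico 0 C.υmax) (q : N) : C.Φ (C.flow s q) = s := by
  obtain ⟨ε, hε, h⟩ := C.exists_Ioo_subset q
  have hd : ∀ x ∈ Ioo (-ε) C.υmax, HasDerivAt (fun s => C.Φ (C.flow s q) - s) 0 x := fun x hx => by
    simpa using (C.hasDerivAt_Φ_flow (h x hx)).fun_sub (hasDerivAt_id' x)
  have := isOpen_Ioo.is_const_of_deriv_eq_zero isPreconnected_Ioo
    (fun x hx => (hd x hx).differentiableAt.differentiableWithinAt)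
    (fun x hx => (hd x hx).deriv)
    (show s ∈ Ioo (-ε) C.υmax from ⟨by linarith [hs.1], hs.2⟩)
    (show (0 : ℝ) ∈ Ioo (-ε) C.υmax from ⟨by linarith, C.υmax_pos⟩)
  simp only [C.Φ_incl, sub_zero] at this
  linarith

/-- `Φ` recovers the time, so flow lines can only meet at equal times. Uniqueness of integral
curves, valid in a Hausdorff manifold, carries the coincidence back to time `0`, where the inclusion
is injective. -/
lemma flow_injective [T2Space M] {s s' : ℝ} (hs : s ∈ Ico 0 C.υmax) (hs' : s' ∈ Ico 0 C.υmax)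
    {q q' : N} (h : C.flow s q = C.flow s' q') : s = s' ∧ q = q' := by
  have h1 : s = s' := by rw [← C.Φ_flow hs q, h, C.Φ_flow hs' q']
  subst h1
  refine ⟨rfl, C.incl_injective ?_⟩
  obtain ⟨ε, hε, hd⟩ := C.exists_Ioo_subset q
  obtain ⟨ε', hε', hd'⟩ := C.exists_Ioo_subset q'
  have hpos : 0 < min ε ε' := lt_min hε hε'
  have h2 := isMIntegralCurveOn_Ioo_eqOn_of_contMDiff_boundaryless (I := 𝓡 (m + 2))
    (a := -min ε ε') (b := C.υmax) (t₀ := s) ⟨by linarith [hs.1], hs.2⟩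
    (C.contMDiff_v.of_le (by exact_mod_cast le_top))
    ((C.integralCurve q).mono fun x hx => hd x ⟨by linarith [hx.1, min_le_left ε ε'], hx.2⟩)
    ((C.integralCurve q').mono fun x hx => hd' x ⟨by linarith [hx.1, min_le_right ε ε'], hx.2⟩) h
  exact h2 (show (0 : ℝ) ∈ Ioo (-min ε ε') C.υmax from ⟨by linarith, C.υmax_pos⟩)

/-- The parametrization `(s, y) ↦ π_s(q)` of a neighbourhood of a flow line, where `y` are the
coordinates of `q` in the preferred chart at `q₀`. -/
def par (q₀ : N) (z : ℝ × Eu (m + 1)) : M := C.flow z.1 ((extChartAt (𝓡 (m + 1)) q₀).symm z.2)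

/-- The domain of `par`. -/
def parDom (q₀ : N) : Set (ℝ × Eu (m + 1)) :=
  {z | z.2 ∈ (extChartAt (𝓡 (m + 1)) q₀).target ∧
    (z.1, (extChartAt (𝓡 (m + 1)) q₀).symm z.2) ∈ C.dom}

/-- The differential of `par`. -/
def dpar (q₀ : N) (z : ℝ × Eu (m + 1)) : ℝ × Eu (m + 1) →L[ℝ] Eu (m + 2) :=
  mfderiv 𝓘(ℝ, ℝ × Eu (m + 1)) (𝓡 (m + 2)) (C.par q₀) z

lemma isOpen_parDom (q₀ : N) : IsOpen (C.parDom q₀) := by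
  have ho : IsOpen ((univ : Set ℝ) ×ˢ (extChartAt (𝓡 (m + 1)) q₀).target) :=
    isOpen_univ.prod (isOpen_extChartAt_target q₀)
  have hc : ContinuousOn (fun z : ℝ × Eu (m + 1) =>
      (z.1, (extChartAt (𝓡 (m + 1)) q₀).symm z.2))
      ((univ : Set ℝ) ×ˢ (extChartAt (𝓡 (m + 1)) q₀).target) :=
    continuousOn_fst.prodMk ((continuousOn_extChartAt_symm q₀).comp continuousOn_snd fun z hz => hz.2)
  have := hc.isOpen_inter_preimage ho C.isOpen_dom
  convert this using 1
  ext z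
  simp [parDom]

lemma mem_parDom {s : ℝ} (hs : s ∈ Ico 0 C.υmax) {q₀ : N} {y : Eu (m + 1)}
    (hy : y ∈ (extChartAt (𝓡 (m + 1)) q₀).target) : (s, y) ∈ C.parDom q₀ :=
  ⟨hy, C.mem_dom hs _⟩

variable [IsManifold (𝓡 (m + 1)) ∞ N]

lemma contMDiffOn_par (q₀ : N) :
    ContMDiffOn 𝓘(ℝ, ℝ × Eu (m + 1)) (𝓡 (m + 2)) ∞ (C.par q₀) (C.parDom q₀) := by
  have h1 : ContMDiffOn 𝓘(ℝ, ℝ × Eu (m + 1)) (𝓘(ℝ, ℝ).prod (𝓡 (m + 1))) ∞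
      (fun z : ℝ × Eu (m + 1) => (z.1, (extChartAt (𝓡 (m + 1)) q₀).symm z.2)) (C.parDom q₀) := by
    refine ContMDiffOn.prodMk contDiff_fst.contMDiff.contMDiffOn ?_
    exact (contMDiffOn_extChartAt_symm q₀).comp contDiff_snd.contMDiff.contMDiffOn fun z hz => hz.1
  exact C.contMDiffOn_flow.comp h1 fun z hz => hz.2

lemma contMDiffAt_par {q₀ : N} {z : ℝ × Eu (m + 1)} (hz : z ∈ C.parDom q₀) :
    ContMDiffAt 𝓘(ℝ, ℝ × Eu (m + 1)) (𝓡 (m + 2)) ∞ (C.par q₀) z :=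
  (C.contMDiffOn_par q₀).contMDiffAt ((C.isOpen_parDom q₀).mem_nhds hz)

lemma hasMFDerivAt_par {q₀ : N} {z : ℝ × Eu (m + 1)} (hz : z ∈ C.parDom q₀) :
    HasMFDerivAt 𝓘(ℝ, ℝ × Eu (m + 1)) (𝓡 (m + 2)) (C.par q₀) z (C.dpar q₀ z) :=
  ((C.contMDiffAt_par hz).mdifferentiableAt (by simp)).hasMFDerivAt

lemma dpar_normal {q₀ : N} {z : ℝ × Eu (m + 1)} (hz : z ∈ C.parDom q₀) :
    C.dpar q₀ z (1, 0) = C.v (C.par q₀ z) := by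
  have h1 : HasMFDerivAt 𝓘(ℝ, ℝ) 𝓘(ℝ, ℝ × Eu (m + 1)) (fun s : ℝ => (s, z.2)) z.1
      (ContinuousLinearMap.inl ℝ ℝ (Eu (m + 1))) :=
    (hasFDerivAt_prodMk_left z.1 z.2).hasMFDerivAt
  have h2 := (C.hasMFDerivAt_par (z := (z.1, z.2)) hz).comp z.1 h1
  have h3 := hasMFDerivAt_unique h2 (C.hasMFDerivAt_flow hz.2)
  have h4 := congrArg (fun T : ℝ →L[ℝ] Eu (m + 2) => T 1) h3
  change C.dpar q₀ z (1, 0) = (1 : ℝ) • C.v (C.flow z.1 _) at h4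
  rw [one_smul] at h4
  exact h4

/-- The link between the pullback by `π_s` and the restriction of forms to a slice of the flow
coordinates. -/
lemma mfderiv_flow_comp {q₀ : N} {z : ℝ × Eu (m + 1)} (hz : z ∈ C.parDom q₀) :
    (mfderiv (𝓡 (m + 1)) (𝓡 (m + 2)) (C.flow z.1) ((extChartAt (𝓡 (m + 1)) q₀).symm z.2) :
      Eu (m + 1) →L[ℝ] Eu (m + 2)).comp
      (mfderiv 𝓘(ℝ, Eu (m + 1)) (𝓡 (m + 1)) (extChartAt (𝓡 (m + 1)) q₀).symm z.2 :
        Eu (m + 1) →L[ℝ] Eu (m + 1)) =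
      (C.dpar q₀ z).comp (ContinuousLinearMap.inr ℝ ℝ (Eu (m + 1))) := by
  have h1 : HasMFDerivAt 𝓘(ℝ, Eu (m + 1)) 𝓘(ℝ, ℝ × Eu (m + 1)) (fun y => (z.1, y)) z.2
      (ContinuousLinearMap.inr ℝ ℝ (Eu (m + 1))) :=
    (hasFDerivAt_prodMk_right z.1 z.2).hasMFDerivAt
  have h2 := (C.hasMFDerivAt_par (z := (z.1, z.2)) hz).comp z.2 h1
  have h3 : HasMFDerivAt 𝓘(ℝ, Eu (m + 1)) (𝓡 (m + 1)) (extChartAt (𝓡 (m + 1)) q₀).symm z.2 _ :=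
    (((contMDiffOn_extChartAt_symm (n := ∞) q₀).contMDiffAt
      ((isOpen_extChartAt_target q₀).mem_nhds hz.1)).mdifferentiableAt (by simp)).hasMFDerivAt
  have h4 : MDifferentiableAt (𝓡 (m + 1)) (𝓡 (m + 2)) (C.flow z.1)
      ((extChartAt (𝓡 (m + 1)) q₀).symm z.2) := by
    have h5 : ContMDiffAt (𝓡 (m + 1)) (𝓘(ℝ, ℝ).prod (𝓡 (m + 1))) ∞ (fun q : N => (z.1, q))
        ((extChartAt (𝓡 (m + 1)) q₀).symm z.2) := contMDiffAt_const.prodMk contMDiffAt_id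
    have h6 := C.contMDiffOn_flow.contMDiffAt (C.isOpen_dom.mem_nhds hz.2)
    exact (h6.comp _ h5).mdifferentiableAt (by simp)
  exact hasMFDerivAt_unique (h4.hasMFDerivAt.comp z.2 h3) h2

end RiggedBoundary

end

end HolRen

namespace HolRen

noncomputable section

/-! ### Differentials of charts -/

section Charts

variable {n k : ℕ} {X : Type*} [TopologicalSpace X] [ChartedSpace (Eu n) X]

/-- The differential of the preferred chart at `x₀`. -/
def dChart (x₀ x : X) : Eu n →L[ℝ] Eu n :=
  mfderiv (𝓡 n) 𝓘(ℝ, Eu n) (extChartAt (𝓡 n) x₀) x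

/-- The differential of the inverse of the preferred chart at `x₀`. -/
def dSymm (x₀ : X) (y : Eu n) : Eu n →L[ℝ] Eu n :=
  mfderiv 𝓘(ℝ, Eu n) (𝓡 n) (extChartAt (𝓡 n) x₀).symm y

lemma inChart_eq (x₀ : X) (η : SpForm n k X) (y : Eu n) :
    inChart x₀ η y = (η ((extChartAt (𝓡 n) x₀).symm y)).compContinuousLinearMap (dSymm x₀ y) := rfl

variable [IsManifold (𝓡 n) ∞ X]

lemma hasMFDerivAt_chart {x₀ x : X} (hx : x ∈ (extChartAt (𝓡 n) x₀).source) :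
    HasMFDerivAt (𝓡 n) 𝓘(ℝ, Eu n) (extChartAt (𝓡 n) x₀) x (dChart x₀ x) :=
  ((contMDiffAt_extChartAt' (n := ∞) (by rwa [extChartAt_source] at hx)).mdifferentiableAt
    (by simp)).hasMFDerivAt

lemma hasMFDerivAt_chart_symm {x₀ : X} {y : Eu n} (hy : y ∈ (extChartAt (𝓡 n) x₀).target) :
    HasMFDerivAt 𝓘(ℝ, Eu n) (𝓡 n) (extChartAt (𝓡 n) x₀).symm y (dSymm x₀ y) :=
  (((contMDiffOn_extChartAt_symm (n := ∞) x₀).contMDiffAt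
    ((isOpen_extChartAt_target x₀).mem_nhds hy)).mdifferentiableAt (by simp)).hasMFDerivAt

lemma dSymm_comp_dChart {x₀ x : X} (hx : x ∈ (extChartAt (𝓡 n) x₀).source) :
    (dSymm x₀ (extChartAt (𝓡 n) x₀ x)).comp (dChart x₀ x) = ContinuousLinearMap.id ℝ (Eu n) := by
  have h1 := (hasMFDerivAt_chart_symm ((extChartAt (𝓡 n) x₀).map_source hx)).comp x
    (hasMFDerivAt_chart hx)
  have h2 : HasMFDerivAt (𝓡 n) (𝓡 n) ((extChartAt (𝓡 n) x₀).symm ∘ extChartAt (𝓡 n) x₀) x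
      (ContinuousLinearMap.id ℝ (Eu n)) := by
    refine (hasMFDerivAt_id x).congr_of_eventuallyEq ?_
    filter_upwards [(isOpen_extChartAt_source x₀).mem_nhds hx] with x' hx'
    exact (extChartAt (𝓡 n) x₀).left_inv hx'
  exact hasMFDerivAt_unique h1 h2

lemma dChart_comp_dSymm {x₀ : X} {y : Eu n} (hy : y ∈ (extChartAt (𝓡 n) x₀).target) :
    (dChart x₀ ((extChartAt (𝓡 n) x₀).symm y)).comp (dSymm x₀ y) =
      ContinuousLinearMap.id ℝ (Eu n) := by
  have h1 := (hasMFDerivAt_chart ((extChartAt (𝓡 n) x₀).map_target hy)).comp y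
    (hasMFDerivAt_chart_symm hy)
  have h2 : HasMFDerivAt 𝓘(ℝ, Eu n) 𝓘(ℝ, Eu n)
      (extChartAt (𝓡 n) x₀ ∘ (extChartAt (𝓡 n) x₀).symm) y (ContinuousLinearMap.id ℝ (Eu n)) := by
    refine (hasMFDerivAt_id y).congr_of_eventuallyEq ?_
    filter_upwards [(isOpen_extChartAt_target x₀).mem_nhds hy] with x' hx'
    exact (extChartAt (𝓡 n) x₀).right_inv hx'
  exact hasMFDerivAt_unique h1 h2

lemma eq_inChart_comp {x₀ x : X} (hx : x ∈ (extChartAt (𝓡 n) x₀).source) (η : SpForm n k X) :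
    η x = (inChart x₀ η (extChartAt (𝓡 n) x₀ x)).compContinuousLinearMap (dChart x₀ x) := by
  rw [inChart_eq, (extChartAt (𝓡 n) x₀).left_inv hx]
  ext w
  have h := fun i => congrArg (fun T : Eu n →L[ℝ] Eu n => T (w i)) (dSymm_comp_dChart hx)
  simp only [ContinuousLinearMap.comp_apply, ContinuousLinearMap.id_apply] at h
  simp only [ContinuousAlternatingMap.compContinuousLinearMap_apply, Function.comp_def, h]

end Charts

/-! ### The flow in charts of `M` and its linearization -/

namespace RiggedBoundary

variable {m : ℕ} {M N : Type*}
  [TopologicalSpace M] [ChartedSpace (Eu (m + 2)) M] [IsManifold (𝓡 (m + 2)) ∞ M]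
  [TopologicalSpace N] [ChartedSpace (Eu (m + 1)) N] (C : RiggedBoundary m M N)

/-- The rigging vector field in the chart at `x₀`. -/
def vChart (x₀ : M) (y : Eu (m + 2)) : Eu (m + 2) :=
  dChart x₀ ((extChartAt (𝓡 (m + 2)) x₀).symm y)
    (C.v ((extChartAt (𝓡 (m + 2)) x₀).symm y) : Eu (m + 2))

/-- Smoothness of the section `v` is tested in the trivialization of the tangent bundle at `x₀`,
whose fibre part is the differential of the chart. -/
lemma contDiffAt_vChart (x₀ : M) :
    ContDiffAt ℝ ∞ (C.vChart x₀) (extChartAt (𝓡 (m + 2)) x₀ x₀) := by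
  have hv := C.contMDiff_v.contMDiffAt (x := x₀)
  rw [contMDiffAt_iff] at hv
  have h1 := (hv.2.contDiffAt (range_mem_nhds_isInteriorPoint
    (BoundarylessManifold.isInteriorPoint))).snd
  refine h1.congr_of_eventuallyEq ?_
  filter_upwards [extChartAt_target_mem_nhds (I := 𝓡 (m + 2)) x₀] with y hy
  have hs := (extChartAt (𝓡 (m + 2)) x₀).map_target hy
  rw [extChartAt_source] at hs
  have h2 := mfderiv_chartAt_eq_tangentCoordChange (I := 𝓡 (m + 2)) hs
  exact congrArg (fun T : Eu (m + 2) →L[ℝ] Eu (m + 2) =>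
    T (C.v ((extChartAt (𝓡 (m + 2)) x₀).symm y) : Eu (m + 2))) h2

variable [IsManifold (𝓡 (m + 1)) ∞ N]

/-- The parametrization `par` in the chart at `x₀`. -/
def chartPar (x₀ : M) (q₀ : N) (z : ℝ × Eu (m + 1)) : Eu (m + 2) :=
  extChartAt (𝓡 (m + 2)) x₀ (C.par q₀ z)

variable {C} {x₀ : M} {q₀ : N} {z : ℝ × Eu (m + 1)}

lemma contDiffAt_chartPar (hz : z ∈ C.parDom q₀)
    (hx : C.par q₀ z ∈ (extChartAt (𝓡 (m + 2)) x₀).source) :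
    ContDiffAt ℝ ∞ (C.chartPar x₀ q₀) z :=
  ((contMDiffAt_extChartAt' (n := ∞) (by rwa [extChartAt_source] at hx)).comp z
    (C.contMDiffAt_par hz)).contDiffAt

lemma hasFDerivAt_chartPar (hz : z ∈ C.parDom q₀)
    (hx : C.par q₀ z ∈ (extChartAt (𝓡 (m + 2)) x₀).source) :
    HasFDerivAt (C.chartPar x₀ q₀) ((dChart x₀ (C.par q₀ z)).comp (C.dpar q₀ z)) z :=
  ((hasMFDerivAt_chart hx).comp z (C.hasMFDerivAt_par hz)).hasFDerivAt

lemma dpar_eq (hz : z ∈ C.parDom q₀)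
    (hx : C.par q₀ z ∈ (extChartAt (𝓡 (m + 2)) x₀).source) :
    C.dpar q₀ z = (dSymm x₀ (C.chartPar x₀ q₀ z)).comp (fderiv ℝ (C.chartPar x₀ q₀) z) := by
  rw [(hasFDerivAt_chartPar hz hx).fderiv, ← ContinuousLinearMap.comp_assoc, chartPar,
    dSymm_comp_dChart hx, ContinuousLinearMap.id_comp]

lemma eventually_par_mem (hz : z ∈ C.parDom q₀)
    (hx : C.par q₀ z ∈ (extChartAt (𝓡 (m + 2)) x₀).source) :
    ∀ᶠ z' in 𝓝 z, z' ∈ C.parDom q₀ ∧ C.par q₀ z' ∈ (extChartAt (𝓡 (m + 2)) x₀).source :=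
  Eventually.and ((C.isOpen_parDom q₀).mem_nhds hz)
    ((C.contMDiffAt_par hz).continuousAt.preimage_mem_nhds
      ((isOpen_extChartAt_source x₀).mem_nhds hx))

lemma fderiv_chartPar_normal (hz : z ∈ C.parDom q₀)
    (hx : C.par q₀ z ∈ (extChartAt (𝓡 (m + 2)) x₀).source) :
    fderiv ℝ (C.chartPar x₀ q₀) z (1, 0) = C.vChart x₀ (C.chartPar x₀ q₀ z) := by
  rw [(hasFDerivAt_chartPar hz hx).fderiv, vChart, chartPar,
    (extChartAt (𝓡 (m + 2)) x₀).left_inv hx, ContinuousLinearMap.comp_apply, C.dpar_normal hz]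

/-- The variations of the flow satisfy the linearized flow equation. -/
lemma hasDerivAt_fderiv_chartPar {s : ℝ} {y : Eu (m + 1)} (hz : (s, y) ∈ C.parDom q₀)
    (hx : C.par q₀ (s, y) ∈ (extChartAt (𝓡 (m + 2)) x₀).source)
    (hV : DifferentiableAt ℝ (C.vChart x₀) (C.chartPar x₀ q₀ (s, y))) (w : Eu (m + 1)) :
    HasDerivAt (fun s => fderiv ℝ (C.chartPar x₀ q₀) (s, y) (0, w))
      (fderiv ℝ (C.vChart x₀) (C.chartPar x₀ q₀ (s, y))
        (fderiv ℝ (C.chartPar x₀ q₀) (s, y) (0, w))) s := by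
  have hc := contDiffAt_chartPar hz hx
  have hd : DifferentiableAt ℝ (fun z => fderiv ℝ (C.chartPar x₀ q₀) z (0, w)) (s, y) :=
    ((hc.fderiv_right (m := 1) (by simpa [one_add_one_eq_two] using two_le_infty)).differentiableAt
      (by simp)).clm_apply (differentiableAt_const _)
  have h1 := hd.hasFDerivAt.comp_hasDerivAt s ((hasDerivAt_id' s).prodMk (hasDerivAt_const s y))
  refine h1.congr_deriv ?_
  -- After exchanging the derivatives, the inner one is along the flow and equals the vector field
  -- on the curve; differentiating that in the direction `w` linearizes the field.
  rw [fderiv_fderiv_apply_comm hc (1, 0) (0, w)]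
  have h2 : (fun z => fderiv ℝ (C.chartPar x₀ q₀) z (1, 0)) =ᶠ[𝓝 (s, y)]
      fun z => C.vChart x₀ (C.chartPar x₀ q₀ z) := by
    filter_upwards [eventually_par_mem hz hx] with z' hz'
    exact fderiv_chartPar_normal hz'.1 hz'.2
  rw [h2.fderiv_eq]
  have h3 := hV.hasFDerivAt.comp (s, y) (hc.differentiableAt (by simp)).hasFDerivAt
  exact congrArg (fun T : ℝ × Eu (m + 1) →L[ℝ] Eu (m + 2) => T (0, w)) h3.fderiv

lemma fderiv_chartPar_eq_zero_iff (hz : z ∈ C.parDom q₀)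
    (hx : C.par q₀ z ∈ (extChartAt (𝓡 (m + 2)) x₀).source) (w : ℝ × Eu (m + 1)) :
    fderiv ℝ (C.chartPar x₀ q₀) z w = 0 ↔ C.dpar q₀ z w = 0 := by
  constructor
  · intro h
    rw [dpar_eq hz hx, ContinuousLinearMap.comp_apply, h, map_zero]
  · intro h
    rw [(hasFDerivAt_chartPar hz hx).fderiv, ContinuousLinearMap.comp_apply, h, map_zero]

/-- Near each time, a variation of the flow vanishes either identically or nowhere. -/
lemma eventually_dpar_eq_zero_iff {s : ℝ} {y : Eu (m + 1)} (hz : (s, y) ∈ C.parDom q₀)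
    (w : Eu (m + 1)) :
    ∀ᶠ s' in 𝓝 s, C.dpar q₀ (s', y) (0, w) = 0 ↔ C.dpar q₀ (s, y) (0, w) = 0 := by
  set x₀ : M := C.par q₀ (s, y) with hx₀
  have hx : C.par q₀ (s, y) ∈ (extChartAt (𝓡 (m + 2)) x₀).source := mem_extChartAt_source x₀
  have hV : ContDiffAt ℝ ∞ (C.vChart x₀) (C.chartPar x₀ q₀ (s, y)) := C.contDiffAt_vChart x₀
  have hV2 := hV.of_le two_le_infty
  have hline : Tendsto (fun s' : ℝ => (s', y)) (𝓝 s) (𝓝 (s, y)) :=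
    (by fun_prop : Continuous fun s' : ℝ => (s', y)).tendsto s
  have hψ := (contDiffAt_chartPar hz hx).continuousAt
  have hA : ContinuousAt (fun s' : ℝ => ‖fderiv ℝ (C.vChart x₀) (C.chartPar x₀ q₀ (s', y))‖) s := by
    have h1 : ContinuousAt (fderiv ℝ (C.vChart x₀)) (C.chartPar x₀ q₀ (s, y)) :=
      (hV2.fderiv_right (m := 1) (by norm_num)).continuousAt
    exact ((h1.tendsto.comp (hψ.tendsto.comp hline))).norm
  have hev : ∀ᶠ s' in 𝓝 s, ((s', y) ∈ C.parDom q₀ ∧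
      C.par q₀ (s', y) ∈ (extChartAt (𝓡 (m + 2)) x₀).source) ∧
      DifferentiableAt ℝ (C.vChart x₀) (C.chartPar x₀ q₀ (s', y)) ∧
      ‖fderiv ℝ (C.vChart x₀) (C.chartPar x₀ q₀ (s', y))‖ <
        ‖fderiv ℝ (C.vChart x₀) (C.chartPar x₀ q₀ (s, y))‖ + 1 := by
    refine (hline.eventually (eventually_par_mem hz hx)).and (Eventually.and ?_ ?_)
    · have h2 := (hV2.eventually (by simp)).mono fun y' hy' => hy'.differentiableAt (by simp)
      exact (hψ.tendsto.comp hline).eventually h2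
    · exact hA.eventually_lt continuousAt_const (lt_add_one _)
  obtain ⟨δ, hδ, hball⟩ := Metric.eventually_nhds_iff.1 hev
  have hI : ∀ s' ∈ Ioo (s - δ) (s + δ), dist s' s < δ := fun s' hs' => by
    rw [Real.dist_eq, abs_lt]; constructor <;> linarith [hs'.1, hs'.2]
  have hmem : s ∈ Ioo (s - δ) (s + δ) := ⟨by linarith, by linarith⟩
  have key : ∀ s₁ ∈ Ioo (s - δ) (s + δ), ∀ s₂ ∈ Ioo (s - δ) (s + δ),
      C.dpar q₀ (s₁, y) (0, w) = 0 → C.dpar q₀ (s₂, y) (0, w) = 0 := by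
    intro s₁ h₁ s₂ h₂ h0
    have hb := fun s' hs' => hball (hI s' hs')
    rw [← fderiv_chartPar_eq_zero_iff (hb s₁ h₁).1.1 (hb s₁ h₁).1.2] at h0
    rw [← fderiv_chartPar_eq_zero_iff (hb s₂ h₂).1.1 (hb s₂ h₂).1.2]
    -- The variation and the zero function solve the same linear ODE, whose coefficient is bounded
    -- near the time `s`; agreeing at `s₁` they agree at `s₂`.
    refine ODE_solution_unique_of_mem_Ioo
      (v := fun s' j => fderiv ℝ (C.vChart x₀) (C.chartPar x₀ q₀ (s', y)) j)
      (f := fun s' => fderiv ℝ (C.chartPar x₀ q₀) (s', y) (0, w)) (g := fun _ => 0)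
      (s := fun _ => univ) (K := ⟨‖fderiv ℝ (C.vChart x₀) (C.chartPar x₀ q₀ (s, y))‖ + 1,
        by positivity⟩) (fun s' hs' => ?_) h₁ (fun s' hs' => ⟨?_, mem_univ _⟩)
      (fun s' _ => ⟨?_, mem_univ _⟩) h0 h₂
    · refine LipschitzWith.lipschitzOnWith ?_
      exact (fderiv ℝ (C.vChart x₀) (C.chartPar x₀ q₀ (s', y))).lipschitz.weaken (hb s' hs').2.2.le
    · exact hasDerivAt_fderiv_chartPar (hb s' hs').1.1 (hb s' hs').1.2 (hb s' hs').2.1 w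
    · simpa using hasDerivAt_const s' (0 : Eu (m + 2))
  filter_upwards [Ioo_mem_nhds hmem.1 hmem.2] with s' hs'
  exact ⟨key s' hs' s hmem, key s hmem s' hs'⟩

/-- The parametrization `par` is an immersion at the times `0 ≤ s < υmax`. -/
lemma dpar_injective {s : ℝ} (hs : s ∈ Ico 0 C.υmax) {y : Eu (m + 1)}
    (hy : y ∈ (extChartAt (𝓡 (m + 1)) q₀).target) (w : ℝ × Eu (m + 1))
    (hw : C.dpar q₀ (s, y) w = 0) : w = 0 := by
  have hz : (s, y) ∈ C.parDom q₀ := C.mem_parDom hs hy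
  let T : Eu (m + 2) →L[ℝ] ℝ := mfderiv (𝓡 (m + 2)) 𝓘(ℝ, ℝ) C.Φ (C.par q₀ (s, y))
  have hT : HasFDerivAt (fun z => C.Φ (C.par q₀ z)) (T.comp (C.dpar q₀ (s, y))) (s, y) :=
    (((C.contMDiff_Φ.mdifferentiable (by simp) _).hasMFDerivAt).comp (s, y)
      (C.hasMFDerivAt_par hz)).hasFDerivAt
  -- The differential of `Φ` is one on `v` and zero on the directions of the slice, where `Φ` is
  -- constant; this isolates the component `w.1`.
  have hn : T (C.dpar q₀ (s, y) (1, 0)) = 1 := by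
    rw [C.dpar_normal hz]
    exact C.rigging _
  have ht : ∀ w', T (C.dpar q₀ (s, y) (0, w')) = 0 := by
    intro w'
    have h1 := hT.comp y (hasFDerivAt_prodMk_right s y)
    have h2 : HasFDerivAt ((fun z => C.Φ (C.par q₀ z)) ∘ fun y => (s, y))
        (0 : Eu (m + 1) →L[ℝ] ℝ) y :=
      (hasFDerivAt_const s y).congr_of_eventuallyEq (Eventually.of_forall fun y' => C.Φ_flow hs _)
    exact congrArg (fun R : Eu (m + 1) →L[ℝ] ℝ => R w') (h1.unique h2)
  have hsplit : w = w.1 • ((1, 0) : ℝ × Eu (m + 1)) + (0, w.2) := by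
    ext <;> simp
  have hw1 : w.1 = 0 := by
    have h3 := congrArg T hw
    rw [hsplit, map_add, map_smul, map_add, map_smul, hn, ht, map_zero] at h3
    simpa using h3
  have hw0 : C.dpar q₀ (s, y) (0, w.2) = 0 := by
    rw [← hw]; congr 1; ext <;> simp [hw1]
  suffices h : w.2 = 0 from Prod.ext hw1 h
  have h0 : C.dpar q₀ (0, y) (0, w.2) = 0 := by
    classical
    -- Vanishing of the variation is a locally constant property of the time, so on the connected
    -- interval it propagates back to time `0`, where the inclusion of `N` is an immersion.
    have h1 := isPreconnected_Ico.constant (s := Ico 0 C.υmax)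
      (f := fun s' => decide (C.dpar q₀ (s', y) (0, w.2) = 0)) (fun s' hs' => ?_) hs
      ⟨le_rfl, C.υmax_pos⟩
    · exact of_decide_eq_true (h1 ▸ decide_eq_true hw0)
    · refine ContinuousAt.continuousWithinAt ?_
      refine (continuousAt_const (y := decide (C.dpar q₀ (s', y) (0, w.2) = 0))).congr ?_
      filter_upwards [eventually_dpar_eq_zero_iff (C.mem_parDom hs' hy) w.2] with s'' h
      simp only [h]
  have hz0 : (0, y) ∈ C.parDom q₀ := C.mem_parDom ⟨le_rfl, C.υmax_pos⟩ hy
  have h4 := congrArg (fun R : Eu (m + 1) →L[ℝ] Eu (m + 2) => R w.2) (C.mfderiv_flow_comp hz0)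
  have h5 : dSymm q₀ y w.2 = 0 := by
    refine C.incl_immersion _ (h4.trans (h0.trans ?_))
    exact (map_zero (mfderiv (𝓡 (m + 1)) (𝓡 (m + 2)) (C.flow 0) _ : Eu (m + 1) →L[ℝ] Eu (m + 2))).symm
  have h6 := congrArg (fun R : Eu (m + 1) →L[ℝ] Eu (m + 1) => R w.2) (dChart_comp_dSymm hy)
  simpa [h5] using h6.symm

end RiggedBoundary

end

end HolRen

namespace HolRen

noncomputable section

/-! ### Forms in flow coordinates -/

lemma comp_comp_inverse {E F : Type*} [NormedAddCommGroup E] [NormedSpace ℝ E]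
    [NormedAddCommGroup F] [NormedSpace ℝ F] {k : ℕ} (α : F [⋀^Fin k]→L[ℝ] ℝ) {T : E →L[ℝ] F}
    (hT : T.IsInvertible) :
    (α.compContinuousLinearMap T).compContinuousLinearMap T.inverse = α := by
  ext w
  simp [ContinuousAlternatingMap.compContinuousLinearMap_apply, Function.comp_def,
    hT.self_apply_inverse]

lemma inverse_comp_comp {E F : Type*} [NormedAddCommGroup E] [NormedSpace ℝ E]
    [NormedAddCommGroup F] [NormedSpace ℝ F] {k : ℕ} (α : E [⋀^Fin k]→L[ℝ] ℝ) {T : E →L[ℝ] F}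
    (hT : T.IsInvertible) :
    (α.compContinuousLinearMap T.inverse).compContinuousLinearMap T = α := by
  ext w
  simp [ContinuousAlternatingMap.compContinuousLinearMap_apply, Function.comp_def,
    hT.inverse_apply_self]

lemma isInvertible_of_injective {E F : Type*} [NormedAddCommGroup E] [NormedSpace ℝ E]
    [NormedAddCommGroup F] [NormedSpace ℝ F] [FiniteDimensional ℝ E] [FiniteDimensional ℝ F]
    (hd : Module.finrank ℝ E = Module.finrank ℝ F) (T : E →L[ℝ] F) (hT : ∀ w, T w = 0 → w = 0) :
    T.IsInvertible := by
  let e := LinearMap.linearEquivOfInjective (T : E →ₗ[ℝ] F)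
    ((injective_iff_map_eq_zero _).2 hT) hd
  exact ⟨e.toContinuousLinearEquiv, by ext w; rfl⟩

lemma finrank_prod_eu (m : ℕ) :
    Module.finrank ℝ (ℝ × Eu (m + 1)) = Module.finrank ℝ (Eu (m + 2)) := by
  simp; omega

lemma hasLimitAt_zero {n k : ℕ} {X : Type*} [TopologicalSpace X] [ChartedSpace (Eu n) X]
    {D : Set X} {η : SpForm n k X} (h : ∀ x ∈ D, η x = 0) (x₀ : X) : HasLimitAt D η x₀ 0 := by
  have h0 : (@pullAt n n k (Eu n) X _ (chartedSpaceSelf (Eu n)) _ _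
      (extChartAt (𝓡 n) x₀).symm (extChartAt (𝓡 n) x₀ x₀) 0) = 0 := rfl
  rw [HasLimitAt, h0]
  refine tendsto_const_nhds.congr' ?_
  filter_upwards [self_mem_nhdsWithin, mem_nhdsWithin_of_mem_nhds
    (extChartAt_source_mem_nhds (I := 𝓡 n) x₀)] with x e1 e2
  rw [inChart_eq, (extChartAt (𝓡 n) x₀).left_inv e2, h x e1]
  rfl

namespace RiggedBoundary

variable {m k : ℕ} {M N : Type*}
  [TopologicalSpace M] [ChartedSpace (Eu (m + 2)) M] [IsManifold (𝓡 (m + 2)) ∞ M]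
  [TopologicalSpace N] [ChartedSpace (Eu (m + 1)) N] (C : RiggedBoundary m M N)

/-- The pullback of a form on `M` along `par`. -/
def hat (q₀ : N) (η : SpForm (m + 2) k M) (z : ℝ × Eu (m + 1)) :
    (ℝ × Eu (m + 1)) [⋀^Fin k]→L[ℝ] ℝ :=
  (η (C.par q₀ z)).compContinuousLinearMap (C.dpar q₀ z)

lemma hat_add (q₀ : N) (η η' : SpForm (m + 2) k M) (z : ℝ × Eu (m + 1)) :
    C.hat q₀ (η + η') z = C.hat q₀ η z + C.hat q₀ η' z := rfl

lemma hat_sub (q₀ : N) (η η' : SpForm (m + 2) k M) (z : ℝ × Eu (m + 1)) :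
    C.hat q₀ (η - η') z = C.hat q₀ η z - C.hat q₀ η' z := rfl

/-- The part of the domain of `par` that is mapped into the region. -/
def slab (q₀ : N) : Set (ℝ × Eu (m + 1)) := Ioo 0 C.υmax ×ˢ (extChartAt (𝓡 (m + 1)) q₀).target

lemma isOpen_slab (q₀ : N) : IsOpen (C.slab q₀) := isOpen_Ioo.prod (isOpen_extChartAt_target q₀)

variable {C} {x₀ : M} {q₀ : N} {z : ℝ × Eu (m + 1)}

lemma slab_subset (hz : z ∈ C.slab q₀) : z ∈ C.parDom q₀ :=
  C.mem_parDom (Ioo_subset_Ico_self hz.1) hz.2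

lemma par_mem_region (hz : z ∈ C.slab q₀) : C.par q₀ z ∈ C.region :=
  ⟨(z.1, (extChartAt (𝓡 (m + 1)) q₀).symm z.2), ⟨hz.1, mem_univ _⟩, rfl⟩

lemma exists_par_eq {x : M} (hx : x ∈ C.region) :
    ∃ (q : N) (s : ℝ), s ∈ Ioo 0 C.υmax ∧ x = C.par q (s, extChartAt (𝓡 (m + 1)) q q) := by
  obtain ⟨⟨s, q⟩, ⟨hs, -⟩, rfl⟩ := hx
  refine ⟨q, s, hs, ?_⟩
  simp only [par, extChartAt_to_inv]

/-- In contrast to `Φ_flow` this includes negative times close to zero, which is needed to see that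
points of the region near `N` have a positive flow coordinate. -/
lemma eventually_Φ_par {y : Eu (m + 1)} (hy : y ∈ (extChartAt (𝓡 (m + 1)) q₀).target) :
    ∀ᶠ z in 𝓝 ((0 : ℝ), y), C.Φ (C.par q₀ z) = z.1 := by
  have h0 := (C.isOpen_parDom q₀).mem_nhds (C.mem_parDom (⟨le_rfl, C.υmax_pos⟩) hy)
  obtain ⟨δ, hδ, hb⟩ := Metric.mem_nhds_iff.1 h0
  filter_upwards [Metric.ball_mem_nhds _ hδ] with z hz
  have hI : ∀ s ∈ Ioo (-δ) δ, (s, (extChartAt (𝓡 (m + 1)) q₀).symm z.2) ∈ C.dom := by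
    intro s hs
    refine (hb (show (s, z.2) ∈ Metric.ball ((0 : ℝ), y) δ from ?_)).2
    rw [Metric.mem_ball, Prod.dist_eq, max_lt_iff] at hz ⊢
    refine ⟨?_, hz.2⟩
    rw [Real.dist_eq, sub_zero, abs_lt]
    exact hs
  have hd : ∀ x ∈ Ioo (-δ) δ, HasDerivAt
      (fun s => C.Φ (C.flow s ((extChartAt (𝓡 (m + 1)) q₀).symm z.2)) - s) 0 x := fun x hx => by
    simpa using (C.hasDerivAt_Φ_flow (hI x hx)).fun_sub (hasDerivAt_id' x)
  have hz1 : z.1 ∈ Ioo (-δ) δ := by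
    rw [Metric.mem_ball, Prod.dist_eq, max_lt_iff, Real.dist_eq, sub_zero, abs_lt] at hz
    exact hz.1
  have := isOpen_Ioo.is_const_of_deriv_eq_zero isPreconnected_Ioo
    (fun x hx => (hd x hx).differentiableAt.differentiableWithinAt)
    (fun x hx => (hd x hx).deriv) hz1 (show (0 : ℝ) ∈ Ioo (-δ) δ from ⟨by linarith, hδ⟩)
  simp only [C.Φ_incl, sub_zero] at this
  simp only [par]
  linarith

variable [IsManifold (𝓡 (m + 1)) ∞ N]

lemma hat_eq (hz : z ∈ C.parDom q₀) (hx : C.par q₀ z ∈ (extChartAt (𝓡 (m + 2)) x₀).source)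
    (η : SpForm (m + 2) k M) :
    C.hat q₀ η z = (inChart x₀ η (C.chartPar x₀ q₀ z)).compContinuousLinearMap
      (fderiv ℝ (C.chartPar x₀ q₀) z) := by
  rw [hat, dpar_eq hz hx, inChart_eq, chartPar, (extChartAt (𝓡 (m + 2)) x₀).left_inv hx]
  rfl

lemma isInvertible_fderiv_chartPar {s : ℝ} (hs : s ∈ Ico 0 C.υmax) {y : Eu (m + 1)}
    (hy : y ∈ (extChartAt (𝓡 (m + 1)) q₀).target)
    (hx : C.par q₀ (s, y) ∈ (extChartAt (𝓡 (m + 2)) x₀).source) :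
    (fderiv ℝ (C.chartPar x₀ q₀) (s, y)).IsInvertible :=
  isInvertible_of_injective (finrank_prod_eu m) _ fun w hw => dpar_injective hs hy w
    ((fderiv_chartPar_eq_zero_iff (C.mem_parDom hs hy) hx w).1 hw)

lemma isInvertible_dpar {s : ℝ} (hs : s ∈ Ico 0 C.υmax) {y : Eu (m + 1)}
    (hy : y ∈ (extChartAt (𝓡 (m + 1)) q₀).target) : (C.dpar q₀ (s, y)).IsInvertible :=
  isInvertible_of_injective (finrank_prod_eu m) _ fun w hw => dpar_injective hs hy w hw

lemma eq_zero_of_hat_eq_zero {s : ℝ} (hs : s ∈ Ico 0 C.υmax) {y : Eu (m + 1)}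
    (hy : y ∈ (extChartAt (𝓡 (m + 1)) q₀).target) {η : SpForm (m + 2) k M}
    (h : C.hat q₀ η (s, y) = 0) : η (C.par q₀ (s, y)) = 0 := by
  rw [← comp_comp_inverse (η (C.par q₀ (s, y))) (isInvertible_dpar hs hy)]
  rw [hat] at h
  rw [h]
  rfl

/-- The parametrization `par` has a smooth local inverse. -/
lemma exists_localInverse {s : ℝ} (hs : s ∈ Ico 0 C.υmax) {y : Eu (m + 1)}
    (hy : y ∈ (extChartAt (𝓡 (m + 1)) q₀).target)
    (hx : C.par q₀ (s, y) ∈ (extChartAt (𝓡 (m + 2)) x₀).source) :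
    ∃ σ : Eu (m + 2) → ℝ × Eu (m + 1), ContDiffAt ℝ ∞ σ (C.chartPar x₀ q₀ (s, y)) ∧
      σ (C.chartPar x₀ q₀ (s, y)) = (s, y) ∧
      ∀ᶠ y' in 𝓝 (C.chartPar x₀ q₀ (s, y)), C.chartPar x₀ q₀ (σ y') = y' := by
  have hz := C.mem_parDom hs hy
  have hc := contDiffAt_chartPar hz hx
  obtain ⟨e, he⟩ := isInvertible_fderiv_chartPar hs hy hx
  have hd : HasFDerivAt (C.chartPar x₀ q₀) (e : ℝ × Eu (m + 1) →L[ℝ] Eu (m + 2)) (s, y) := by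
    rw [he]; exact (hc.differentiableAt (by simp)).hasFDerivAt
  refine ⟨hc.localInverse hd (by simp), hc.to_localInverse hd (by simp),
    hc.localInverse_apply_image hd (by simp), ?_⟩
  exact (hc.toOpenPartialHomeomorph _ hd (by simp)).eventually_right_inverse
    (hc.image_mem_toOpenPartialHomeomorph_target hd (by simp))

/-- Points near a point of a flow line have continuous flow coordinates. -/
lemma exists_coordinates {s : ℝ} (hs : s ∈ Ico 0 C.υmax) {y : Eu (m + 1)}
    (hy : y ∈ (extChartAt (𝓡 (m + 1)) q₀).target) :
    ∃ ρ : M → ℝ × Eu (m + 1), Tendsto ρ (𝓝 (C.par q₀ (s, y))) (𝓝 (s, y)) ∧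
      ∀ᶠ x in 𝓝 (C.par q₀ (s, y)), C.par q₀ (ρ x) = x := by
  set x₀ := C.par q₀ (s, y) with hx₀
  have hx : C.par q₀ (s, y) ∈ (extChartAt (𝓡 (m + 2)) x₀).source := mem_extChartAt_source x₀
  obtain ⟨σ, h1, h2, h3⟩ := exists_localInverse hs hy hx
  have hχ : Tendsto (extChartAt (𝓡 (m + 2)) x₀) (𝓝 x₀) (𝓝 (C.chartPar x₀ q₀ (s, y))) :=
    continuousAt_extChartAt x₀
  have hσ : Tendsto (fun x => σ (extChartAt (𝓡 (m + 2)) x₀ x)) (𝓝 x₀) (𝓝 (s, y)) := by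
    have := h1.continuousAt.tendsto.comp hχ
    rwa [h2] at this
  refine ⟨fun x => σ (extChartAt (𝓡 (m + 2)) x₀ x), hσ, ?_⟩
  filter_upwards [hχ.eventually h3, hσ.eventually (eventually_par_mem (C.mem_parDom hs hy) hx),
    (isOpen_extChartAt_source x₀).mem_nhds hx] with x e1 e2 e3
  exact (extChartAt (𝓡 (m + 2)) x₀).injOn e2.2 e3 e1

lemma isOpen_region : IsOpen C.region := by
  rw [isOpen_iff_mem_nhds]
  intro x hx
  obtain ⟨q, s, hs, rfl⟩ := exists_par_eq hx
  obtain ⟨ρ, h1, h2⟩ := exists_coordinates (q₀ := q) (Ioo_subset_Ico_self hs)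
    (mem_extChartAt_target q)
  filter_upwards [h2, h1.eventually ((C.isOpen_slab q).mem_nhds ⟨hs, mem_extChartAt_target q⟩)]
    with x e1 e2
  rw [← e1]
  exact par_mem_region e2

lemma tang_comp_dpar (hz : z ∈ C.parDom q₀) (α : (Eu (m + 2)) [⋀^Fin k]→L[ℝ] ℝ) :
    (pullAt (C.flow z.1) ((extChartAt (𝓡 (m + 1)) q₀).symm z.2) α).compContinuousLinearMap
      (dSymm q₀ z.2) = tang k _ (α.compContinuousLinearMap (C.dpar q₀ z)) := by
  ext w
  have h := fun i => congrArg (fun T : Eu (m + 1) →L[ℝ] Eu (m + 2) => T (w i))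
    (C.mfderiv_flow_comp hz)
  rw [tang_apply_apply]
  simp only [pullAt, ContinuousAlternatingMap.compContinuousLinearMap_apply]
  exact congrArg α (funext h)

lemma norml_comp_dpar (hz : z ∈ C.parDom q₀) (α : (Eu (m + 2)) [⋀^Fin (k + 1)]→L[ℝ] ℝ) :
    (pullAt (C.flow z.1) ((extChartAt (𝓡 (m + 1)) q₀).symm z.2)
      (α.curryLeft (C.v (C.par q₀ z) : Eu (m + 2)))).compContinuousLinearMap
      (dSymm q₀ z.2) = norml k _ (α.compContinuousLinearMap (C.dpar q₀ z)) := by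
  rw [tang_comp_dpar hz, norml_apply]
  congr 1
  ext w
  simp only [ContinuousAlternatingMap.compContinuousLinearMap_apply,
    ContinuousAlternatingMap.curryLeft_apply_apply]
  refine congrArg α (funext fun i => ?_)
  refine Fin.cases ?_ (fun i => ?_) i
  · simp [C.dpar_normal hz]
    rfl
  · simp
    rfl

/-- With the next lemma, the dictionary that turns statements about `π_s^* η` and `π_s^* i_v η` into
statements about forms on a product with a line. -/
lemma inChart_pull (hz : z ∈ C.parDom q₀) (η : SpForm (m + 2) k M) :
    inChart q₀ (C.pull z.1 η) z.2 = tang k _ (C.hat q₀ η z) :=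
  tang_comp_dpar hz _

lemma inChart_pull_iv (hz : z ∈ C.parDom q₀) (η : SpForm (m + 2) (k + 1) M) :
    inChart q₀ (C.pull z.1 (C.iv η)) z.2 = norml k _ (C.hat q₀ η z) :=
  norml_comp_dpar hz _

/-- A form on `M` has a limit at a point of `N` if it has one in flow coordinates. -/
lemma exists_hasLimitAt (q : N) {η : SpForm (m + 2) k M}
    {β : (ℝ × Eu (m + 1)) [⋀^Fin k]→L[ℝ] ℝ}
    (h : Tendsto (C.hat q η) (𝓝[>] 0 ×ˢ 𝓝 (extChartAt (𝓡 (m + 1)) q q)) (𝓝 β)) :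
    ∃ α, HasLimitAt C.region η (C.flow 0 q) α ∧
      α.compContinuousLinearMap (C.dpar q (0, extChartAt (𝓡 (m + 1)) q q)) = β := by
  set y₀ := extChartAt (𝓡 (m + 1)) q q with hy₀
  have hy : y₀ ∈ (extChartAt (𝓡 (m + 1)) q).target := mem_extChartAt_target q
  have hs : (0 : ℝ) ∈ Ico 0 C.υmax := ⟨le_rfl, C.υmax_pos⟩
  have hz := C.mem_parDom hs hy
  have hpar : C.par q (0, y₀) = C.flow 0 q := by simp only [par, hy₀, extChartAt_to_inv]
  set x₀ : M := C.flow 0 q with hx₀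
  have hx : C.par q (0, y₀) ∈ (extChartAt (𝓡 (m + 2)) x₀).source := by
    rw [hpar]; exact mem_extChartAt_source x₀
  have hinv := isInvertible_fderiv_chartPar hs hy hx
  refine ⟨β.compContinuousLinearMap ((C.dpar q (0, y₀)).inverse), ?_,
    inverse_comp_comp _ (isInvertible_dpar hs hy)⟩
  obtain ⟨ρ, h1, h2⟩ := exists_coordinates hs hy
  rw [hpar] at h1 h2
  have h1' : Tendsto ρ (𝓝[C.region] x₀) (𝓝 (0, y₀)) := h1.mono_left nhdsWithin_le_nhds
  -- In the region `Φ` is positive, and near `N` it is the first flow coordinate, so the times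
  -- approach zero from above.
  have hρ : Tendsto ρ (𝓝[C.region] x₀) (𝓝[>] 0 ×ˢ 𝓝 y₀) := by
    have h3 : Tendsto (fun x => (ρ x).1) (𝓝[C.region] x₀) (𝓝[>] 0) := by
      refine tendsto_nhdsWithin_iff.2 ⟨(continuous_fst.tendsto _).comp h1', ?_⟩
      filter_upwards [h2.filter_mono nhdsWithin_le_nhds, h1'.eventually (eventually_Φ_par (C := C) hy),
        self_mem_nhdsWithin] with x e1 e2 e3
      rw [e1] at e2
      obtain ⟨⟨s, q'⟩, ⟨hs', -⟩, rfl⟩ := e3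
      dsimp only at e2
      rw [C.Φ_flow (Ioo_subset_Ico_self hs')] at e2
      rw [← e2]
      exact hs'.1
    exact h3.prodMk ((continuous_snd.tendsto _).comp h1')
  -- The components in the chart at `x₀` are those in flow coordinates composed with the inverse
  -- Jacobian, which is continuous at `s = 0` because the Jacobian is invertible there.
  have hT : Tendsto (fun x => (C.hat q η (ρ x)).compContinuousLinearMap
      (fderiv ℝ (C.chartPar x₀ q) (ρ x)).inverse) (𝓝[C.region] x₀)
      (𝓝 (β.compContinuousLinearMap (fderiv ℝ (C.chartPar x₀ q) (0, y₀)).inverse)) := by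
    have h4 : Tendsto (fun x => (fderiv ℝ (C.chartPar x₀ q) (ρ x)).inverse) (𝓝[C.region] x₀)
        (𝓝 (fderiv ℝ (C.chartPar x₀ q) (0, y₀)).inverse) := by
      have h5 : ContinuousAt (fderiv ℝ (C.chartPar x₀ q)) (0, y₀) :=
        (((contDiffAt_chartPar hz hx).of_le two_le_infty).fderiv_right
          (m := 1) (by norm_num)).continuousAt
      have h6 : ContinuousAt ContinuousLinearMap.inverse (fderiv ℝ (C.chartPar x₀ q) (0, y₀)) :=
        (hinv.contDiffAt_map_inverse (n := 1)).continuousAt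
      exact h6.tendsto.comp (h5.tendsto.comp h1')
    exact ((contDiff_compContinuousLinearMap (n := 1)).continuous.tendsto _).comp
      ((h.comp hρ).prodMk_nhds h4)
  -- The chart expression of the candidate limit is the limit found above.
  have hfin : (@pullAt (m + 2) (m + 2) k (Eu (m + 2)) M _ (chartedSpaceSelf (Eu (m + 2))) _ _
      (extChartAt (𝓡 (m + 2)) x₀).symm (extChartAt (𝓡 (m + 2)) x₀ x₀)
      (β.compContinuousLinearMap ((C.dpar q (0, y₀)).inverse))) =
      β.compContinuousLinearMap (fderiv ℝ (C.chartPar x₀ q) (0, y₀)).inverse := by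
    have h7 : C.chartPar x₀ q (0, y₀) = extChartAt (𝓡 (m + 2)) x₀ x₀ := by rw [chartPar, hpar]
    have h8 : (β.compContinuousLinearMap ((C.dpar q (0, y₀)).inverse)).compContinuousLinearMap
        (dSymm x₀ (extChartAt (𝓡 (m + 2)) x₀ x₀)) =
        ((((β.compContinuousLinearMap ((C.dpar q (0, y₀)).inverse)).compContinuousLinearMap
          (dSymm x₀ (C.chartPar x₀ q (0, y₀)))).compContinuousLinearMap
          (fderiv ℝ (C.chartPar x₀ q) (0, y₀))).compContinuousLinearMap
            (fderiv ℝ (C.chartPar x₀ q) (0, y₀)).inverse) := by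
      rw [comp_comp_inverse _ hinv, h7]
    refine h8.trans (congrArg (fun γ => ContinuousAlternatingMap.compContinuousLinearMap γ _) ?_)
    have h9 : ((β.compContinuousLinearMap ((C.dpar q (0, y₀)).inverse)).compContinuousLinearMap
          (dSymm x₀ (C.chartPar x₀ q (0, y₀)))).compContinuousLinearMap
          (fderiv ℝ (C.chartPar x₀ q) (0, y₀)) =
        (β.compContinuousLinearMap ((C.dpar q (0, y₀)).inverse)).compContinuousLinearMap
          (C.dpar q (0, y₀)) := by
      rw [dpar_eq hz hx]; rfl
    rw [h9, inverse_comp_comp _ (isInvertible_dpar hs hy)]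
  rw [HasLimitAt, hfin]
  refine hT.congr' ?_
  have h10 : ∀ᶠ z in 𝓝 ((0 : ℝ), y₀), (fderiv ℝ (C.chartPar x₀ q) z).IsInvertible := by
    obtain ⟨e, he⟩ := hinv
    have h5 : ContinuousAt (fderiv ℝ (C.chartPar x₀ q)) (0, y₀) :=
      (((contDiffAt_chartPar hz hx).of_le two_le_infty).fderiv_right
        (m := 1) (by norm_num)).continuousAt
    have := h5.eventually (he ▸ ContinuousLinearEquiv.nhds e)
    filter_upwards [this] with z hz
    obtain ⟨e', he'⟩ := hz
    exact ⟨e', he'⟩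
  filter_upwards [h2.filter_mono nhdsWithin_le_nhds, h1'.eventually (eventually_par_mem hz hx),
    h1'.eventually h10] with x e1 e2 e3
  rw [hat_eq e2.1 e2.2, comp_comp_inverse _ e3, chartPar, e1]

end RiggedBoundary

end

end HolRen

namespace HolRen

noncomputable section

namespace RiggedBoundary

variable {m k r : ℕ} {M N : Type*}
  [TopologicalSpace M] [ChartedSpace (Eu (m + 2)) M] [IsManifold (𝓡 (m + 2)) ∞ M]
  [TopologicalSpace N] [ChartedSpace (Eu (m + 1)) N] [IsManifold (𝓡 (m + 1)) ∞ N]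
  {C : RiggedBoundary m M N} {q₀ : N} {z : ℝ × Eu (m + 1)}

/-! ### Smooth families in flow coordinates -/

lemma contDiffAt_hat {A : Eu r → SpForm (m + 2) k M} (hA : SmoothFamilyOn C.region A)
    (u : Eu r) (hz : z ∈ C.slab q₀) :
    ContDiffAt ℝ ∞ (fun p : Eu r × (ℝ × Eu (m + 1)) => C.hat q₀ (A p.1) p.2) (u, z) := by
  set x₀ := C.par q₀ z with hx₀
  have hx : C.par q₀ z ∈ (extChartAt (𝓡 (m + 2)) x₀).source := mem_extChartAt_source x₀
  have hd := slab_subset hz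
  have hc := contDiffAt_chartPar hd hx
  have h1 : ContDiffAt ℝ ∞ (fun p : Eu r × Eu (m + 2) => inChart x₀ (A p.1) p.2)
      (u, C.chartPar x₀ q₀ z) := by
    refine (hA x₀).contDiffAt ?_
    have h2 : (extChartAt (𝓡 (m + 2)) x₀).target ∩ (extChartAt (𝓡 (m + 2)) x₀).symm ⁻¹' C.region ∈
        𝓝 (C.chartPar x₀ q₀ z) := by
      refine ((continuousOn_extChartAt_symm x₀).isOpen_inter_preimage (isOpen_extChartAt_target x₀)
        isOpen_region).mem_nhds ⟨(extChartAt (𝓡 (m + 2)) x₀).map_source hx, ?_⟩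
      rw [mem_preimage, chartPar, (extChartAt (𝓡 (m + 2)) x₀).left_inv hx]
      exact par_mem_region hz
    exact prod_mem_nhds univ_mem h2
  have h3 : ContDiffAt ℝ ∞ (fun p : Eu r × (ℝ × Eu (m + 1)) =>
      (inChart x₀ (A p.1) (C.chartPar x₀ q₀ p.2)).compContinuousLinearMap
        (fderiv ℝ (C.chartPar x₀ q₀) p.2)) (u, z) := by
    have h4 : ContDiffAt ℝ ∞ (fun p : Eu r × (ℝ × Eu (m + 1)) => (p.1, C.chartPar x₀ q₀ p.2))
        (u, z) := contDiffAt_fst.prodMk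
      (ContDiffAt.comp (u, z) (g := C.chartPar x₀ q₀) (f := Prod.snd) hc contDiffAt_snd)
    have h5 : ContDiffAt ℝ ∞ (fun p : Eu r × (ℝ × Eu (m + 1)) =>
        fderiv ℝ (C.chartPar x₀ q₀) p.2) (u, z) :=
      ContDiffAt.comp (u, z) (g := fderiv ℝ (C.chartPar x₀ q₀)) (f := Prod.snd)
        (hc.fderiv_right (m := ∞) (by simp)) contDiffAt_snd
    exact contDiff_compContinuousLinearMap.contDiffAt.comp (u, z)
      ((h1.comp (u, z) h4).prodMk h5)
  refine h3.congr_of_eventuallyEq ?_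
  filter_upwards [(continuousAt_snd (p := (u, z))).eventually (eventually_par_mem hd hx)]
    with p hp
  exact hat_eq hp.1 hp.2 _

/-- The smooth local inverse of `par` and the inverse of its differential recover the chart
components from `hat`. Centres of charts of `N` suffice, because every point of the region lies on
the flow line of such a centre. -/
lemma smoothFamilyOn_of_hat {A : Eu r → SpForm (m + 2) k M}
    (h : ∀ (u : Eu r) (q : N), ∀ s ∈ Ioo 0 C.υmax,
      ContDiffAt ℝ ∞ (fun p : Eu r × (ℝ × Eu (m + 1)) => C.hat q (A p.1) p.2)
        (u, (s, extChartAt (𝓡 (m + 1)) q q))) : SmoothFamilyOn C.region A := by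
  rintro x₀ ⟨u, y⟩ ⟨-, hy, hyD⟩
  refine ContDiffAt.contDiffWithinAt ?_
  obtain ⟨q, s, hs, hq⟩ := exists_par_eq hyD
  dsimp only at hy hyD hq
  set y₀ := extChartAt (𝓡 (m + 1)) q q with hy₀
  have hy₀t : y₀ ∈ (extChartAt (𝓡 (m + 1)) q).target := mem_extChartAt_target q
  have hs' := Ioo_subset_Ico_self hs
  have hd := C.mem_parDom hs' hy₀t
  have hx : C.par q (s, y₀) ∈ (extChartAt (𝓡 (m + 2)) x₀).source := by
    rw [← hq]; exact (extChartAt (𝓡 (m + 2)) x₀).map_target hy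
  have hψ : C.chartPar x₀ q (s, y₀) = y := by
    rw [chartPar, ← hq, (extChartAt (𝓡 (m + 2)) x₀).right_inv hy]
  obtain ⟨σ, h1, h2, h3⟩ := exists_localInverse hs' hy₀t hx
  rw [hψ] at h1 h2 h3
  have hc := contDiffAt_chartPar hd hx
  have hσ : ContDiffAt ℝ ∞ (fun p : Eu r × Eu (m + 2) => σ p.2) (u, y) :=
    h1.comp (u, y) contDiffAt_snd
  have h4 : ContDiffAt ℝ ∞ (fun p : Eu r × Eu (m + 2) => C.hat q (A p.1) (σ p.2)) (u, y) := by
    have h5 := h u q s hs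
    rw [← h2] at h5
    exact ContDiffAt.comp (u, y) (g := fun p : Eu r × (ℝ × Eu (m + 1)) => C.hat q (A p.1) p.2)
      (f := fun p : Eu r × Eu (m + 2) => (p.1, σ p.2)) h5 (contDiffAt_fst.prodMk hσ)
  have hinv := isInvertible_fderiv_chartPar hs' hy₀t hx
  have h6 : ContDiffAt ℝ ∞ (fun p : Eu r × Eu (m + 2) =>
      (fderiv ℝ (C.chartPar x₀ q) (σ p.2)).inverse) (u, y) := by
    have h7 : ContDiffAt ℝ ∞ (fderiv ℝ (C.chartPar x₀ q)) (σ y) := by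
      rw [h2]; exact hc.fderiv_right (m := ∞) (by simp)
    have h8 : ContDiffAt ℝ ∞ ContinuousLinearMap.inverse (fderiv ℝ (C.chartPar x₀ q) (σ y)) := by
      rw [h2]; exact hinv.contDiffAt_map_inverse
    exact h8.comp (u, y) (ContDiffAt.comp (u, y) (g := fderiv ℝ (C.chartPar x₀ q))
      (f := fun p : Eu r × Eu (m + 2) => σ p.2) h7 hσ)
  refine (contDiff_compContinuousLinearMap.contDiffAt.comp (u, y) (h4.prodMk h6)).congr_of_eventuallyEq ?_
  have hσt : Tendsto (fun p : Eu r × Eu (m + 2) => σ p.2) (𝓝 (u, y)) (𝓝 (s, y₀)) := by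
    have := hσ.continuousAt.tendsto
    simpa only [h2] using this
  filter_upwards [hσt.eventually (eventually_par_mem hd hx),
    hσt.eventually (((isOpen_slab C q).mem_nhds ⟨hs, hy₀t⟩)),
    (continuousAt_snd (p := (u, y))).eventually h3] with p e1 e2 e3
  have e4 := isInvertible_fderiv_chartPar (q₀ := q) (y := (σ p.2).2) (Ioo_subset_Ico_self e2.1) e2.2 e1.2
  simp only [Function.comp]
  rw [hat_eq e1.1 e1.2, comp_comp_inverse _ e4, e3]

/-- A single smooth form in flow coordinates. -/
lemma contDiffAt_hat_fixed {A : Eu r → SpForm (m + 2) k M} (hA : SmoothFamilyOn C.region A)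
    (u : Eu r) (hz : z ∈ C.slab q₀) : ContDiffAt ℝ ∞ (C.hat q₀ (A u)) z :=
  ContDiffAt.comp z (g := fun p : Eu r × (ℝ × Eu (m + 1)) => C.hat q₀ (A p.1) p.2)
    (f := fun z => (u, z)) (contDiffAt_hat hA u hz) (contDiffAt_const.prodMk contDiffAt_id)

/-- The exterior derivative in flow coordinates. -/
lemma hat_dExt {A : Eu r → SpForm (m + 2) k M} (hA : SmoothFamilyOn C.region A)
    (u : Eu r) (hz : z ∈ C.slab q₀) :
    C.hat q₀ (dExt (A u)) z = extDeriv (C.hat q₀ (A u)) z := by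
  set x₀ := C.par q₀ z with hx₀
  have hx : C.par q₀ z ∈ (extChartAt (𝓡 (m + 2)) x₀).source := mem_extChartAt_source x₀
  have hd := slab_subset hz
  have hc := contDiffAt_chartPar hd hx
  have h1 : DifferentiableAt ℝ (inChart x₀ (A u)) (C.chartPar x₀ q₀ z) := by
    have h2 : (extChartAt (𝓡 (m + 2)) x₀).target ∩ (extChartAt (𝓡 (m + 2)) x₀).symm ⁻¹' C.region ∈
        𝓝 (C.chartPar x₀ q₀ z) := by
      refine ((continuousOn_extChartAt_symm x₀).isOpen_inter_preimage (isOpen_extChartAt_target x₀)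
        isOpen_region).mem_nhds ⟨(extChartAt (𝓡 (m + 2)) x₀).map_source hx, ?_⟩
      rw [mem_preimage, chartPar, (extChartAt (𝓡 (m + 2)) x₀).left_inv hx]
      exact par_mem_region hz
    have h3 := (hA x₀).contDiffAt (x := (u, C.chartPar x₀ q₀ z)) (prod_mem_nhds univ_mem h2)
    exact DifferentiableAt.comp (C.chartPar x₀ q₀ z)
      (g := fun p : Eu r × Eu (m + 2) => inChart x₀ (A p.1) p.2) (f := fun y => (u, y))
      (h3.differentiableAt (by simp)) (by fun_prop)
  have h4 : C.hat q₀ (A u) =ᶠ[𝓝 z] fun z => (inChart x₀ (A u)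
      (C.chartPar x₀ q₀ z)).compContinuousLinearMap (fderiv ℝ (C.chartPar x₀ q₀) z) := by
    filter_upwards [eventually_par_mem hd hx] with z' hz'
    exact hat_eq hz'.1 hz'.2 _
  -- Naturality of the exterior derivative under the coordinate change. The chart is the one at the
  -- point itself, as in the definition of `dExt`.
  rw [h4.extDeriv_eq, extDeriv_pullback h1 (hc.of_le two_le_infty) (by simp),
    (hasFDerivAt_chartPar hd hx).fderiv]
  rfl

end RiggedBoundary

end

end HolRen

namespace HolRen

noncomputable section

namespace RiggedBoundary

variable {m k r : ℕ} {M N : Type*}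
  [TopologicalSpace M] [ChartedSpace (Eu (m + 2)) M] [IsManifold (𝓡 (m + 2)) ∞ M]
  [TopologicalSpace N] [ChartedSpace (Eu (m + 1)) N] [IsManifold (𝓡 (m + 1)) ∞ N]

/-! ### Horizontal forms -/

section Horizontal

variable {C : RiggedBoundary m M N} {q₀ : N} {z : ℝ × Eu (m + 1)}

lemma curryLeft_hat (hz : z ∈ C.parDom q₀) (η : SpForm (m + 2) (k + 1) M) :
    (C.hat q₀ η z).curryLeft (1, 0) = C.hat q₀ (interior C.v η) z := by
  ext w
  simp only [hat, interior, ContinuousAlternatingMap.compContinuousLinearMap_apply,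
    ContinuousAlternatingMap.curryLeft_apply_apply]
  refine congrArg (η (C.par q₀ z)) (funext fun i => ?_)
  refine Fin.cases ?_ (fun i => ?_) i
  · simp only [Function.comp, Matrix.cons_val_zero]
    rw [C.dpar_normal hz]
    rfl
  · simp
    rfl

lemma isHorizontal_hat {η : SpForm (m + 2) k M} (h : IsHorizontalOn C.v C.region η)
    (hz : z ∈ C.slab q₀) : IsHorizontal (C.hat q₀ η z) := by
  cases k with
  | zero => trivial
  | succ k =>
    change (C.hat q₀ η z).curryLeft (1, 0) = 0
    rw [curryLeft_hat (slab_subset hz), hat, h _ (par_mem_region hz)]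
    rfl

lemma isHorizontalOn_of_hat {η : SpForm (m + 2) k M}
    (h : ∀ q : N, ∀ s ∈ Ioo 0 C.υmax,
      IsHorizontal (C.hat q η (s, extChartAt (𝓡 (m + 1)) q q))) :
    IsHorizontalOn C.v C.region η := by
  cases k with
  | zero => trivial
  | succ k =>
    intro x hx
    obtain ⟨q, s, hs, rfl⟩ := exists_par_eq hx
    have h1 : (C.hat q η (s, extChartAt (𝓡 (m + 1)) q q)).curryLeft (1, 0) = 0 := h q s hs
    rw [curryLeft_hat (slab_subset ⟨hs, mem_extChartAt_target q⟩)] at h1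
    exact eq_zero_of_hat_eq_zero (Ioo_subset_Ico_self hs) (mem_extChartAt_target q) h1

lemma hat_eq_of_isHorizontalOn {η : SpForm (m + 2) k M} (h : IsHorizontalOn C.v C.region η)
    (hz : z ∈ C.slab q₀) :
    C.hat q₀ η z = (inChart q₀ (C.pull z.1 η) z.2).compContinuousLinearMap
      (ContinuousLinearMap.snd ℝ ℝ (Eu (m + 1))) := by
  rw [inChart_pull (slab_subset hz)]
  exact (isHorizontal_hat h hz).eq_comp_snd

/-- Horizontal forms with the same pullbacks to `N` agree. -/
lemma eqOn_region_of_pull {η η' : SpForm (m + 2) k M} (h : IsHorizontalOn C.v C.region η)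
    (h' : IsHorizontalOn C.v C.region η') (hp : ∀ s ∈ Ioo 0 C.υmax, ∀ q,
      C.pull s η q = C.pull s η' q) : EqOn η η' C.region := by
  intro x hx
  obtain ⟨q, s, hs, rfl⟩ := exists_par_eq hx
  have hz : (s, extChartAt (𝓡 (m + 1)) q q) ∈ C.slab q := ⟨hs, mem_extChartAt_target q⟩
  rw [← sub_eq_zero]
  refine eq_zero_of_hat_eq_zero (η := η - η') (Ioo_subset_Ico_self hs) (mem_extChartAt_target q) ?_
  rw [hat_sub, hat_eq_of_isHorizontalOn h hz, hat_eq_of_isHorizontalOn h' hz,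
    show C.pull s η = C.pull s η' from funext (hp s hs), sub_self]

/-- A family of horizontal forms is smooth if its pullbacks to `N` are. -/
lemma smoothFamilyOn_of_isHorizontalOn {A : Eu r → SpForm (m + 2) k M}
    (h : ∀ u, IsHorizontalOn C.v C.region (A u)) (hs : ∀ (u : Eu r) (q : N), ∀ s ∈ Ioo 0 C.υmax,
      ContDiffAt ℝ ∞ (fun p : Eu r × (ℝ × Eu (m + 1)) => inChart q (C.pull p.2.1 (A p.1)) p.2.2)
        (u, (s, extChartAt (𝓡 (m + 1)) q q))) : SmoothFamilyOn C.region A := by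
  refine smoothFamilyOn_of_hat fun u q s hs' => ?_
  refine (contDiff_compContinuousLinearMap.contDiffAt.comp
    (u, (s, extChartAt (𝓡 (m + 1)) q q)) ((hs u q s hs').prodMk
      (contDiffAt_const (c := ContinuousLinearMap.snd ℝ ℝ (Eu (m + 1)))))).congr_of_eventuallyEq ?_
  have h1 : ∀ᶠ p in 𝓝 ((u, (s, extChartAt (𝓡 (m + 1)) q q)) : Eu r × (ℝ × Eu (m + 1))),
      p.2 ∈ C.slab q :=
    continuousAt_snd.eventually ((isOpen_slab C q).mem_nhds ⟨hs', mem_extChartAt_target q⟩)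
  filter_upwards [h1] with p hp
  exact hat_eq_of_isHorizontalOn (h p.1) hp

end Horizontal

/-! ### The horizontal form with given pullbacks -/

open Classical in
/-- The horizontal form on the region with the pullbacks `π_s^* η = b s`. -/
def lift (C : RiggedBoundary m M N) (k : ℕ) :
    (ℝ → SpForm (m + 1) k N) →ₗ[ℝ] SpForm (m + 2) k M where
  toFun b x := if h : x ∈ C.region then
    (((inChart (Classical.choose h).2 (b (Classical.choose h).1)
      (extChartAt (𝓡 (m + 1)) (Classical.choose h).2 (Classical.choose h).2)).compContinuousLinearMap
        (ContinuousLinearMap.snd ℝ ℝ (Eu (m + 1)))).compContinuousLinearMap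
          (C.dpar (Classical.choose h).2 ((Classical.choose h).1,
            extChartAt (𝓡 (m + 1)) (Classical.choose h).2 (Classical.choose h).2)).inverse)
    else 0
  map_add' b b' := by
    funext x
    by_cases h : x ∈ C.region
    · simp only [Pi.add_apply, dif_pos h]; rfl
    · simp only [Pi.add_apply, dif_neg h, add_zero]
  map_smul' a b := by
    funext x
    by_cases h : x ∈ C.region
    · simp only [Pi.smul_apply, dif_pos h]; rfl
    · simp only [Pi.smul_apply, dif_neg h, smul_zero]

variable {C : RiggedBoundary m M N} [T2Space M]

/-- The definition of `lift` chooses a time and a point of `N`. By `flow_injective` the choice is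
the given pair, and the inverse differential cancels against that in `hat`. -/
lemma hat_lift (b : ℝ → SpForm (m + 1) k N) {s : ℝ} (hs : s ∈ Ioo 0 C.υmax) (q : N) :
    C.hat q (C.lift k b) (s, extChartAt (𝓡 (m + 1)) q q) =
      (inChart q (b s) (extChartAt (𝓡 (m + 1)) q q)).compContinuousLinearMap
        (ContinuousLinearMap.snd ℝ ℝ (Eu (m + 1))) := by
  have hx : C.par q (s, extChartAt (𝓡 (m + 1)) q q) ∈ C.region :=
    par_mem_region ⟨hs, mem_extChartAt_target q⟩
  have h1 := Classical.choose_spec hx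
  have h2 : C.flow (Classical.choose hx).1 (Classical.choose hx).2 = C.flow s q := by
    refine h1.2.trans ?_
    simp only [par, extChartAt_to_inv]
  have h3 := C.flow_injective (Ioo_subset_Ico_self h1.1.1) (Ioo_subset_Ico_self hs) h2
  have h4 : Classical.choose hx = (s, q) := Prod.ext h3.1 h3.2
  have h5 : C.lift k b (C.par q (s, extChartAt (𝓡 (m + 1)) q q)) =
      ((inChart q (b s) (extChartAt (𝓡 (m + 1)) q q)).compContinuousLinearMap
        (ContinuousLinearMap.snd ℝ ℝ (Eu (m + 1)))).compContinuousLinearMap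
          (C.dpar q (s, extChartAt (𝓡 (m + 1)) q q)).inverse := by
    refine (dif_pos hx).trans ?_
    rw [h4]
  rw [hat, h5, inverse_comp_comp _
    (isInvertible_dpar (Ioo_subset_Ico_self hs) (mem_extChartAt_target q))]

lemma isHorizontalOn_lift (b : ℝ → SpForm (m + 1) k N) :
    IsHorizontalOn C.v C.region (C.lift k b) :=
  isHorizontalOn_of_hat fun q s hs => by
    rw [hat_lift b hs]
    exact isHorizontal_comp_snd _

lemma pull_lift (b : ℝ → SpForm (m + 1) k N) {s : ℝ} (hs : s ∈ Ioo 0 C.υmax) (q : N) :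
    C.pull s (C.lift k b) q = b s q := by
  have hq : q ∈ (extChartAt (𝓡 (m + 1)) q).source := mem_extChartAt_source q
  have hz : (s, extChartAt (𝓡 (m + 1)) q q) ∈ C.slab q := ⟨hs, mem_extChartAt_target q⟩
  rw [eq_inChart_comp hq (C.pull s (C.lift k b)), inChart_pull (slab_subset hz), hat_lift b hs,
    tang_comp_snd, ← eq_inChart_comp hq]

end RiggedBoundary

end

end HolRen

namespace HolRen

noncomputable section

/-! ### Partial derivatives -/

section Partial

variable {Z V : Type*} [NormedAddCommGroup Z] [NormedSpace ℝ Z]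
  [NormedAddCommGroup V] [NormedSpace ℝ V]

lemma DifferentiableAt.deriv_left {b : ℝ × Z → V} {s : ℝ} {z : Z}
    (hb : DifferentiableAt ℝ b (s, z)) :
    HasDerivAt (fun s => b (s, z)) (fderiv ℝ b (s, z) (1, 0)) s :=
  hb.hasFDerivAt.comp_hasDerivAt s ((hasDerivAt_id' s).prodMk (hasDerivAt_const s z))

lemma DifferentiableAt.fderiv_right {b : ℝ × Z → V} {s : ℝ} {z : Z}
    (hb : DifferentiableAt ℝ b (s, z)) :
    HasFDerivAt (fun z => b (s, z)) ((fderiv ℝ b (s, z)).comp (ContinuousLinearMap.inr ℝ ℝ Z)) z :=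
  hb.hasFDerivAt.comp z (hasFDerivAt_prodMk_right s z)

lemma ContDiffAt.eventually_differentiableAt {b : ℝ × Z → V} {w : ℝ × Z}
    (hb : ContDiffAt ℝ ∞ b w) : ∀ᶠ w' in 𝓝 w, DifferentiableAt ℝ b w' :=
  ((hb.of_le (m := 1) (by simp)).eventually (by simp)).mono
    fun w' hw' => hw'.differentiableAt (by simp)

/-- The derivative with respect to `s` commutes with that with respect to the parameters. -/
lemma hasDerivAt_fderiv_right {b : ℝ × Z → V} {s : ℝ} {z : Z} (hb : ContDiffAt ℝ ∞ b (s, z)) :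
    HasDerivAt (fun s => fderiv ℝ (fun z => b (s, z)) z)
      (fderiv ℝ (fun z => deriv (fun s => b (s, z)) s) z) s := by
  have h1 : ∀ᶠ w' in 𝓝 (s, z), DifferentiableAt ℝ b w' :=
    ContDiffAt.eventually_differentiableAt hb
  have hd : DifferentiableAt ℝ (fderiv ℝ b) (s, z) :=
    (hb.fderiv_right (m := 1) (by simpa [one_add_one_eq_two] using two_le_infty)).differentiableAt
      (by simp)
  have h2 : (fun s => fderiv ℝ (fun z => b (s, z)) z) =ᶠ[𝓝 s]
      fun s => (fderiv ℝ b (s, z)).comp (ContinuousLinearMap.inr ℝ ℝ Z) := by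
    have hc : ContinuousAt (fun s : ℝ => (s, z)) s := by fun_prop
    filter_upwards [hc.eventually h1] with s' hs'
    exact (DifferentiableAt.fderiv_right hs').fderiv
  have h3 : (fun z => deriv (fun s => b (s, z)) s) =ᶠ[𝓝 z] fun z => fderiv ℝ b (s, z) (1, 0) := by
    have hc : ContinuousAt (fun z : Z => (s, z)) z := by fun_prop
    filter_upwards [hc.eventually h1] with z' hz'
    exact (DifferentiableAt.deriv_left hz').deriv
  have h4 := hd.hasFDerivAt.comp_hasDerivAt s ((hasDerivAt_id' s).prodMk (hasDerivAt_const s z))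
  refine HasDerivAt.congr_of_eventuallyEq ?_ h2
  refine (h4.clm_comp (hasDerivAt_const s (ContinuousLinearMap.inr ℝ ℝ Z))).congr_deriv ?_
  rw [h3.fderiv_eq]
  have h5 : DifferentiableAt ℝ (fun w => fderiv ℝ b w (1, 0)) (s, z) :=
    hd.clm_apply (differentiableAt_const _)
  rw [(DifferentiableAt.fderiv_right h5).fderiv]
  ext w
  have h6 := fderiv_fderiv_apply_comm hb (1, 0) ((0, w) : ℝ × Z)
  have h7 : fderiv ℝ (fun w' => fderiv ℝ b w' (0, w)) (s, z) (1, 0) =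
      (fderiv ℝ (fderiv ℝ b) (s, z) (1, 0)) (0, w) := by
    rw [fderiv_clm_apply hd (differentiableAt_const _)]
    simp
  rw [h7] at h6
  simpa using h6

end Partial

/-- The exterior derivative in the directions of the second factor `E`. -/
def extRight (k r n : ℕ) : (Eu r × Eu n →L[ℝ] (Eu n) [⋀^Fin k]→L[ℝ] ℝ) →L[ℝ]
    (Eu n) [⋀^Fin (k + 1)]→L[ℝ] ℝ :=
  (ContinuousAlternatingMap.alternatizeUncurryFinCLM ℝ (Eu n) ℝ).comp
    (ContinuousLinearMap.precomp _ (ContinuousLinearMap.inr ℝ (Eu r) (Eu n)))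

lemma extRight_apply {k r n : ℕ} (T : Eu r × Eu n →L[ℝ] (Eu n) [⋀^Fin k]→L[ℝ] ℝ) :
    extRight k r n T = ContinuousAlternatingMap.alternatizeUncurryFin
      (T.comp (ContinuousLinearMap.inr ℝ (Eu r) (Eu n))) := rfl

namespace RiggedBoundary

variable {m k r : ℕ} {M N S : Type*} [DiffeologicalSpace S]
  [TopologicalSpace M] [ChartedSpace (Eu (m + 2)) M] [IsManifold (𝓡 (m + 2)) ∞ M]
  [TopologicalSpace N] [ChartedSpace (Eu (m + 1)) N] [IsManifold (𝓡 (m + 1)) ∞ N]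
  (C : RiggedBoundary m M N) (q₀ : N)

/-! ### Families of forms in flow coordinates -/

/-- The tangential part of a family of forms, as a function of the flow time, the parameter of the
family, and the coordinates on `N`. -/
def tng (A : Eu r → SpForm (m + 2) k M) (w : ℝ × (Eu r × Eu (m + 1))) :
    (Eu (m + 1)) [⋀^Fin k]→L[ℝ] ℝ :=
  tang k _ (C.hat q₀ (A w.2.1) (w.1, w.2.2))

/-- The normal part of a family of forms, as a function of the flow time, the parameter of the
family, and the coordinates on `N`. -/
def nrm (A : Eu r → SpForm (m + 2) (k + 1) M) (w : ℝ × (Eu r × Eu (m + 1))) :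
    (Eu (m + 1)) [⋀^Fin k]→L[ℝ] ℝ :=
  norml k _ (C.hat q₀ (A w.2.1) (w.1, w.2.2))

variable {C q₀} {s : ℝ} {u : Eu r} {y : Eu (m + 1)}

lemma contDiffAt_tng {A : Eu r → SpForm (m + 2) k M} (hA : SmoothFamilyOn C.region A)
    (hz : (s, y) ∈ C.slab q₀) : ContDiffAt ℝ ∞ (C.tng q₀ A) (s, (u, y)) := by
  have h1 : ContDiffAt ℝ ∞ (fun w : ℝ × (Eu r × Eu (m + 1)) => (w.2.1, (w.1, w.2.2)))
      (s, (u, y)) := by fun_prop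
  exact (tang k _).contDiff.contDiffAt.comp (s, (u, y)) (ContDiffAt.comp (s, (u, y))
    (g := fun p : Eu r × (ℝ × Eu (m + 1)) => C.hat q₀ (A p.1) p.2) (contDiffAt_hat hA u hz) h1)

lemma contDiffAt_nrm {A : Eu r → SpForm (m + 2) (k + 1) M} (hA : SmoothFamilyOn C.region A)
    (hz : (s, y) ∈ C.slab q₀) : ContDiffAt ℝ ∞ (C.nrm q₀ A) (s, (u, y)) := by
  have h1 : ContDiffAt ℝ ∞ (fun w : ℝ × (Eu r × Eu (m + 1)) => (w.2.1, (w.1, w.2.2)))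
      (s, (u, y)) := by fun_prop
  exact (norml k _).contDiff.contDiffAt.comp (s, (u, y)) (ContDiffAt.comp (s, (u, y))
    (g := fun p : Eu r × (ℝ × Eu (m + 1)) => C.hat q₀ (A p.1) p.2) (contDiffAt_hat hA u hz) h1)

lemma tng_eq (A : Eu r → SpForm (m + 2) k M) (hz : (s, y) ∈ C.slab q₀) :
    C.tng q₀ A (s, (u, y)) = inChart q₀ (C.pull s (A u)) y :=
  (inChart_pull (slab_subset hz) (A u)).symm

lemma nrm_eq (A : Eu r → SpForm (m + 2) (k + 1) M) (hz : (s, y) ∈ C.slab q₀) :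
    C.nrm q₀ A (s, (u, y)) = inChart q₀ (C.pull s (C.iv (A u))) y :=
  (inChart_pull_iv (slab_subset hz) (A u)).symm

/-- The partial derivatives of the tangential part, in terms of those at a fixed parameter. -/
lemma fderiv_tang_hat {A : Eu r → SpForm (m + 2) k M} (hA : SmoothFamilyOn C.region A)
    (hz : (s, y) ∈ C.slab q₀) (a : ℝ) (e : Eu (m + 1)) :
    fderiv ℝ (fun z => tang k _ (C.hat q₀ (A u) z)) (s, y) (a, e) =
      fderiv ℝ (C.tng q₀ A) (s, (u, y)) (a, (0, e)) := by
  have h1 := ((contDiffAt_tng (u := u) hA hz).differentiableAt (by simp)).hasFDerivAt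
  have h2 : HasFDerivAt (fun z : ℝ × Eu (m + 1) => (z.1, (u, z.2)))
      ((ContinuousLinearMap.fst ℝ ℝ (Eu (m + 1))).prod
        ((0 : ℝ × Eu (m + 1) →L[ℝ] Eu r).prod (ContinuousLinearMap.snd ℝ ℝ (Eu (m + 1))))) (s, y) :=
    hasFDerivAt_fst.prodMk ((hasFDerivAt_const u _).prodMk hasFDerivAt_snd)
  have h3 := HasFDerivAt.comp (g := C.tng q₀ A)
    (f := fun z : ℝ × Eu (m + 1) => (z.1, (u, z.2))) (s, y) h1 h2
  exact congrArg (fun T : ℝ × Eu (m + 1) →L[ℝ] _ => T (a, e)) h3.fderiv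

lemma fderiv_norml_hat {A : Eu r → SpForm (m + 2) (k + 1) M} (hA : SmoothFamilyOn C.region A)
    (hz : (s, y) ∈ C.slab q₀) (a : ℝ) (e : Eu (m + 1)) :
    fderiv ℝ (fun z => norml k _ (C.hat q₀ (A u) z)) (s, y) (a, e) =
      fderiv ℝ (C.nrm q₀ A) (s, (u, y)) (a, (0, e)) := by
  have h1 := ((contDiffAt_nrm (u := u) hA hz).differentiableAt (by simp)).hasFDerivAt
  have h2 : HasFDerivAt (fun z : ℝ × Eu (m + 1) => (z.1, (u, z.2)))
      ((ContinuousLinearMap.fst ℝ ℝ (Eu (m + 1))).prod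
        ((0 : ℝ × Eu (m + 1) →L[ℝ] Eu r).prod (ContinuousLinearMap.snd ℝ ℝ (Eu (m + 1))))) (s, y) :=
    hasFDerivAt_fst.prodMk ((hasFDerivAt_const u _).prodMk hasFDerivAt_snd)
  have h3 := HasFDerivAt.comp (g := C.nrm q₀ A)
    (f := fun z : ℝ × Eu (m + 1) => (z.1, (u, z.2))) (s, y) h1 h2
  exact congrArg (fun T : ℝ × Eu (m + 1) →L[ℝ] _ => T (a, e)) h3.fderiv

lemma differentiableAt_hat {A : Eu r → SpForm (m + 2) k M} (hA : SmoothFamilyOn C.region A)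
    {z : ℝ × Eu (m + 1)} (hz : z ∈ C.slab q₀) : DifferentiableAt ℝ (C.hat q₀ (A u)) z :=
  (contDiffAt_hat_fixed hA u hz).differentiableAt (by simp)

lemma tang_hat_dExt {A : Eu r → SpForm (m + 2) k M} (hA : SmoothFamilyOn C.region A)
    (hz : (s, y) ∈ C.slab q₀) :
    tang (k + 1) _ (C.hat q₀ (dExt (A u)) (s, y)) =
      extRight k r (m + 1) (fderiv ℝ (fun z => C.tng q₀ A (s, z)) (u, y)) := by
  rw [hat_dExt hA u hz, tang_extDeriv (differentiableAt_hat hA hz), extRight_apply,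
    (DifferentiableAt.fderiv_right
      ((contDiffAt_tng (u := u) hA hz).differentiableAt (by simp))).fderiv]
  congr 1
  ext1 e
  exact fderiv_tang_hat hA hz 0 e

lemma norml_hat_dExt {A : Eu r → SpForm (m + 2) (k + 1) M} (hA : SmoothFamilyOn C.region A)
    (hz : (s, y) ∈ C.slab q₀) :
    norml (k + 1) _ (C.hat q₀ (dExt (A u)) (s, y)) =
      deriv (fun s => C.tng q₀ A (s, (u, y))) s -
        extRight k r (m + 1) (fderiv ℝ (fun z => C.nrm q₀ A (s, z)) (u, y)) := by
  rw [hat_dExt hA u hz, norml_extDeriv (differentiableAt_hat hA hz), extRight_apply,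
    (DifferentiableAt.fderiv_right
      ((contDiffAt_nrm (u := u) hA hz).differentiableAt (by simp))).fderiv,
    (DifferentiableAt.deriv_left
      ((contDiffAt_tng (u := u) hA hz).differentiableAt (by simp))).deriv]
  congr 1
  · exact fderiv_tang_hat hA hz 1 0
  · congr 1
    ext1 e
    exact fderiv_norml_hat hA hz 0 e

/-- Degree zero is included because `Λ` takes values in the functions when `m = 0`. -/
lemma norml_hat_dExt_of_isHorizontalOn {A : Eu r → SpForm (m + 2) k M}
    (hA : SmoothFamilyOn C.region A) (hh : IsHorizontalOn C.v C.region (A u))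
    (hz : (s, y) ∈ C.slab q₀) :
    norml k _ (C.hat q₀ (dExt (A u)) (s, y)) = deriv (fun s => C.tng q₀ A (s, (u, y))) s := by
  have h1 : ∀ᶠ z in 𝓝 (s, y), IsHorizontal (C.hat q₀ (A u) z) := by
    filter_upwards [(isOpen_slab C q₀).mem_nhds hz] with z hz
    exact isHorizontal_hat hh hz
  rw [hat_dExt hA u hz, norml_extDeriv_of_isHorizontal (differentiableAt_hat hA hz) h1,
    (DifferentiableAt.deriv_left
      ((contDiffAt_tng (u := u) hA hz).differentiableAt (by simp))).deriv]
  exact fderiv_tang_hat hA hz 1 0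

/-! ### Variations -/

/-- At a fixed point `hat` is a fixed linear isomorphism, so it commutes with the parameter
derivative; its inverse transfers differentiability back to `A (p u)`. -/
lemma hat_delta {A : S → SpForm (m + 2) k M} (hA : SmoothField C.region A) {p : Eu r → S}
    (hp : IsPlot p) (h : Eu r) {z : ℝ × Eu (m + 1)} (hz : z ∈ C.slab q₀) :
    C.hat q₀ (delta A p u h) z = fderiv ℝ (fun u => C.hat q₀ (A (p u)) z) u h := by
  have h1 : DifferentiableAt ℝ (fun u => C.hat q₀ (A (p u)) z) u :=
    DifferentiableAt.comp u (g := fun q : Eu r × (ℝ × Eu (m + 1)) => C.hat q₀ (A (p q.1)) q.2)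
      (f := fun u => (u, z)) ((contDiffAt_hat (hA r p hp) u hz).differentiableAt (by simp))
      (by fun_prop)
  have hinv := isInvertible_dpar (y := z.2) (Ioo_subset_Ico_self hz.1) hz.2
  let T : ((Eu (m + 2)) [⋀^Fin k]→L[ℝ] ℝ) →L[ℝ] ((ℝ × Eu (m + 1)) [⋀^Fin k]→L[ℝ] ℝ) :=
    ContinuousAlternatingMap.compContinuousLinearMapCLM (C.dpar q₀ z)
  let T' : ((ℝ × Eu (m + 1)) [⋀^Fin k]→L[ℝ] ℝ) →L[ℝ] ((Eu (m + 2)) [⋀^Fin k]→L[ℝ] ℝ) :=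
    ContinuousAlternatingMap.compContinuousLinearMapCLM (C.dpar q₀ z).inverse
  have h2 : (fun u => A (p u) (C.par q₀ z)) = fun u => T' (C.hat q₀ (A (p u)) z) := by
    funext u
    exact (comp_comp_inverse (A (p u) (C.par q₀ z)) hinv).symm
  have h3 : DifferentiableAt ℝ (fun u => A (p u) (C.par q₀ z)) u := by
    rw [h2]; exact T'.differentiableAt.comp u h1
  have h4 := (T.hasFDerivAt.comp u h3.hasFDerivAt).fderiv
  exact (congrArg (fun R : Eu r →L[ℝ] _ => R h) h4).symm

lemma tang_hat_delta {A : S → SpForm (m + 2) k M} (hA : SmoothField C.region A) {p : Eu r → S}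
    (hp : IsPlot p) (h : Eu r) (hz : (s, y) ∈ C.slab q₀) :
    tang k _ (C.hat q₀ (delta A p u h) (s, y)) =
      fderiv ℝ (fun z => C.tng q₀ (fun u => A (p u)) (s, z)) (u, y) (h, 0) := by
  have h1 : DifferentiableAt ℝ (fun u => C.hat q₀ (A (p u)) (s, y)) u :=
    DifferentiableAt.comp u (g := fun q : Eu r × (ℝ × Eu (m + 1)) => C.hat q₀ (A (p q.1)) q.2)
      (f := fun u => (u, (s, y))) ((contDiffAt_hat (hA r p hp) u hz).differentiableAt (by simp))
      (by fun_prop)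
  have h2 := DifferentiableAt.fderiv_right
    ((contDiffAt_tng (u := u) (hA r p hp) hz).differentiableAt (by simp))
  have h3 := HasFDerivAt.comp (g := fun z => C.tng q₀ (fun u => A (p u)) (s, z))
    (f := fun u => (u, y)) u h2 (hasFDerivAt_prodMk_left u y)
  have h4 := (tang k (Eu (m + 1))).hasFDerivAt.comp u h1.hasFDerivAt
  rw [hat_delta hA hp h hz, h2.fderiv]
  exact congrArg (fun R : Eu r →L[ℝ] _ => R h) (h4.unique h3)

lemma norml_hat_delta {A : S → SpForm (m + 2) (k + 1) M} (hA : SmoothField C.region A)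
    {p : Eu r → S} (hp : IsPlot p) (h : Eu r) (hz : (s, y) ∈ C.slab q₀) :
    norml k _ (C.hat q₀ (delta A p u h) (s, y)) =
      fderiv ℝ (fun z => C.nrm q₀ (fun u => A (p u)) (s, z)) (u, y) (h, 0) := by
  have h1 : DifferentiableAt ℝ (fun u => C.hat q₀ (A (p u)) (s, y)) u :=
    DifferentiableAt.comp u (g := fun q : Eu r × (ℝ × Eu (m + 1)) => C.hat q₀ (A (p q.1)) q.2)
      (f := fun u => (u, (s, y))) ((contDiffAt_hat (hA r p hp) u hz).differentiableAt (by simp))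
      (by fun_prop)
  have h2 := DifferentiableAt.fderiv_right
    ((contDiffAt_nrm (u := u) (hA r p hp) hz).differentiableAt (by simp))
  have h3 := HasFDerivAt.comp (g := fun z => C.nrm q₀ (fun u => A (p u)) (s, z))
    (f := fun u => (u, y)) u h2 (hasFDerivAt_prodMk_left u y)
  have h4 := (norml k (Eu (m + 1))).hasFDerivAt.comp u h1.hasFDerivAt
  rw [hat_delta hA hp h hz, h2.fderiv]
  exact congrArg (fun R : Eu r →L[ℝ] _ => R h) (h4.unique h3)

end RiggedBoundary

end

end HolRen

namespace HolRen

noncomputable section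

lemma differentiableAt_deriv_left {Z V : Type*} [NormedAddCommGroup Z] [NormedSpace ℝ Z]
    [NormedAddCommGroup V] [NormedSpace ℝ V] {b : ℝ × Z → V} {s : ℝ} {z : Z}
    (hb : ContDiffAt ℝ ∞ b (s, z)) :
    DifferentiableAt ℝ (fun z => deriv (fun s => b (s, z)) s) z := by
  have h3 : (fun z => deriv (fun s => b (s, z)) s) =ᶠ[𝓝 z] fun z => fderiv ℝ b (s, z) (1, 0) := by
    have hc : ContinuousAt (fun z : Z => (s, z)) z := by fun_prop
    filter_upwards [hc.eventually (ContDiffAt.eventually_differentiableAt hb)] with z' hz'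
    exact (DifferentiableAt.deriv_left hz').deriv
  have h4 : DifferentiableAt ℝ (fun w => fderiv ℝ b w (1, 0)) (s, z) :=
    ((hb.fderiv_right (m := 1) (by simpa [one_add_one_eq_two] using two_le_infty)).differentiableAt
      (by simp)).clm_apply (differentiableAt_const _)
  exact (DifferentiableAt.fderiv_right h4).differentiableAt.congr_of_eventuallyEq h3

/-- In the application `f`, `g`, `f'`, `b`, `l` are `π_s^* i_v L`, `π_s^* θ`, `π_s^* i_v θ`, `π_s^*
B`, `π_s^* Λ`, and `T` is the exterior derivative on `N`. The hypothesis is then `δ L = d θ`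
contracted with `v`, rewritten by the homotopy formula; for the remaining terms `∂_s` only has to
commute with the other derivatives. -/
lemma hasDerivAt_transgression {Z V W : Type*} [NormedAddCommGroup Z] [NormedSpace ℝ Z]
    [NormedAddCommGroup V] [NormedSpace ℝ V] [NormedAddCommGroup W] [NormedSpace ℝ W]
    (T : (Z →L[ℝ] W) →L[ℝ] V) {f b g : ℝ × Z → V} {f' l : ℝ × Z → W} {s : ℝ} {z : Z}
    (e : Z) (hf : ContDiffAt ℝ ∞ f (s, z)) (hb : ContDiffAt ℝ ∞ b (s, z))
    (hg : ContDiffAt ℝ ∞ g (s, z)) (hf' : ContDiffAt ℝ ∞ f' (s, z)) (hl : ContDiffAt ℝ ∞ l (s, z))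
    (h : fderiv ℝ (fun z => f (s, z)) z e = deriv (fun s => g (s, z)) s -
      T (fderiv ℝ (fun z => f' (s, z)) z)) :
    HasDerivAt (fun s => g (s, z) + fderiv ℝ (fun z => b (s, z)) z e -
        T (fderiv ℝ (fun z => l (s, z)) z))
      (fderiv ℝ (fun z => f (s, z) + deriv (fun s => b (s, z)) s) z e +
        T (fderiv ℝ (fun z => f' (s, z) - deriv (fun s => l (s, z)) s) z)) s := by
  have e1 := DifferentiableAt.deriv_left (hg.differentiableAt (by simp))
  have hb' := hasDerivAt_fderiv_right hb
  have hl' := hasDerivAt_fderiv_right hl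
  have e2 : HasDerivAt (fun s => fderiv ℝ (fun z => b (s, z)) z e)
      (fderiv ℝ (fun z => deriv (fun s => b (s, z)) s) z e) s := by
    have h0 := hb'.clm_apply (hasDerivAt_const s e)
    rwa [map_zero, add_zero] at h0
  have e3 : HasDerivAt (fun s => T (fderiv ℝ (fun z => l (s, z)) z))
      (T (fderiv ℝ (fun z => deriv (fun s => l (s, z)) s) z)) s :=
    T.hasFDerivAt.comp_hasDerivAt s hl'
  refine ((e1.fun_add e2).fun_sub e3).congr_deriv ?_
  have df := (DifferentiableAt.fderiv_right (hf.differentiableAt (by simp))).differentiableAt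
  have df' := (DifferentiableAt.fderiv_right (hf'.differentiableAt (by simp))).differentiableAt
  rw [fderiv_fun_add df (differentiableAt_deriv_left hb),
    fderiv_fun_sub df' (differentiableAt_deriv_left hl), map_sub,
    _root_.add_apply, h, e1.deriv]
  abel

namespace RiggedBoundary

variable {m k r : ℕ} {M N S : Type*} [DiffeologicalSpace S]
  [TopologicalSpace M] [ChartedSpace (Eu (m + 2)) M] [IsManifold (𝓡 (m + 2)) ∞ M]
  [TopologicalSpace N] [ChartedSpace (Eu (m + 1)) N] [IsManifold (𝓡 (m + 1)) ∞ N]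
  {C : RiggedBoundary m M N} {q₀ : N}

/-! ### Limits from tangential and normal parts -/

lemma eq_of_inChart_eq {n : ℕ} {X : Type*} [TopologicalSpace X] [ChartedSpace (Eu n) X]
    [IsManifold (𝓡 n) ∞ X] {q : X} {α α' : (Eu n) [⋀^Fin k]→L[ℝ] ℝ}
    (h : α.compContinuousLinearMap (dSymm q (extChartAt (𝓡 n) q q)) =
      α'.compContinuousLinearMap (dSymm q (extChartAt (𝓡 n) q q))) : α = α' := by
  have key : ∀ β : (Eu n) [⋀^Fin k]→L[ℝ] ℝ,
      (β.compContinuousLinearMap (dSymm q (extChartAt (𝓡 n) q q))).compContinuousLinearMap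
        (dChart q q) = β := fun β => by
    ext w
    have h := fun i => congrArg (fun T : Eu n →L[ℝ] Eu n => T (w i))
      (dSymm_comp_dChart (mem_extChartAt_source (I := 𝓡 n) q))
    simp only [ContinuousLinearMap.comp_apply, ContinuousLinearMap.id_apply] at h
    simp only [ContinuousAlternatingMap.compContinuousLinearMap_apply, Function.comp_def, h]
  rw [← key α, h, key α']

lemma inChart_center {n : ℕ} {X : Type*} [TopologicalSpace X] [ChartedSpace (Eu n) X]
    (q : X) (η : SpForm n k X) : inChart q η (extChartAt (𝓡 n) q q) =
      (η q).compContinuousLinearMap (dSymm q (extChartAt (𝓡 n) q q)) := by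
  rw [inChart_eq, extChartAt_to_inv]

/-- A form has a finite limit if its tangential and normal parts converge. -/
lemma exists_hasLimitAt_of_tang_norml (q : N) {η : SpForm (m + 2) (k + 1) M}
    {β : (Eu (m + 1)) [⋀^Fin (k + 1)]→L[ℝ] ℝ} {γ : (Eu (m + 1)) [⋀^Fin k]→L[ℝ] ℝ}
    (hβ : Tendsto (fun z => tang (k + 1) _ (C.hat q η z))
      (𝓝[>] 0 ×ˢ 𝓝 (extChartAt (𝓡 (m + 1)) q q)) (𝓝 β))
    (hγ : Tendsto (fun z => norml k _ (C.hat q η z))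
      (𝓝[>] 0 ×ˢ 𝓝 (extChartAt (𝓡 (m + 1)) q q)) (𝓝 γ)) :
    ∃ α, HasLimitAt C.region η (C.flow 0 q) α ∧
      (C.restrictAt q α).compContinuousLinearMap (dSymm q (extChartAt (𝓡 (m + 1)) q q)) = β ∧
      (C.restrictAt q (C.ivAt q α)).compContinuousLinearMap
        (dSymm q (extChartAt (𝓡 (m + 1)) q q)) = γ ∧
      (γ = 0 → C.ivAt q α = 0) := by
  -- A form depends continuously on its two parts, so convergence of both gives convergence of the
  -- form.
  obtain ⟨R, hR⟩ := exists_recon (k := k) (E := Eu (m + 1))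
  have h1 : Tendsto (C.hat q η) (𝓝[>] 0 ×ˢ 𝓝 (extChartAt (𝓡 (m + 1)) q q)) (𝓝 (R (β, γ))) := by
    have h2 := (R.continuous.tendsto (β, γ)).comp (hβ.prodMk_nhds hγ)
    exact h2.congr fun z => hR _
  obtain ⟨α, hα, hα'⟩ := exists_hasLimitAt q h1
  have hs : (0 : ℝ) ∈ Ico 0 C.υmax := ⟨le_rfl, C.υmax_pos⟩
  have hy := mem_extChartAt_target (I := 𝓡 (m + 1)) q
  have hz := C.mem_parDom hs hy
  have ht : tang (k + 1) _ (R (β, γ)) = β := by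
    have h3 := ((tang (k + 1) (Eu (m + 1))).continuous.tendsto (R (β, γ))).comp h1
    exact tendsto_nhds_unique h3 hβ
  have hn : norml k _ (R (β, γ)) = γ := by
    have h3 := ((norml k (Eu (m + 1))).continuous.tendsto (R (β, γ))).comp h1
    exact tendsto_nhds_unique h3 hγ
  have e1 := tang_comp_dpar hz α
  have e2 := norml_comp_dpar hz α
  rw [hα', ht] at e1
  rw [hα', hn] at e2
  have hpar : C.par q (0, extChartAt (𝓡 (m + 1)) q q) = C.flow 0 q := by
    simp only [par, extChartAt_to_inv]
  simp only [extChartAt_to_inv] at e1 e2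
  rw [hpar] at e2
  refine ⟨α, hα, e1, e2, fun h0 => ?_⟩
  -- If the normal part vanishes, the limit is horizontal in flow coordinates. Inverting the
  -- differential of `par` gives vanishing of the contraction on the full tangent space of `M`, not
  -- only on that of `N`.
  have h4 : (R (β, γ)).curryLeft (1, 0) = 0 := isHorizontal_of_norml (hn.trans h0)
  rw [← hα'] at h4
  have h5 := curryLeft_hat hz (fun _ : M => α)
  rw [hat, h4, hat] at h5
  have h6 := comp_comp_inverse (C.ivAt q α) (isInvertible_dpar hs hy)
  rw [← h6]
  have h7 : (C.ivAt q α).compContinuousLinearMap (C.dpar q (0, extChartAt (𝓡 (m + 1)) q q)) = 0 := by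
    refine Eq.trans ?_ h5.symm
    exact congrArg (fun x : M => (α.curryLeft (C.v x : Eu (m + 2))).compContinuousLinearMap
      (C.dpar q (0, extChartAt (𝓡 (m + 1)) q q))) hpar.symm
  rw [h7]
  rfl

/-! ### Renormalized forms in flow coordinates -/

section Renormalized

variable {L : S → SpForm (m + 2) (m + 2) M} {θ : FieldOneForm S (SpForm (m + 2) (m + 1) M)}
  {B : S → SpForm (m + 2) (m + 1) M} {Λ : FieldOneForm S (SpForm (m + 2) m M)}
  {p : Eu r → S} (hp : IsPlot p) (h : Eu r) {s : ℝ} {u : Eu r} {y : Eu (m + 1)}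

/-- Since `B` is horizontal, the homotopy formula for `d B` reduces to the flow derivative. -/
lemma norml_lagRen (hp : IsPlot p) (hB : SmoothField C.region B) (hB' : ∀ φ, IsHorizontalOn C.v C.region (B φ))
    (hz : (s, y) ∈ C.slab q₀) :
    norml (m + 1) _ (C.hat q₀ (lagRen L B (p u)) (s, y)) =
      C.nrm q₀ (fun u => L (p u)) (s, (u, y)) +
        deriv (fun s => C.tng q₀ (fun u => B (p u)) (s, (u, y))) s := by
  rw [lagRen, hat_add, map_add,
    norml_hat_dExt_of_isHorizontalOn (A := fun u => B (p u)) (hB r p hp) (hB' (p u)) hz]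
  rfl

lemma nrm_eq_zero {A : Eu r → SpForm (m + 2) (k + 1) M}
    (hA : ∀ u, IsHorizontalOn C.v C.region (A u)) (hz : (s, y) ∈ C.slab q₀) :
    C.nrm q₀ A (s, (u, y)) = 0 := by
  have h1 : (C.hat q₀ (A u) (s, y)).curryLeft (1, 0) = 0 := isHorizontal_hat (hA u) hz
  rw [nrm, norml_apply, h1, map_zero]

/-- `δ B` inherits horizontality from `B` and does not contribute; `Λ` enters as `B` does in
`L_ren`, with the opposite sign. -/
lemma norml_thetaRen (hB : SmoothField C.region B)
    (hB' : ∀ φ, IsHorizontalOn C.v C.region (B φ)) (hΛ : SmoothFieldOneForm C.region Λ)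
    (hΛ' : ∀ u, IsHorizontalOn C.v C.region (Λ.toFun p hp u h)) (hz : (s, y) ∈ C.slab q₀) :
    norml m _ (C.hat q₀ (thetaRen θ B Λ p hp u h) (s, y)) =
      C.nrm q₀ (fun u => θ.toFun p hp u h) (s, (u, y)) -
        deriv (fun s => C.tng q₀ (fun u => Λ.toFun p hp u h) (s, (u, y))) s := by
  have h1 : (fun z => C.nrm q₀ (fun u => B (p u)) (s, z)) =ᶠ[𝓝 (u, y)] fun _ => 0 := by
    filter_upwards [(continuousAt_snd (p := (u, y))).eventually
      ((isOpen_extChartAt_target q₀).mem_nhds hz.2)] with z hz'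
    exact nrm_eq_zero (A := fun u => B (p u)) (fun u => hB' (p u)) ⟨hz.1, hz'⟩
  have h2 : norml m _ (C.hat q₀ (delta B p u h) (s, y)) = 0 := by
    rw [norml_hat_delta hB hp h hz, h1.fderiv_eq]
    simp
  rw [thetaRen, hat_sub, hat_add, map_sub, map_add, h2, add_zero,
    norml_hat_dExt_of_isHorizontalOn (A := fun u => Λ.toFun p hp u h) (hΛ r p hp h) (hΛ' u) hz]
  rfl

lemma tang_thetaRen (hB : SmoothField C.region B) (hΛ : SmoothFieldOneForm C.region Λ)
    (hz : (s, y) ∈ C.slab q₀) :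
    tang (m + 1) _ (C.hat q₀ (thetaRen θ B Λ p hp u h) (s, y)) =
      C.tng q₀ (fun u => θ.toFun p hp u h) (s, (u, y)) +
        fderiv ℝ (fun z => C.tng q₀ (fun u => B (p u)) (s, z)) (u, y) (h, 0) -
        extRight m r (m + 1)
          (fderiv ℝ (fun z => C.tng q₀ (fun u => Λ.toFun p hp u h) (s, z)) (u, y)) := by
  rw [thetaRen, hat_sub, hat_add, map_sub, map_add, tang_hat_delta hB hp h hz,
    tang_hat_dExt (A := fun u => Λ.toFun p hp u h) (hΛ r p hp h) hz]
  rfl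

/-- The equation `∂_s π_s^* θ_ren = δ π_s^* i_v L_ren + d π_s^* i_v θ_ren`. -/
lemma hasDerivAt_tang_thetaRen (hL : SmoothField C.region L) (hθ : SmoothFieldOneForm C.region θ)
    (onShell : ∀ x ∈ C.region, delta L p u h x = dExt (θ.toFun p hp u h) x)
    (hB : SmoothField C.region B) (hΛ : SmoothFieldOneForm C.region Λ)
    (hz : (s, y) ∈ C.slab q₀) :
    HasDerivAt (fun s => tang (m + 1) _ (C.hat q₀ (thetaRen θ B Λ p hp u h) (s, y)))
      (fderiv ℝ (fun z => C.nrm q₀ (fun u => L (p u)) (s, z) +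
          deriv (fun s => C.tng q₀ (fun u => B (p u)) (s, z)) s) (u, y) (h, 0) +
        extRight m r (m + 1) (fderiv ℝ (fun z => C.nrm q₀ (fun u => θ.toFun p hp u h) (s, z) -
          deriv (fun s => C.tng q₀ (fun u => Λ.toFun p hp u h) (s, z)) s) (u, y))) s := by
  have e := hasDerivAt_transgression (extRight m r (m + 1)) (h, 0) (contDiffAt_nrm (u := u) (hL r p hp) hz)
    (contDiffAt_tng (u := u) (hB r p hp) hz) (contDiffAt_tng (u := u) (hθ r p hp h) hz)
    (contDiffAt_nrm (u := u) (hθ r p hp h) hz) (contDiffAt_tng (u := u) (hΛ r p hp h) hz) ?_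
  · refine e.congr_of_eventuallyEq ?_
    filter_upwards [isOpen_Ioo.mem_nhds hz.1] with s' hs'
    exact tang_thetaRen hp h hB hΛ ⟨hs', hz.2⟩
  -- The required identity is the normal part of `δ L = d θ`.
  · rw [← norml_hat_delta hL hp h hz, ← norml_hat_dExt (A := fun u => θ.toFun p hp u h)
      (hθ r p hp h) hz, hat, onShell _ (par_mem_region hz)]
    rfl

end Renormalized

end RiggedBoundary

end

end HolRen

namespace HolRen

noncomputable section

lemma uIcc_subset_Ioo {a b s s' : ℝ} (hs' : s' ∈ Ioo a b) (hs : s ∈ Ioo a b) :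
    uIcc s s' ⊆ Ioo a b :=
  ordConnected_Ioo.uIcc_subset hs hs'

/-! ### Integrals of families of forms on `N` -/

section Integrals

variable {n k : ℕ} {X : Type*} [TopologicalSpace X] [ChartedSpace (Eu n) X] [IsManifold (𝓡 n) ∞ X]

lemma continuousOn_of_inChart {q₀ : X} {y : Eu n} (hy : y ∈ (extChartAt (𝓡 n) q₀).target)
    {G : ℝ → SpForm n k X} {I : Set ℝ} (hG : ContinuousOn (fun s => inChart q₀ (G s) y) I) :
    ContinuousOn (fun s => G s ((extChartAt (𝓡 n) q₀).symm y)) I := by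
  let T : ((Eu n) [⋀^Fin k]→L[ℝ] ℝ) →L[ℝ] ((Eu n) [⋀^Fin k]→L[ℝ] ℝ) :=
    ContinuousAlternatingMap.compContinuousLinearMapCLM
      (dChart q₀ ((extChartAt (𝓡 n) q₀).symm y))
  refine (T.continuous.comp_continuousOn hG).congr fun s _ => ?_
  have h := eq_inChart_comp ((extChartAt (𝓡 n) q₀).map_target hy) (G s)
  rw [(extChartAt (𝓡 n) q₀).right_inv hy] at h
  exact h

lemma inChart_integral {q₀ : X} {y : Eu n} (hy : y ∈ (extChartAt (𝓡 n) q₀).target)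
    {G : ℝ → SpForm n k X} {a b : ℝ} (hG : ContinuousOn (fun s => inChart q₀ (G s) y) (uIcc a b)) :
    inChart q₀ (fun q => ∫ s in a..b, G s q) y = ∫ s in a..b, inChart q₀ (G s) y := by
  let T : ((Eu n) [⋀^Fin k]→L[ℝ] ℝ) →L[ℝ] ((Eu n) [⋀^Fin k]→L[ℝ] ℝ) :=
    ContinuousAlternatingMap.compContinuousLinearMapCLM (dSymm q₀ y)
  exact (T.intervalIntegral_comp_comm (continuousOn_of_inChart hy hG).intervalIntegrable).symm

end Integrals

namespace RiggedBoundary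

variable {m k r : ℕ} {M N S : Type*} [DiffeologicalSpace S]
  [TopologicalSpace M] [ChartedSpace (Eu (m + 2)) M] [IsManifold (𝓡 (m + 2)) ∞ M]
  [TopologicalSpace N] [ChartedSpace (Eu (m + 1)) N] [IsManifold (𝓡 (m + 1)) ∞ N]
  {C : RiggedBoundary m M N} {q₀ : N}

lemma continuousOn_nrm {A : Eu r → SpForm (m + 2) (k + 1) M} (hA : SmoothFamilyOn C.region A)
    (u : Eu r) {y : Eu (m + 1)} (hy : y ∈ (extChartAt (𝓡 (m + 1)) q₀).target) :
    ContinuousOn (fun s => C.nrm q₀ A (s, (u, y))) (Ioo 0 C.υmax) := fun s hs => by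
  have h1 := (contDiffAt_nrm (u := u) hA (show (s, y) ∈ C.slab q₀ from ⟨hs, hy⟩)).continuousAt
  exact (ContinuousAt.comp (g := C.nrm q₀ A) (f := fun s : ℝ => (s, (u, y))) h1
    (by fun_prop)).continuousWithinAt

lemma continuousOn_pull_iv {A : Eu r → SpForm (m + 2) (k + 1) M} (hA : SmoothFamilyOn C.region A)
    (u : Eu r) {y : Eu (m + 1)} (hy : y ∈ (extChartAt (𝓡 (m + 1)) q₀).target) :
    ContinuousOn (fun s => inChart q₀ (C.pull s (C.iv (A u))) y) (Ioo 0 C.υmax) :=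
  (continuousOn_nrm hA u hy).congr fun _ hs => (nrm_eq A ⟨hs, hy⟩).symm

lemma intervalIntegrable_pull_iv {A : Eu r → SpForm (m + 2) (k + 1) M}
    (hA : SmoothFamilyOn C.region A) (u : Eu r) (q : N) {υ₀ s : ℝ} (hυ₀ : υ₀ ∈ Ioo 0 C.υmax)
    (hs : s ∈ Ioo 0 C.υmax) :
    IntervalIntegrable (fun s => C.pull s (C.iv (A u)) q) MeasureTheory.volume s υ₀ := by
  have h1 := continuousOn_of_inChart (mem_extChartAt_target q)
    (continuousOn_pull_iv hA u (mem_extChartAt_target (I := 𝓡 (m + 1)) q))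
  rw [extChartAt_to_inv] at h1
  exact (h1.mono (uIcc_subset_Ioo hυ₀ hs)).intervalIntegrable

/-- Pullbacks given by integrals along the flow, in coordinates. -/
lemma tng_eq_integral {A : Eu r → SpForm (m + 2) (k + 1) M} (hA : SmoothFamilyOn C.region A)
    {η : Eu r → SpForm (m + 2) k M} {υ₀ : ℝ} (hυ₀ : υ₀ ∈ Ioo 0 C.υmax)
    (hη : ∀ u, ∀ s ∈ Ioo 0 C.υmax, ∀ q, C.pull s (η u) q = ∫ s' in s..υ₀, C.pull s' (C.iv (A u)) q)
    {s : ℝ} {u : Eu r} {y : Eu (m + 1)} (hz : (s, y) ∈ C.slab q₀) :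
    C.tng q₀ η (s, (u, y)) = ∫ s' in s..υ₀, C.nrm q₀ A (s', (u, y)) := by
  rw [tng_eq η hz, show C.pull s (η u) = _ from funext (hη u s hz.1), inChart_integral hz.2
    ((continuousOn_pull_iv hA u hz.2).mono (uIcc_subset_Ioo hυ₀ hz.1))]
  refine intervalIntegral.integral_congr fun s' hs' => ?_
  exact (nrm_eq A ⟨uIcc_subset_Ioo hυ₀ hz.1 hs', hz.2⟩).symm

/-- Horizontal forms given by integrals along the flow are smooth. -/
lemma smoothFamilyOn_of_integral {A : Eu r → SpForm (m + 2) (k + 1) M}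
    (hA : SmoothFamilyOn C.region A) {η : Eu r → SpForm (m + 2) k M} {υ₀ : ℝ}
    (hυ₀ : υ₀ ∈ Ioo 0 C.υmax) (hh : ∀ u, IsHorizontalOn C.v C.region (η u))
    (hη : ∀ u, ∀ s ∈ Ioo 0 C.υmax, ∀ q,
      C.pull s (η u) q = ∫ s' in s..υ₀, C.pull s' (C.iv (A u)) q) :
    SmoothFamilyOn C.region η := by
  refine smoothFamilyOn_of_isHorizontalOn hh fun u q s hs => ?_
  let O : Set (Eu r × Eu (m + 1)) := univ ×ˢ (extChartAt (𝓡 (m + 1)) q).target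
  have hO : IsOpen O := isOpen_univ.prod (isOpen_extChartAt_target q)
  have hf : ContDiffOn ℝ ∞ (C.nrm q A) (Ioo 0 C.υmax ×ˢ O) := fun w hw =>
    (contDiffAt_nrm (s := w.1) (u := w.2.1) (y := w.2.2) hA ⟨hw.1, hw.2.2⟩).contDiffWithinAt
  let σ : Eu r × (ℝ × Eu (m + 1)) →L[ℝ] ℝ :=
    (ContinuousLinearMap.fst ℝ ℝ (Eu (m + 1))).comp (ContinuousLinearMap.snd ℝ (Eu r) _)
  let ζ : Eu r × (ℝ × Eu (m + 1)) →L[ℝ] Eu r × Eu (m + 1) :=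
    (ContinuousLinearMap.fst ℝ (Eu r) _).prod
      ((ContinuousLinearMap.snd ℝ ℝ (Eu (m + 1))).comp (ContinuousLinearMap.snd ℝ (Eu r) _))
  have h1 := contDiffOn_integral_left isOpen_Ioo ordConnected_Ioo hυ₀ hO hf σ ζ
  have hopen : IsOpen (σ ⁻¹' Ioo 0 C.υmax ∩ ζ ⁻¹' O) :=
    (isOpen_Ioo.preimage σ.continuous).inter (hO.preimage ζ.continuous)
  have hmem : (u, (s, extChartAt (𝓡 (m + 1)) q q)) ∈ σ ⁻¹' Ioo 0 C.υmax ∩ ζ ⁻¹' O :=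
    ⟨hs, mem_univ _, mem_extChartAt_target q⟩
  refine (h1.contDiffAt (hopen.mem_nhds hmem)).congr_of_eventuallyEq ?_
  filter_upwards [hopen.mem_nhds hmem] with p hp
  have hz : (p.2.1, p.2.2) ∈ C.slab q := ⟨hp.1, hp.2.2⟩
  have h2 := tng_eq_integral (u := p.1) hA hυ₀ hη hz
  rw [tng_eq η hz] at h2
  exact h2

/-- Fundamental theorem of calculus at the lower endpoint: an integral counterterm cancels the
normal part exactly. -/
lemma nrm_add_deriv_tng_eq_zero {A : Eu r → SpForm (m + 2) (k + 1) M}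
    (hA : SmoothFamilyOn C.region A) {η : Eu r → SpForm (m + 2) k M} {υ₀ : ℝ}
    (hυ₀ : υ₀ ∈ Ioo 0 C.υmax)
    (hη : ∀ u, ∀ s ∈ Ioo 0 C.υmax, ∀ q,
      C.pull s (η u) q = ∫ s' in s..υ₀, C.pull s' (C.iv (A u)) q)
    {s : ℝ} {u : Eu r} {y : Eu (m + 1)} (hz : (s, y) ∈ C.slab q₀) :
    C.nrm q₀ A (s, (u, y)) + deriv (fun s => C.tng q₀ η (s, (u, y))) s = 0 := by
  have hc := continuousOn_nrm (q₀ := q₀) hA u hz.2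
  have h1 : (fun s => C.tng q₀ η (s, (u, y))) =ᶠ[𝓝 s]
      fun s => ∫ s' in s..υ₀, C.nrm q₀ A (s', (u, y)) := by
    filter_upwards [isOpen_Ioo.mem_nhds hz.1] with s' hs'
    exact tng_eq_integral hA hυ₀ hη ⟨hs', hz.2⟩
  have h2 := intervalIntegral.integral_hasDerivAt_left
    (hc.mono (uIcc_subset_Ioo hυ₀ hz.1)).intervalIntegrable
    (hc.stronglyMeasurableAtFilter isOpen_Ioo s hz.1) (hc.continuousAt (isOpen_Ioo.mem_nhds hz.1))
  rw [h1.deriv_eq, h2.deriv, add_neg_cancel]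

end RiggedBoundary

end

end HolRen

namespace HolRen

noncomputable section

section Families

variable {n k r : ℕ} {S X : Type*} [DiffeologicalSpace S] [TopologicalSpace X]
  [ChartedSpace (Eu n) X] {D : Set X}

lemma SmoothFamilyOn.neg {A : Eu r → SpForm n k X} (hA : SmoothFamilyOn D A) :
    SmoothFamilyOn D (fun u => -A u) := fun x₀ => (hA x₀).neg

end Families

namespace RiggedBoundary

/-! ### The counterterms given by integrals along the flow -/

variable {m k r : ℕ} {M N S : Type*} [DiffeologicalSpace S]
  [TopologicalSpace M] [ChartedSpace (Eu (m + 2)) M] [IsManifold (𝓡 (m + 2)) ∞ M]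
  [TopologicalSpace N] [ChartedSpace (Eu (m + 1)) N] [IsManifold (𝓡 (m + 1)) ∞ N]
  {C : RiggedBoundary m M N} {q₀ : N} {L : S → SpForm (m + 2) (m + 2) M}
  {θ : FieldOneForm S (SpForm (m + 2) (m + 1) M)} {υ₀ : ℝ}

theorem exists_isCounterterm [T2Space M] (hθ : SmoothFieldOneForm C.region θ)
    (hυ₀ : υ₀ ∈ Ioo 0 C.υmax) :
    ∃ (B : S → SpForm (m + 2) (m + 1) M) (Λ : FieldOneForm S (SpForm (m + 2) m M)),
      C.IsCounterterm υ₀ L θ B Λ := by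
  classical
  let Λ : FieldOneForm S (SpForm (m + 2) m M) :=
    { toFun := fun {r} p hp u => (C.lift m).comp
        -- Outside the flow interval the value is set to zero: additivity in `h` uses integrability,
        -- which is available only for times inside.
        { toFun := fun h s => if s ∈ Ioo 0 C.υmax then
            fun q => -∫ s' in s..υ₀, C.pull s' (C.iv (θ.toFun p hp u h)) q else 0
          map_add' := fun h h' => by
            funext s
            by_cases hs : s ∈ Ioo 0 C.υmax
            · simp only [Pi.add_apply, if_pos hs]
              funext q
              have e := fun h => intervalIntegrable_pull_iv
                (A := fun u => θ.toFun p hp u h) (hθ r p hp h) u q hυ₀ hs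
              rw [Pi.add_apply, ← neg_add, ← intervalIntegral.integral_add (e h) (e h'), map_add]
              rfl
            · simp only [Pi.add_apply, if_neg hs, add_zero]
          map_smul' := fun a h => by
            funext s
            by_cases hs : s ∈ Ioo 0 C.υmax
            · simp only [Pi.smul_apply, if_pos hs]
              funext q
              rw [Pi.smul_apply, RingHom.id_apply, smul_neg, ← intervalIntegral.integral_smul,
                map_smul]
              rfl
            · simp only [Pi.smul_apply, if_neg hs, smul_zero] }
      compat := fun {r s} p hp f hf u h => by
        simp only [LinearMap.comp_apply, LinearMap.coe_mk, AddHom.coe_mk, θ.compat p hp f hf] }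
  refine ⟨fun φ => C.lift (m + 1) fun s q => ∫ s' in s..υ₀, C.pull s' (C.iv (L φ)) q, Λ, ?_⟩
  constructor
  · exact fun φ => isHorizontalOn_lift _
  · exact fun φ s hs q => pull_lift _ hs q
  · exact fun p hp u h => isHorizontalOn_lift _
  · intro r p hp u h s hs q
    refine (pull_lift _ hs q).trans ?_
    exact congrFun (if_pos hs) q

lemma IsCounterterm.eqOn {B B' : S → SpForm (m + 2) (m + 1) M}
    {Λ Λ' : FieldOneForm S (SpForm (m + 2) m M)} (hc : C.IsCounterterm υ₀ L θ B Λ)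
    (hc' : C.IsCounterterm υ₀ L θ B' Λ') : (∀ φ, EqOn (B φ) (B' φ) C.region) ∧
      ∀ {r : ℕ} (p : Eu r → S) (hp : IsPlot p) (u h : Eu r),
        EqOn (Λ.toFun p hp u h) (Λ'.toFun p hp u h) C.region :=
  ⟨fun φ => eqOn_region_of_pull (hc.int_B φ) (hc'.int_B φ) fun s hs q => by
    rw [hc.pull_B φ s hs, hc'.pull_B φ s hs],
  fun p hp u h => eqOn_region_of_pull (hc.int_Λ p hp u h) (hc'.int_Λ p hp u h) fun s hs q => by
    rw [hc.pull_Λ p hp u h s hs, hc'.pull_Λ p hp u h s hs]⟩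

lemma iv_eq_zero_of_norml {η : SpForm (m + 2) (k + 1) M}
    (h : ∀ q : N, ∀ s ∈ Ioo 0 C.υmax,
      norml k _ (C.hat q η (s, extChartAt (𝓡 (m + 1)) q q)) = 0) :
    ∀ x ∈ C.region, C.iv η x = 0 :=
  isHorizontalOn_of_hat (k := k + 1) (η := η) fun q s hs => isHorizontal_of_norml (h q s hs)

lemma eventually_mem_slab (q : N) :
    ∀ᶠ z in 𝓝[>] (0 : ℝ) ×ˢ 𝓝 (extChartAt (𝓡 (m + 1)) q q), z ∈ C.slab q :=
  prod_mem_prod (Ioo_mem_nhdsGT C.υmax_pos) (extChartAt_target_mem_nhds q)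

section Counterterm

variable {B : S → SpForm (m + 2) (m + 1) M} {Λ : FieldOneForm S (SpForm (m + 2) m M)}

/-- `Λ` is the integral counterterm built from `-θ`, so the general lemmas on such integrals apply
to it as they do to `B`. -/
lemma IsCounterterm.pull_Λ_neg (hc : C.IsCounterterm υ₀ L θ B Λ) {p : Eu r → S} (hp : IsPlot p)
    (h u : Eu r) {s : ℝ} (hs : s ∈ Ioo 0 C.υmax) (q : N) :
    C.pull s (Λ.toFun p hp u h) q =
      ∫ s' in s..υ₀, C.pull s' (C.iv (-θ.toFun p hp u h)) q := by
  rw [hc.pull_Λ p hp u h s hs q, ← intervalIntegral.integral_neg]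
  rfl

lemma IsCounterterm.smooth_B (hc : C.IsCounterterm υ₀ L θ B Λ) (hL : SmoothField C.region L)
    (hυ₀ : υ₀ ∈ Ioo 0 C.υmax) : SmoothField C.region B := fun r p hp =>
  smoothFamilyOn_of_integral (hL r p hp) hυ₀ (fun u => hc.int_B (p u)) fun u => hc.pull_B (p u)

lemma IsCounterterm.smooth_Λ (hc : C.IsCounterterm υ₀ L θ B Λ) (hθ : SmoothFieldOneForm C.region θ)
    (hυ₀ : υ₀ ∈ Ioo 0 C.υmax) : SmoothFieldOneForm C.region Λ := fun r p hp h =>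
  smoothFamilyOn_of_integral (hθ r p hp h).neg hυ₀ (fun u => hc.int_Λ p hp u h)
    fun u _ hs q => hc.pull_Λ_neg hp h u hs q

lemma IsCounterterm.nrm_add_eq_zero (hc : C.IsCounterterm υ₀ L θ B Λ) (hL : SmoothField C.region L)
    (hυ₀ : υ₀ ∈ Ioo 0 C.υmax) {p : Eu r → S} (hp : IsPlot p) {s : ℝ} {u : Eu r} {y : Eu (m + 1)}
    (hz : (s, y) ∈ C.slab q₀) : C.nrm q₀ (fun u => L (p u)) (s, (u, y)) +
      deriv (fun s => C.tng q₀ (fun u => B (p u)) (s, (u, y))) s = 0 :=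
  nrm_add_deriv_tng_eq_zero (hL r p hp) hυ₀ (fun u => hc.pull_B (p u)) hz

lemma IsCounterterm.nrm_sub_eq_zero (hc : C.IsCounterterm υ₀ L θ B Λ)
    (hθ : SmoothFieldOneForm C.region θ) (hυ₀ : υ₀ ∈ Ioo 0 C.υmax) {p : Eu r → S} (hp : IsPlot p)
    (h : Eu r) {s : ℝ} {u : Eu r} {y : Eu (m + 1)} (hz : (s, y) ∈ C.slab q₀) :
    C.nrm q₀ (fun u => θ.toFun p hp u h) (s, (u, y)) -
      deriv (fun s => C.tng q₀ (fun u => Λ.toFun p hp u h) (s, (u, y))) s = 0 := by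
  have h1 := nrm_add_deriv_tng_eq_zero (hθ r p hp h).neg hυ₀
    (fun u _ hs q => hc.pull_Λ_neg hp h u hs q) hz (u := u)
  have h2 : C.nrm q₀ (fun u => -θ.toFun p hp u h) (s, (u, y)) =
      -C.nrm q₀ (fun u => θ.toFun p hp u h) (s, (u, y)) :=
    map_neg (norml m (Eu (m + 1))) (C.hat q₀ (θ.toFun p hp u h) (s, y))
  rw [h2] at h1
  rw [sub_eq_zero]
  exact (neg_add_eq_zero.1 h1)

theorem IsCounterterm.iv_lagRen (hc : C.IsCounterterm υ₀ L θ B Λ) (hL : SmoothField C.region L)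
    (hυ₀ : υ₀ ∈ Ioo 0 C.υmax) (φ : S) : ∀ x ∈ C.region, C.iv (lagRen L B φ) x = 0 := by
  refine iv_eq_zero_of_norml fun q s hs => ?_
  have hz : (s, extChartAt (𝓡 (m + 1)) q q) ∈ C.slab q := ⟨hs, mem_extChartAt_target q⟩
  -- A single field configuration is treated as a constant plot with zero-dimensional parameter
  -- space.
  have hp : IsPlot (fun _ : Eu 0 => φ) := isPlot_const
  exact (norml_lagRen (u := 0) hp (hc.smooth_B hL hυ₀) hc.int_B hz).trans
    (hc.nrm_add_eq_zero hL hυ₀ hp hz)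

/-- The tangential part of the top-degree form `L_ren` has degree `m + 2` on a space of dimension `m
+ 1` and vanishes automatically; the normal part is cancelled by `B`. -/
theorem IsCounterterm.lagRen_eq_zero (hc : C.IsCounterterm υ₀ L θ B Λ)
    (hL : SmoothField C.region L) (hυ₀ : υ₀ ∈ Ioo 0 C.υmax) (φ : S) :
    ∀ x ∈ C.region, lagRen L B φ x = 0 := by
  intro x hx
  obtain ⟨q, s, hs, rfl⟩ := exists_par_eq hx
  have hz : (s, extChartAt (𝓡 (m + 1)) q q) ∈ C.slab q := ⟨hs, mem_extChartAt_target q⟩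
  have hp : IsPlot (fun _ : Eu 0 => φ) := isPlot_const
  refine eq_zero_of_hat_eq_zero (Ioo_subset_Ico_self hs) hz.2 (eq_zero_of_tang_norml ?_ ?_)
  · exact eq_zero_of_finrank_lt (by simp) _
  · exact (norml_lagRen (u := 0) hp (hc.smooth_B hL hυ₀) hc.int_B hz).trans
      (hc.nrm_add_eq_zero hL hυ₀ hp hz)

lemma IsCounterterm.norml_thetaRen_eq_zero (hc : C.IsCounterterm υ₀ L θ B Λ)
    (hL : SmoothField C.region L) (hθ : SmoothFieldOneForm C.region θ) (hυ₀ : υ₀ ∈ Ioo 0 C.υmax)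
    {p : Eu r → S} (hp : IsPlot p) (u h : Eu r) {z : ℝ × Eu (m + 1)} (hz : z ∈ C.slab q₀) :
    norml m _ (C.hat q₀ (thetaRen θ B Λ p hp u h) z) = 0 :=
  (norml_thetaRen hp h (hc.smooth_B hL hυ₀) hc.int_B (hc.smooth_Λ hθ hυ₀)
    (fun u => hc.int_Λ p hp u h) hz).trans (hc.nrm_sub_eq_zero hθ hυ₀ hp h hz)

/-- Stated on a neighbourhood, because it serves to make parameter and coordinate derivatives vanish
at the time `υ₀`. -/
lemma tng_eq_zero_of_pull {A : Eu r → SpForm (m + 2) k M} {s : ℝ} (hs : s ∈ Ioo 0 C.υmax)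
    (hA : ∀ u q, C.pull s (A u) q = 0) :
    (fun z => C.tng q₀ A (s, z)) =ᶠ[𝓝ˢ (univ ×ˢ (extChartAt (𝓡 (m + 1)) q₀).target)]
      fun _ => 0 := by
  have ho : IsOpen ((univ : Set (Eu r)) ×ˢ (extChartAt (𝓡 (m + 1)) q₀).target) :=
    isOpen_univ.prod (isOpen_extChartAt_target q₀)
  rw [EventuallyEq, ho.nhdsSet_eq, eventually_principal]
  intro z hz
  have h1 := tng_eq (u := z.1) A (show (s, z.2) ∈ C.slab q₀ from ⟨hs, hz.2⟩)
  refine h1.trans ?_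
  rw [show C.pull s (A z.1) = 0 from funext (hA z.1)]
  rfl

/-- Both terms of `∂_s π_s^* θ_ren = δ π_s^* i_v L_ren + d π_s^* i_v θ_ren` vanish, so the
tangential part does not depend on the time. At `υ₀` the integrals run from `υ₀` to `υ₀`, hence `B`
and `Λ` pull back to zero there and only `θ` remains. -/
lemma IsCounterterm.tang_thetaRen_eq (hc : C.IsCounterterm υ₀ L θ B Λ)
    (hL : SmoothField C.region L) (hθ : SmoothFieldOneForm C.region θ) (hυ₀ : υ₀ ∈ Ioo 0 C.υmax)
    {p : Eu r → S} (hp : IsPlot p) (u h : Eu r)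
    (onShell : ∀ x ∈ C.region, delta L p u h x = dExt (θ.toFun p hp u h) x)
    {z : ℝ × Eu (m + 1)} (hz : z ∈ C.slab q₀) :
    tang (m + 1) _ (C.hat q₀ (thetaRen θ B Λ p hp u h) z) =
      C.tng q₀ (fun u => θ.toFun p hp u h) (υ₀, (u, z.2)) := by
  obtain ⟨s, y⟩ := z
  have hB := hc.smooth_B hL hυ₀
  have hΛ := hc.smooth_Λ hθ hυ₀
  have hO : ∀ᶠ w in 𝓝 (u, y), w ∈ (univ : Set (Eu r)) ×ˢ (extChartAt (𝓡 (m + 1)) q₀).target :=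
    (isOpen_univ.prod (isOpen_extChartAt_target q₀)).mem_nhds ⟨mem_univ _, hz.2⟩
  have hd : ∀ s' ∈ Ioo 0 C.υmax, HasDerivAt
      (fun s => tang (m + 1) _ (C.hat q₀ (thetaRen θ B Λ p hp u h) (s, y))) 0 s' := by
    intro s' hs'
    refine (hasDerivAt_tang_thetaRen hp h hL hθ onShell hB hΛ ⟨hs', hz.2⟩).congr_deriv ?_
    have e1 : (fun z => C.nrm q₀ (fun u => L (p u)) (s', z) +
        deriv (fun s => C.tng q₀ (fun u => B (p u)) (s, z)) s') =ᶠ[𝓝 (u, y)] fun _ => 0 := by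
      filter_upwards [hO] with w hw using hc.nrm_add_eq_zero hL hυ₀ hp ⟨hs', hw.2⟩
    have e2 : (fun z => C.nrm q₀ (fun u => θ.toFun p hp u h) (s', z) -
        deriv (fun s => C.tng q₀ (fun u => Λ.toFun p hp u h) (s, z)) s') =ᶠ[𝓝 (u, y)]
        fun _ => 0 := by
      filter_upwards [hO] with w hw using hc.nrm_sub_eq_zero hθ hυ₀ hp h ⟨hs', hw.2⟩
    rw [e1.fderiv_eq, e2.fderiv_eq]
    simp
  have h1 := isOpen_Ioo.is_const_of_deriv_eq_zero isPreconnected_Ioo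
    (fun x hx => (hd x hx).differentiableAt.differentiableWithinAt)
    (fun x hx => (hd x hx).deriv) hz.1 hυ₀
  refine h1.trans ?_
  rw [tang_thetaRen hp h hB hΛ ⟨hυ₀, hz.2⟩]
  have e3 : (fun z => C.tng q₀ (fun u => B (p u)) (υ₀, z)) =ᶠ[𝓝 (u, y)] fun _ => 0 :=
    (tng_eq_zero_of_pull hυ₀ fun u q => by
      rw [hc.pull_B _ _ hυ₀, intervalIntegral.integral_same]).filter_mono
      (nhds_le_nhdsSet ⟨mem_univ _, hz.2⟩)
  have e4 : (fun z => C.tng q₀ (fun u => Λ.toFun p hp u h) (υ₀, z)) =ᶠ[𝓝 (u, y)] fun _ => 0 :=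
    (tng_eq_zero_of_pull hυ₀ fun u q => by
      rw [hc.pull_Λ _ _ _ _ _ hυ₀, intervalIntegral.integral_same, neg_zero]).filter_mono
      (nhds_le_nhdsSet ⟨mem_univ _, hz.2⟩)
  rw [e3.fderiv_eq, e4.fderiv_eq]
  simp

theorem IsCounterterm.pull_thetaRen (hc : C.IsCounterterm υ₀ L θ B Λ)
    (hL : SmoothField C.region L) (hθ : SmoothFieldOneForm C.region θ) (hυ₀ : υ₀ ∈ Ioo 0 C.υmax)
    {p : Eu r → S} (hp : IsPlot p) (u h : Eu r)
    (onShell : ∀ x ∈ C.region, delta L p u h x = dExt (θ.toFun p hp u h) x)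
    {s : ℝ} (hs : s ∈ Ioo 0 C.υmax) (q : N) :
    C.pull s (thetaRen θ B Λ p hp u h) q = C.pull υ₀ (θ.toFun p hp u h) q := by
  have hz : (s, extChartAt (𝓡 (m + 1)) q q) ∈ C.slab q := ⟨hs, mem_extChartAt_target q⟩
  have h1 := hc.tang_thetaRen_eq hL hθ hυ₀ hp u h onShell hz
  rw [← inChart_pull (slab_subset hz), tng_eq (fun u => θ.toFun p hp u h) ⟨hυ₀, hz.2⟩,
    inChart_center, inChart_center] at h1
  exact eq_of_inChart_eq h1

theorem IsCounterterm.exists_hasLimitAt_thetaRen (hc : C.IsCounterterm υ₀ L θ B Λ)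
    (hL : SmoothField C.region L) (hθ : SmoothFieldOneForm C.region θ) (hυ₀ : υ₀ ∈ Ioo 0 C.υmax)
    {p : Eu r → S} (hp : IsPlot p) (u h : Eu r)
    (onShell : ∀ x ∈ C.region, delta L p u h x = dExt (θ.toFun p hp u h) x) (q : N) :
    ∃ α, HasLimitAt C.region (thetaRen θ B Λ p hp u h) (C.flow 0 q) α ∧ C.ivAt q α = 0 ∧
      C.restrictAt q α = C.pull υ₀ (θ.toFun p hp u h) q := by
  set y₀ := extChartAt (𝓡 (m + 1)) q q with hy₀
  have hz : (υ₀, y₀) ∈ C.slab q := ⟨hυ₀, mem_extChartAt_target q⟩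
  have h1 : Tendsto (fun z => tang (m + 1) _ (C.hat q (thetaRen θ B Λ p hp u h) z))
      (𝓝[>] 0 ×ˢ 𝓝 y₀) (𝓝 (C.tng q (fun u => θ.toFun p hp u h) (υ₀, (u, y₀)))) := by
    have hcont := (contDiffAt_tng (u := u) (hθ r p hp h) hz).continuousAt
    have h2 : Tendsto (fun z : ℝ × Eu (m + 1) => (υ₀, (u, z.2))) (𝓝[>] 0 ×ˢ 𝓝 y₀)
        (𝓝 (υ₀, (u, y₀))) :=
      tendsto_const_nhds.prodMk_nhds (tendsto_const_nhds.prodMk_nhds tendsto_snd)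
    refine (hcont.tendsto.comp h2).congr' ?_
    filter_upwards [eventually_mem_slab (C := C) q] with z hz
    exact (hc.tang_thetaRen_eq hL hθ hυ₀ hp u h onShell hz).symm
  have h2 : Tendsto (fun z => norml m _ (C.hat q (thetaRen θ B Λ p hp u h) z))
      (𝓝[>] 0 ×ˢ 𝓝 y₀) (𝓝 0) := by
    refine tendsto_const_nhds.congr' ?_
    filter_upwards [eventually_mem_slab (C := C) q] with z hz
    exact (hc.norml_thetaRen_eq_zero hL hθ hυ₀ hp u h hz).symm
  obtain ⟨α, hα, hα1, -, hα2⟩ := exists_hasLimitAt_of_tang_norml q h1 h2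
  refine ⟨α, hα, hα2 rfl, eq_of_inChart_eq (hα1.trans ?_)⟩
  rw [tng_eq (fun u => θ.toFun p hp u h) hz, inChart_center]

end Counterterm

end RiggedBoundary

end

end HolRen

namespace HolRen

noncomputable section

/-! ### Expansions in powers of `s` and `s log s` in coordinates -/

lemma IsLogSmooth.congr {Z V : Type*} [NormedAddCommGroup Z] [NormedSpace ℝ Z]
    [NormedAddCommGroup V] [NormedSpace ℝ V] {t : ℕ} {z₀ : Z} {f g : ℝ → Z → V}
    {H : ℝ × ℝ × Z → V} (h : IsLogSmooth t z₀ f H)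
    (hfg : ∀ᶠ p : ℝ × Z in 𝓝[>] 0 ×ˢ 𝓝 z₀, g p.1 p.2 = f p.1 p.2) : IsLogSmooth t z₀ g H := by
  refine ⟨h.1, ?_⟩
  filter_upwards [h.2, hfg] with p h1 h2
  rw [h2, h1]

/-- The coordinate expression at a point, as a linear map. -/
def inChartₗ {n k : ℕ} {X : Type*} [TopologicalSpace X] [ChartedSpace (Eu n) X] (q : X) (y : Eu n) :
    SpForm n k X →ₗ[ℝ] (Eu n) [⋀^Fin k]→L[ℝ] ℝ where
  toFun η := inChart q η y
  map_add' _ _ := rfl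
  map_smul' _ _ := rfl

lemma inChart_neg_primCoeff {n k : ℕ} {X : Type*} [TopologicalSpace X] [ChartedSpace (Eu n) X]
    (q : X) (y : Eu n) (t : ℕ) (c : ℤ → ℕ → SpForm n k X) (i : ℤ) (j : ℕ) :
    inChart q (-primCoeff t c i j) y = -primCoeff t (fun i j => inChart q (c i j) y) i j := by
  have := (inChartₗ q y).map_neg (primCoeff t c i j)
  rw [primCoeff_map] at this
  exact this

/-- The local function of the definition is replaced by a globally smooth one with the same germ.
Taylor coefficients depend only on germs, and equality of germs persists nearby, so the coefficients
are identified for all `z` near the base point. -/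
lemma HasLogExpansion.exists_isLogSmooth {d k r : ℕ} {X : Type*} [TopologicalSpace X]
    [ChartedSpace (Eu d) X] {t : ℕ} {υmax : ℝ} {f : ℝ → Eu r → SpForm d k X}
    {c : ℤ → ℕ → Eu r → SpForm d k X} (h : HasLogExpansion t υmax f c) (hυ : 0 < υmax) (u₀ : Eu r)
    (q₀ : X) : ∃ H : ℝ × ℝ × (Eu r × Eu d) → (Eu d) [⋀^Fin k]→L[ℝ] ℝ,
      IsLogSmooth t (u₀, extChartAt (𝓡 d) q₀ q₀) (fun s z => inChart q₀ (f s z.1) z.2) H ∧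
      ∀ᶠ z in 𝓝 (u₀, extChartAt (𝓡 d) q₀ q₀), ∀ i j : ℕ,
        tcoef i j H z = inChart q₀ (c ((i : ℤ) - t) j z.1) z.2 := by
  obtain ⟨O, H₀, hO, hmem, hH₀, hf, hc⟩ := h u₀ q₀
  obtain ⟨H, hH, hHH⟩ := exists_contDiff_eventuallyEq hO hmem hH₀
  set z₀ : Eu r × Eu d := (u₀, extChartAt (𝓡 d) q₀ q₀) with hz₀
  have htar : ∀ᶠ z : Eu r × Eu d in 𝓝 z₀, z.2 ∈ (extChartAt (𝓡 d) q₀).target :=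
    (continuousAt_snd (p := z₀)).eventually (extChartAt_target_mem_nhds (I := 𝓡 d) q₀)
  refine ⟨H, ⟨hH, ?_⟩, ?_⟩
  · have h1 : Tendsto (fun p : ℝ × (Eu r × Eu d) => (p.1, p.1 * Real.log p.1, p.2))
        (𝓝[>] 0 ×ˢ 𝓝 z₀) (𝓝 (0, 0, z₀)) :=
      (tendsto_fst.mono_right nhdsWithin_le_nhds).prodMk_nhds
        ((tendsto_self_mul_log.comp tendsto_fst).prodMk_nhds tendsto_snd)
    filter_upwards [h1.eventually hHH, h1.eventually (hO.mem_nhds hmem),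
      tendsto_fst.eventually (Ioo_mem_nhdsGT hυ), tendsto_snd.eventually htar] with p e1 e2 e3 e4
    rw [e1]
    exact hf p.1 p.2.1 p.2.2 e3.1 e3.2 e4 e2
  · have h2 : Tendsto (fun z : Eu r × Eu d => ((0 : ℝ), (0 : ℝ), z)) (𝓝 z₀) (𝓝 (0, 0, z₀)) :=
      tendsto_const_nhds.prodMk_nhds (tendsto_const_nhds.prodMk_nhds tendsto_id)
    filter_upwards [h2.eventually (eventually_eventually_nhds.2 hHH),
      h2.eventually (hO.mem_nhds hmem), htar] with z e1 e2 e3 i j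
    rw [tcoef_congr e1]
    exact (hc z.1 z.2 e3 e2 i j).symm

lemma HasLogExpansion.neg {d k r : ℕ} {X : Type*} [TopologicalSpace X]
    [ChartedSpace (Eu d) X] {t : ℕ} {υmax : ℝ} {f : ℝ → Eu r → SpForm d k X}
    {c : ℤ → ℕ → Eu r → SpForm d k X} (h : HasLogExpansion t υmax f c) :
    HasLogExpansion t υmax (fun s u => -f s u) (fun i j u => -c i j u) := by
  intro u₀ q₀
  obtain ⟨O, H, hO, hmem, hH, hf, hc⟩ := h u₀ q₀
  refine ⟨O, fun w => -H w, hO, hmem, hH.neg, fun s u y h1 h2 h3 h4 => ?_, fun u y h1 h2 i j => ?_⟩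
  · exact (smul_neg _ (inChart q₀ (f s u) y)).trans (congrArg Neg.neg (hf s u y h1 h2 h3 h4))
  · have e1 : (fun a : ℝ => iteratedDeriv j (fun b : ℝ => -H (a, b, u, y)) 0) =
        fun a : ℝ => -iteratedDeriv j (fun b : ℝ => H (a, b, u, y)) 0 := by
      funext a
      exact iteratedDeriv_fun_neg j (fun b : ℝ => H (a, b, u, y)) 0
    rw [e1, iteratedDeriv_fun_neg, smul_neg, ← hc u y h1 h2 i j]
    rfl

namespace RiggedBoundary

variable {m k r : ℕ} {M N S : Type*} [DiffeologicalSpace S]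
  [TopologicalSpace M] [ChartedSpace (Eu (m + 2)) M] [IsManifold (𝓡 (m + 2)) ∞ M]
  [TopologicalSpace N] [ChartedSpace (Eu (m + 1)) N] [IsManifold (𝓡 (m + 1)) ∞ N]
  {C : RiggedBoundary m M N}

lemma eventually_slab (u₀ : Eu r) (q : N) : ∀ᶠ p : ℝ × (Eu r × Eu (m + 1)) in
    𝓝[>] 0 ×ˢ 𝓝 (u₀, extChartAt (𝓡 (m + 1)) q q), (p.1, p.2.2) ∈ C.slab q := by
  have h1 : Tendsto (fun p : ℝ × (Eu r × Eu (m + 1)) => (p.1, p.2.2))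
      (𝓝[>] 0 ×ˢ 𝓝 (u₀, extChartAt (𝓡 (m + 1)) q q))
      (𝓝[>] 0 ×ˢ 𝓝 (extChartAt (𝓡 (m + 1)) q q)) :=
    tendsto_fst.prodMk ((continuousAt_snd (p := (u₀, extChartAt (𝓡 (m + 1)) q q))).tendsto.comp
      tendsto_snd)
  exact h1.eventually (eventually_mem_slab q)

lemma exists_isLogSmooth_nrm {t : ℕ} {A : Eu r → SpForm (m + 2) (k + 1) M}
    {c : ℤ → ℕ → Eu r → SpForm (m + 1) k N}
    (h : HasLogExpansion t C.υmax (fun s u => C.pull s (C.iv (A u))) c) (u₀ : Eu r) (q : N) :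
    ∃ H : ℝ × ℝ × (Eu r × Eu (m + 1)) → (Eu (m + 1)) [⋀^Fin k]→L[ℝ] ℝ,
      IsLogSmooth t (u₀, extChartAt (𝓡 (m + 1)) q q) (fun s z => C.nrm q A (s, z)) H ∧
      ∀ᶠ z in 𝓝 (u₀, extChartAt (𝓡 (m + 1)) q q), ∀ i j : ℕ,
        tcoef i j H z = inChart q (c ((i : ℤ) - t) j z.1) z.2 := by
  obtain ⟨H, h1, h2⟩ := h.exists_isLogSmooth C.υmax_pos u₀ q
  refine ⟨H, h1.congr ?_, h2⟩
  filter_upwards [eventually_slab (C := C) u₀ q] with p hp using nrm_eq A hp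

lemma exists_isLogSmooth_tng {t : ℕ} {A : Eu r → SpForm (m + 2) k M}
    {c : ℤ → ℕ → Eu r → SpForm (m + 1) k N}
    (h : HasLogExpansion t C.υmax (fun s u => C.pull s (A u)) c) (u₀ : Eu r) (q : N) :
    ∃ H : ℝ × ℝ × (Eu r × Eu (m + 1)) → (Eu (m + 1)) [⋀^Fin k]→L[ℝ] ℝ,
      IsLogSmooth t (u₀, extChartAt (𝓡 (m + 1)) q q) (fun s z => C.tng q A (s, z)) H ∧
      ∀ᶠ z in 𝓝 (u₀, extChartAt (𝓡 (m + 1)) q q), ∀ i j : ℕ,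
        tcoef i j H z = inChart q (c ((i : ℤ) - t) j z.1) z.2 := by
  obtain ⟨H, h1, h2⟩ := h.exists_isLogSmooth C.υmax_pos u₀ q
  refine ⟨H, h1.congr ?_, h2⟩
  filter_upwards [eventually_slab (C := C) u₀ q] with p hp using tng_eq A hp

/-- If the expansion of the pullbacks of `η` cancels the divergent terms in that of the pullbacks
of `i_v A`, then `π_s^* i_v A + ∂_s π_s^* η` is free of divergences up to a certain order. -/
lemma exists_isFlat_nrm_add_deriv {t K : ℕ} (hK : 1 ≤ K)
    {A : Eu r → SpForm (m + 2) (k + 1) M} {η : Eu r → SpForm (m + 2) k M}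
    {c b : ℤ → ℕ → Eu r → SpForm (m + 1) k N}
    (hA : HasLogExpansion t C.υmax (fun s u => C.pull s (C.iv (A u))) c)
    (hη : HasLogExpansion t C.υmax (fun s u => C.pull s (η u)) b)
    (hb : ∀ (i : ℤ) (j : ℕ) (u : Eu r), -(t : ℤ) ≤ i → i + j ≤ K →
      b i j u = -primCoeff t (fun i' j' => c i' j' u) i j) (u₀ : Eu r) (q : N) :
    ∃ G, IsLogSmooth (t + 1) (u₀, extChartAt (𝓡 (m + 1)) q q)
        (fun s z => C.nrm q A (s, z) + deriv (fun s => C.tng q η (s, z)) s) G ∧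
      IsFlat t K (u₀, extChartAt (𝓡 (m + 1)) q q) G ∧
      tcoef (t + 1) 0 G (u₀, extChartAt (𝓡 (m + 1)) q q) =
        inChart q (c 0 0 u₀) (extChartAt (𝓡 (m + 1)) q q) := by
  obtain ⟨Hf, f1, f2⟩ := exists_isLogSmooth_nrm hA u₀ q
  obtain ⟨Hb, b1, b2⟩ := exists_isLogSmooth_tng hη u₀ q
  refine exists_isFlat_add_deriv (c := fun z i j => inChart q (c i j z.1) z.2) hK f1 b1 f2 ?_
  filter_upwards [b2] with z hz i j hij
  rw [hz, hb _ _ _ (by omega) (by omega), inChart_neg_primCoeff]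

/-- The expansion of the tangential part of a counterterm has no finite part. -/
lemma exists_isLogSmooth_tng_of_primCoeff {t K : ℕ} {η : Eu r → SpForm (m + 2) k M}
    {c b : ℤ → ℕ → Eu r → SpForm (m + 1) k N}
    (hη : HasLogExpansion t C.υmax (fun s u => C.pull s (η u)) b)
    (hb : ∀ (i : ℤ) (j : ℕ) (u : Eu r), -(t : ℤ) ≤ i → i + j ≤ K →
      b i j u = -primCoeff t (fun i' j' => c i' j' u) i j) (u₀ : Eu r) (q : N) :
    ∃ H : ℝ × ℝ × (Eu r × Eu (m + 1)) → (Eu (m + 1)) [⋀^Fin k]→L[ℝ] ℝ,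
      IsLogSmooth t (u₀, extChartAt (𝓡 (m + 1)) q q) (fun s z => C.tng q η (s, z)) H ∧
      fderiv ℝ (tcoef t 0 H) (u₀, extChartAt (𝓡 (m + 1)) q q) = 0 := by
  obtain ⟨H, h1, h2⟩ := exists_isLogSmooth_tng hη u₀ q
  refine ⟨H, h1, ?_⟩
  have h3 : tcoef t 0 H =ᶠ[𝓝 (u₀, extChartAt (𝓡 (m + 1)) q q)] fun _ => 0 := by
    filter_upwards [h2] with z hz
    rw [hz, hb _ _ _ (by omega) (by omega), inChart_neg_primCoeff, sub_self, primCoeff_zero_zero,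
      neg_zero]
  rw [h3.fderiv_eq]
  simp

end RiggedBoundary

end

end HolRen

namespace HolRen

noncomputable section

namespace RiggedBoundary

variable {m k r : ℕ} {M N S : Type*} [DiffeologicalSpace S]
  [TopologicalSpace M] [ChartedSpace (Eu (m + 2)) M] [IsManifold (𝓡 (m + 2)) ∞ M]
  [TopologicalSpace N] [ChartedSpace (Eu (m + 1)) N] [IsManifold (𝓡 (m + 1)) ∞ N]
  {C : RiggedBoundary m M N}

/-! ### Counterterms with a prescribed asymptotic series -/

lemma tng_neg (q : N) (A : Eu r → SpForm (m + 2) k M) (w : ℝ × (Eu r × Eu (m + 1))) :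
    C.tng q (fun u => -A u) w = -C.tng q A w := by
  have : C.hat q (-A w.2.1) (w.1, w.2.2) = -C.hat q (A w.2.1) (w.1, w.2.2) := rfl
  simp only [tng, this, map_neg]

/-- Restriction of a limit that is uniform in a parameter to a value of the parameter. -/
lemma tendsto_of_parameter {Y Z W : Type*} [TopologicalSpace Y] [TopologicalSpace Z]
    {F : ℝ × (Z × Y) → W} {z : Z} {y : Y} {l : Filter W}
    (h : Tendsto F (𝓝[>] 0 ×ˢ 𝓝 (z, y)) l) :
    Tendsto (fun w : ℝ × Y => F (w.1, (z, w.2))) (𝓝[>] 0 ×ˢ 𝓝 y) l :=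
  h.comp (tendsto_fst.prodMk (tendsto_const_nhds.prodMk_nhds tendsto_snd))

section Limits

variable {L : S → SpForm (m + 2) (m + 2) M} {θ : FieldOneForm S (SpForm (m + 2) (m + 1) M)}
  {B : S → SpForm (m + 2) (m + 1) M} {Λ : FieldOneForm S (SpForm (m + 2) m M)}
  {t K : ℕ} {p : Eu r → S} {hp : IsPlot p} {h : Eu r}

/-- The counterterm makes the normal part flat, so it converges to its finite part, which is that of
`π_s^* i_v L`. The limit is joint in the parameter and the point of `N` and is then restricted to a
fixed parameter. -/
lemma tendsto_norml_lagRen (hK : 1 ≤ K) (hp : IsPlot p) (hB : SmoothField C.region B)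
    (hB' : ∀ φ, IsHorizontalOn C.v C.region (B φ)) {cL b : ℤ → ℕ → Eu r → SpForm (m + 1) (m + 1) N}
    (hL : HasLogExpansion t C.υmax (fun s u => C.pull s (C.iv (L (p u)))) cL)
    (hb : HasLogExpansion t C.υmax (fun s u => C.pull s (B (p u))) b)
    (hbc : ∀ (i : ℤ) (j : ℕ) (u : Eu r), -(t : ℤ) ≤ i → i + j ≤ K →
      b i j u = -primCoeff t (fun i' j' => cL i' j' u) i j) (u : Eu r) (q : N) :
    Tendsto (fun w => norml (m + 1) _ (C.hat q (lagRen L B (p u)) w))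
      (𝓝[>] 0 ×ˢ 𝓝 (extChartAt (𝓡 (m + 1)) q q))
      (𝓝 (inChart q (cL 0 0 u) (extChartAt (𝓡 (m + 1)) q q))) := by
  obtain ⟨G, g1, g2, g3⟩ := exists_isFlat_nrm_add_deriv hK hL hb hbc u q
  have h1 := tendsto_of_parameter (g1.tendsto hK g2)
  rw [g3] at h1
  refine h1.congr' ?_
  filter_upwards [eventually_mem_slab (C := C) q] with w hw
  exact (norml_lagRen hp hB hB' hw).symm

lemma tendsto_norml_thetaRen (hK : 1 ≤ K) (hB : SmoothField C.region B)
    (hB' : ∀ φ, IsHorizontalOn C.v C.region (B φ)) (hΛ : SmoothFieldOneForm C.region Λ)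
    (hΛ' : ∀ u, IsHorizontalOn C.v C.region (Λ.toFun p hp u h))
    {cI b : ℤ → ℕ → Eu r → SpForm (m + 1) m N}
    (hθ : HasLogExpansion t C.υmax (fun s u => C.pull s (C.iv (θ.toFun p hp u h))) cI)
    (hb : HasLogExpansion t C.υmax (fun s u => C.pull s (-Λ.toFun p hp u h)) b)
    (hbc : ∀ (i : ℤ) (j : ℕ) (u : Eu r), -(t : ℤ) ≤ i → i + j ≤ K →
      b i j u = -primCoeff t (fun i' j' => cI i' j' u) i j) (u : Eu r) (q : N) :
    Tendsto (fun w => norml m _ (C.hat q (thetaRen θ B Λ p hp u h) w))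
      (𝓝[>] 0 ×ˢ 𝓝 (extChartAt (𝓡 (m + 1)) q q))
      (𝓝 (inChart q (cI 0 0 u) (extChartAt (𝓡 (m + 1)) q q))) := by
  obtain ⟨G, g1, g2, g3⟩ := exists_isFlat_nrm_add_deriv hK hθ hb hbc u q
  have h1 := tendsto_of_parameter (g1.tendsto hK g2)
  rw [g3] at h1
  refine h1.congr' ?_
  filter_upwards [eventually_mem_slab (C := C) q] with w hw
  refine ((norml_thetaRen hp h hB hB' hΛ hΛ' hw).trans ?_).symm
  simp only [tng_neg, deriv.fun_neg, sub_eq_add_neg]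

/-- The expansion of the tangential part of `θ_ren` has the same finite part as that of `θ`, and,
since `δ L = d θ`, a bounded derivative along the flow. -/
lemma tendsto_tang_thetaRen (hK : 1 ≤ K) (hL : SmoothField C.region L)
    (hθ : SmoothFieldOneForm C.region θ)
    (onShell : ∀ u, ∀ x ∈ C.region, delta L p u h x = dExt (θ.toFun p hp u h) x)
    (hB : SmoothField C.region B) (hΛ : SmoothFieldOneForm C.region Λ)
    {cL bB c0 : ℤ → ℕ → Eu r → SpForm (m + 1) (m + 1) N}
    {cI bΛ : ℤ → ℕ → Eu r → SpForm (m + 1) m N}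
    (eL : HasLogExpansion t C.υmax (fun s u => C.pull s (C.iv (L (p u)))) cL)
    (eI : HasLogExpansion t C.υmax (fun s u => C.pull s (C.iv (θ.toFun p hp u h))) cI)
    (e0 : HasLogExpansion t C.υmax (fun s u => C.pull s (θ.toFun p hp u h)) c0)
    (eB : HasLogExpansion t C.υmax (fun s u => C.pull s (B (p u))) bB)
    (hbB : ∀ (i : ℤ) (j : ℕ) (u : Eu r), -(t : ℤ) ≤ i → i + j ≤ K →
      bB i j u = -primCoeff t (fun i' j' => cL i' j' u) i j)
    (eΛ : HasLogExpansion t C.υmax (fun s u => C.pull s (-Λ.toFun p hp u h)) bΛ)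
    (hbΛ : ∀ (i : ℤ) (j : ℕ) (u : Eu r), -(t : ℤ) ≤ i → i + j ≤ K →
      bΛ i j u = -primCoeff t (fun i' j' => cI i' j' u) i j) (u : Eu r) (q : N) :
    Tendsto (fun w => tang (m + 1) _ (C.hat q (thetaRen θ B Λ p hp u h) w))
      (𝓝[>] 0 ×ˢ 𝓝 (extChartAt (𝓡 (m + 1)) q q))
      (𝓝 (inChart q (c0 0 0 u) (extChartAt (𝓡 (m + 1)) q q))) := by
  obtain ⟨GX, x1, x2, -⟩ := exists_isFlat_nrm_add_deriv hK eL eB hbB u q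
  obtain ⟨GY, y1, y2, -⟩ := exists_isFlat_nrm_add_deriv hK eI eΛ hbΛ u q
  obtain ⟨HB, b1, b2⟩ := exists_isLogSmooth_tng_of_primCoeff eB hbB u q
  obtain ⟨HΛ, l1, l2⟩ := exists_isLogSmooth_tng_of_primCoeff eΛ hbΛ u q
  obtain ⟨H0, o1, o2⟩ := exists_isLogSmooth_tng e0 u q
  let ev := ContinuousLinearMap.apply ℝ ((Eu (m + 1)) [⋀^Fin (m + 1)]→L[ℝ] ℝ)
    ((h, 0) : Eu r × Eu (m + 1))
  have hB1 := b1.fderiv.clm ev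
  have hΛ1 := l1.fderiv.clm (extRight m r (m + 1))
  -- The tangential part is `π_s^* θ + δ π_s^* B - d π_s^* Λ`, so it has an expansion; its divergent
  -- terms need not be computed.
  have hZ := (o1.add (hB1.add hΛ1)).congr
    (g := fun s z => tang (m + 1) _ (C.hat q (thetaRen θ B Λ p hp z.1 h) (s, z.2))) (by
      filter_upwards [eventually_slab (C := C) u q] with w hw
      refine (tang_thetaRen hp h hB hΛ hw).trans ?_
      simp only [tng_neg, fderiv_fun_neg, map_neg]
      rw [← sub_eq_add_neg, ← add_sub_assoc]
      rfl)
  -- Flatness passes to derivatives, so `δ π_s^* i_v L_ren` and `d π_s^* i_v θ_ren` converge and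
  -- their sum `∂_s π_s^* θ_ren` is bounded near `s = 0`.
  have hX := (x1.fderiv.tendsto hK (x2.fderiv x1.1))
  have hY := (y1.fderiv.tendsto hK (y2.fderiv y1.1))
  have hXY := ((ev.continuous.tendsto _).comp hX).add
    (((extRight m r (m + 1)).continuous.tendsto _).comp hY)
  have hlim := hZ.tendsto_of_bounded_deriv (by
    filter_upwards [eventually_slab (C := C) u q,
      hXY.norm.eventually_lt_const (lt_add_one _)] with w hw hw'
    have hd := hasDerivAt_tang_thetaRen hp h hL hθ (onShell w.2.1) hB hΛ hw
    refine ⟨hd.differentiableAt, ?_⟩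
    rw [hd.deriv]
    refine (le_of_eq ?_).trans hw'.le
    simp only [tng_neg, deriv.fun_neg, sub_eq_add_neg]
    rfl)
  -- The finite part is that of `θ`, because the series of the counterterms have no constant term,
  -- and this holds on a neighbourhood, so their derivatives have none either.
  have hval : tcoef t 0 (fun w => H0 w + (ev ((fderiv ℝ HB w).comp (inZ _)) +
      extRight m r (m + 1) ((fderiv ℝ HΛ w).comp (inZ _)))) (u, extChartAt (𝓡 (m + 1)) q q) =
      inChart q (c0 0 0 u) (extChartAt (𝓡 (m + 1)) q q) := by
    rw [tcoef_add o1.1 (hB1.1.add hΛ1.1), tcoef_add hB1.1 hΛ1.1, tcoef_clm _ b1.fderiv.1,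
      tcoef_clm _ l1.fderiv.1, inZ, tcoef_fderiv b1.1, tcoef_fderiv l1.1, b2, l2, map_zero,
      map_zero, add_zero, add_zero, o2.self_of_nhds, sub_self]
  rw [hval] at hlim
  exact tendsto_of_parameter hlim

end Limits

/-- Counterterms whose asymptotic series agree with the antiderivatives of the divergent terms, up
to some positive order, render the action and the symplectic potential finite. -/
theorem renormalizesTo_of_expansions
    {L : S → SpForm (m + 2) (m + 2) M} {θ : FieldOneForm S (SpForm (m + 2) (m + 1) M)}
    {B : S → SpForm (m + 2) (m + 1) M} {Λ : FieldOneForm S (SpForm (m + 2) m M)}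
    (hL : SmoothField C.region L) (hθ : SmoothFieldOneForm C.region θ)
    (onShell : ∀ {r : ℕ} (p : Eu r → S) (hp : IsPlot p) (u h : Eu r),
      ∀ x ∈ C.region, delta L p u h x = dExt (θ.toFun p hp u h) x)
    {t : ℕ} {cL : ℤ → ℕ → S → SpForm (m + 1) (m + 1) N}
    {cI : ℤ → ℕ → FieldOneForm S (SpForm (m + 1) m N)}
    {c0 : ℤ → ℕ → FieldOneForm S (SpForm (m + 1) (m + 1) N)}
    (eL : ∀ {r : ℕ} (p : Eu r → S), IsPlot p →
      HasLogExpansion t C.υmax (fun υ u => C.pull υ (C.iv (L (p u)))) (fun i j u => cL i j (p u)))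
    (eθ : ∀ {r : ℕ} (p : Eu r → S) (hp : IsPlot p) (h : Eu r),
      HasLogExpansion t C.υmax (fun υ u => C.pull υ (C.iv (θ.toFun p hp u h)))
        (fun i j u => (cI i j).toFun p hp u h) ∧
      HasLogExpansion t C.υmax (fun υ u => C.pull υ (θ.toFun p hp u h))
        (fun i j u => (c0 i j).toFun p hp u h))
    {K : ℕ} (hK : 1 ≤ K) (hB : SmoothField C.region B) (hΛ : SmoothFieldOneForm C.region Λ)
    (hB' : ∀ φ, IsHorizontalOn C.v C.region (B φ))
    (hΛ' : ∀ {r : ℕ} (p : Eu r → S) (hp : IsPlot p) (u h : Eu r),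
      IsHorizontalOn C.v C.region (Λ.toFun p hp u h))
    (eB : ∀ {r : ℕ} (p : Eu r → S), IsPlot p → ∃ bB : ℤ → ℕ → Eu r → SpForm (m + 1) (m + 1) N,
      (∀ (i : ℤ) (j : ℕ) (u : Eu r), -(t : ℤ) ≤ i → i + j ≤ (K : ℤ) →
        bB i j u = -primCoeff t (fun i' j' => cL i' j' (p u)) i j) ∧
      HasLogExpansion t C.υmax (fun υ u => C.pull υ (B (p u))) bB)
    (eΛ : ∀ {r : ℕ} (p : Eu r → S) (hp : IsPlot p) (h : Eu r),
      ∃ bΛ : ℤ → ℕ → Eu r → SpForm (m + 1) m N,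
        (∀ (i : ℤ) (j : ℕ) (u : Eu r), -(t : ℤ) ≤ i → i + j ≤ (K : ℤ) →
          bΛ i j u = primCoeff t (fun i' j' => (cI i' j').toFun p hp u h) i j) ∧
        HasLogExpansion t C.υmax (fun υ u => C.pull υ (Λ.toFun p hp u h)) bΛ) :
    C.RenormalizesTo L θ B Λ (cL 0 0) (cI 0 0) (c0 0 0) := by
  refine ⟨fun φ q => ?_, fun {r} p hp u h q => ?_⟩
  · have hp : IsPlot (fun _ : Eu 0 => φ) := isPlot_const
    obtain ⟨bB, hbB, eB⟩ := eB (fun _ : Eu 0 => φ) hp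
    have hγ := tendsto_norml_lagRen hK hp hB hB' (eL _ hp) eB hbB 0 q
    -- The tangential part has degree above the dimension of `N` and vanishes.
    have hβ : Tendsto (fun w => tang (m + 2) _ (C.hat q (lagRen L B φ) w))
        (𝓝[>] 0 ×ˢ 𝓝 (extChartAt (𝓡 (m + 1)) q q)) (𝓝 0) := by
      refine tendsto_const_nhds.congr fun w => ?_
      exact (eq_zero_of_finrank_lt (by simp) _).symm
    obtain ⟨α, h1, -, h3, -⟩ := exists_hasLimitAt_of_tang_norml q hβ hγ
    exact ⟨α, h1, eq_of_inChart_eq (h3.trans (inChart_center q _))⟩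
  · obtain ⟨bB, hbB, eB⟩ := eB p hp
    obtain ⟨bΛ, hbΛ, eΛ⟩ := eΛ p hp h
    -- Passing to `-Λ` gives the same sign convention as for `B`.
    have eΛ' : HasLogExpansion t C.υmax (fun s u => C.pull s (-Λ.toFun p hp u h))
      (fun i j u => -bΛ i j u) := eΛ.neg
    have hbΛ' : ∀ (i : ℤ) (j : ℕ) (u : Eu r), -(t : ℤ) ≤ i → i + j ≤ (K : ℤ) →
        -bΛ i j u = -primCoeff t (fun i' j' => (cI i' j').toFun p hp u h) i j :=
      fun i j u h1 h2 => by rw [hbΛ i j u h1 h2]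
    have hγ := tendsto_norml_thetaRen hK hB hB' hΛ (fun u => hΛ' p hp u h) (eθ p hp h).1 eΛ' hbΛ'
      u q
    have hβ := tendsto_tang_thetaRen hK hL hθ (fun u => onShell p hp u h) hB hΛ (eL p hp)
      (eθ p hp h).1 (eθ p hp h).2 eB hbB eΛ' hbΛ' u q
    obtain ⟨α, h1, h2, h3, -⟩ := exists_hasLimitAt_of_tang_norml q hβ hγ
    exact ⟨α, h1, eq_of_inChart_eq (h3.trans (inChart_center q _)),
      eq_of_inChart_eq (h2.trans (inChart_center q _))⟩

end RiggedBoundary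

end

end HolRen

namespace HolRen

noncomputable section

/-! ### The truncated series as counterterms -/

/-- Only coefficients with `i ≥ -t` enter, and only these are represented by Taylor coefficients. -/
lemma primCoeff_congr {V : Type*} [AddCommGroup V] [Module ℝ V] {t : ℕ} {c c' : ℤ → ℕ → V}
    (h : ∀ i j, -(t : ℤ) ≤ i → c i j = c' i j) (p : ℤ) (q : ℕ) :
    primCoeff t c p q = primCoeff t c' p q := by
  unfold primCoeff powCoeff logCoeff
  split_ifs with h1 h2
  · rw [h _ _ (Finset.mem_Icc.1 h2).1]
  · rfl
  · exact Finset.sum_congr rfl fun j hj => by rw [h _ _ (Finset.mem_Icc.1 hj).1]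

lemma contDiff_primCoeff {Z V : Type*} [NormedAddCommGroup Z] [NormedSpace ℝ Z]
    [NormedAddCommGroup V] [NormedSpace ℝ V] {t : ℕ} {c : Z → ℤ → ℕ → V}
    (h : ∀ i j, ContDiff ℝ ∞ fun z => c z i j) (p : ℤ) (q : ℕ) :
    ContDiff ℝ ∞ fun z => primCoeff t (c z) p q := by
  unfold primCoeff powCoeff logCoeff
  split_ifs with h1 h2
  · exact contDiff_const.smul (h _ _)
  · exact contDiff_const
  · exact ContDiff.sum fun j _ => contDiff_const.smul (h _ _)

lemma contDiff_pol {Z V : Type*} [NormedAddCommGroup Z] [NormedSpace ℝ Z]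
    [NormedAddCommGroup V] [NormedSpace ℝ V] (n : ℕ) {g : Z → ℕ → ℕ → V}
    (h : ∀ i j, ContDiff ℝ ∞ fun z => g z i j) :
    ContDiff ℝ ∞ fun w : ℝ × ℝ × Z => pol n (g w.2.2) w.1 w.2.1 := by
  unfold pol
  refine ContDiff.sum fun k _ => ContDiff.sum fun p _ => ContDiff.smul ?_ ((h _ _).comp ?_)
  · exact (contDiff_fst.pow _).mul ((contDiff_fst.comp contDiff_snd).pow _)
  · exact contDiff_snd.comp contDiff_snd

lemma pol_congr {V : Type*} [NormedAddCommGroup V] [NormedSpace ℝ V] {n : ℕ} {g g' : ℕ → ℕ → V}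
    (h : ∀ i j, i + j < n → g i j = g' i j) : pol n g = pol n g' := by
  funext a b
  refine Finset.sum_congr rfl fun k hk => Finset.sum_congr rfl fun p hp => ?_
  rw [Finset.HasAntidiagonal.mem_antidiagonal] at hp
  rw [h _ _ (by rw [hp]; exact Finset.mem_range.1 hk)]

lemma neg_primSum {V : Type*} [AddCommGroup V] [Module ℝ V] (t : ℕ) (K : ℤ) (c : ℤ → ℕ → V)
    (s : ℝ) : -primSum t K c s = primSum t K (fun i j => -c i j) s :=
  primSum_map (-LinearMap.id : V →ₗ[ℝ] V) t K c s

lemma neg_primCoeff {V : Type*} [AddCommGroup V] [Module ℝ V] (t : ℕ) (c : ℤ → ℕ → V) (i : ℤ)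
    (j : ℕ) : -primCoeff t c i j = primCoeff t (fun i j => -c i j) i j :=
  primCoeff_map (-LinearMap.id : V →ₗ[ℝ] V) t c i j

lemma primSum_apply {ι : Type*} {V : ι → Type*} [∀ i, AddCommGroup (V i)] [∀ i, Module ℝ (V i)]
    (t : ℕ) (K : ℤ) (c : ℤ → ℕ → ∀ i, V i) (s : ℝ) (q : ι) :
    primSum t K c s q = primSum t K (fun i j => c i j q) s :=
  primSum_map (LinearMap.proj q : (∀ i, V i) →ₗ[ℝ] V q) t K c s

/-! ### The expansion of the truncated series -/

section

variable {d k r : ℕ} {X : Type*} [TopologicalSpace X] [ChartedSpace (Eu d) X] {t : ℕ} {υmax : ℝ}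
  {f : ℝ → Eu r → SpForm d k X} {c : ℤ → ℕ → Eu r → SpForm d k X}

/-- The truncated series is, near `s = 0`, a smooth function of `s` and `s log s`. -/
lemma HasLogExpansion.exists_primSum_eq (h : HasLogExpansion t υmax f c) (hυ : 0 < υmax) (K : ℕ)
    (u₀ : Eu r) (q₀ : X) : ∃ H : ℝ × ℝ × (Eu r × Eu d) → (Eu d) [⋀^Fin k]→L[ℝ] ℝ,
      ContDiff ℝ ∞ H ∧ ∀ᶠ z in 𝓝 (u₀, extChartAt (𝓡 d) q₀ q₀),
        (∀ s > 0, inChart q₀ (primSum t (K : ℤ) (fun i j => c i j z.1) s) z.2 =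
          (s ^ t)⁻¹ • H (s, s * Real.log s, z)) ∧
        ∀ i j : ℕ, tcoef i j H z = inChart q₀ (if (i : ℤ) - t + j ≤ K then
          primCoeff t (fun i' j' => c i' j' z.1) ((i : ℤ) - t) j else 0) z.2 := by
  obtain ⟨H, hH, hc⟩ := h.exists_isLogSmooth hυ u₀ q₀
  -- No regularity of the coefficients `c` is assumed. Near the base point their chart expressions
  -- agree with Taylor coefficients of `H`, which are smooth in `z` everywhere.
  let c' : Eu r × Eu d → ℤ → ℕ → (Eu d) [⋀^Fin k]→L[ℝ] ℝ := fun z i j =>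
    tcoef (i + t).toNat j H z
  have hc' : ∀ i j, ContDiff ℝ ∞ fun z => c' z i j := fun i j => contDiff_tcoef hH.1 _ _
  let g : Eu r × Eu d → ℕ → ℕ → (Eu d) [⋀^Fin k]→L[ℝ] ℝ := fun z i j =>
    if (i : ℤ) - t + j ≤ K then primCoeff t (c' z) ((i : ℤ) - t) j else 0
  have hg : ∀ i j, ContDiff ℝ ∞ fun z => g z i j := fun i j => by
    by_cases hij : (i : ℤ) - t + j ≤ K
    · simpa only [g, if_pos hij] using contDiff_primCoeff hc' _ _
    · simpa only [g, if_neg hij] using contDiff_const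
  refine ⟨fun w => pol (t + K + 1) (g w.2.2) w.1 w.2.1, contDiff_pol _ hg, ?_⟩
  filter_upwards [hc] with z hz
  have hcc : ∀ i j, primCoeff t (c' z) i j =
      inChart q₀ (primCoeff t (fun i' j' => c i' j' z.1) i j) z.2 := fun i j => by
    refine (primCoeff_congr (fun i j hi => ?_) i j).trans
      (primCoeff_map (inChartₗ q₀ z.2) t _ i j).symm
    have : (((i + t).toNat : ℕ) : ℤ) - t = i := by omega
    exact (hz _ _).trans (by rw [this]; rfl)
  refine ⟨fun s hs => ?_, fun i j => ?_⟩
  · refine (primSum_map (inChartₗ q₀ z.2) t K (fun i j => c i j z.1) s).trans ?_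
    rw [primSum_eq_pol _ _ _ hs]
    congr 1
    refine congrFun (congrFun (pol_congr fun i j hij => ?_) _) _
    simp only [g]
    rw [if_pos (by omega), hcc]
    exact (primCoeff_map (inChartₗ q₀ z.2) t _ _ j).symm
  · rw [tcoef_pol (t + K + 1) g (fun z i j hij => if_neg (by omega))]
    simp only [g]
    split_ifs
    · exact hcc _ _
    · exact (map_zero (inChartₗ q₀ z.2)).symm

/-- The truncated series is a polynomial in `s` and `s log s` divided by `s^t`, hence its own
expansion: its coefficients agree with those of the full series through total order `K` and are zero
beyond. -/
lemma HasLogExpansion.primSum (h : HasLogExpansion t υmax f c) (hυ : 0 < υmax) (K : ℕ)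
    {f' : ℝ → Eu r → SpForm d k X} (hf' : ∀ s ∈ Ioo 0 υmax, ∀ u,
      f' s u = primSum t (K : ℤ) (fun i j => c i j u) s) :
    HasLogExpansion t υmax f' (fun i j u => if i + j ≤ (K : ℤ) then
        primCoeff t (fun i' j' => c i' j' u) i j else 0) := by
  intro u₀ q₀
  obtain ⟨H, hH, hc⟩ := h.exists_primSum_eq hυ K u₀ q₀
  obtain ⟨U, hU, hUo, hU0⟩ := eventually_nhds_iff.1 hc
  refine ⟨{w | w.2.2 ∈ U}, H, hUo.preimage (by fun_prop), hU0, hH.contDiffOn,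
    fun s u y h1 h2 _ h4 => ?_, fun u y _ h2 i j => ((hU (u, y) h2).2 i j).symm⟩
  rw [hf' s ⟨h1, h2⟩, (hU (u, y) h4).1 s h1, smul_smul, mul_inv_cancel₀ (by positivity), one_smul]

end

namespace RiggedBoundary

variable {m k r : ℕ} {M N S : Type*} [DiffeologicalSpace S]
  [TopologicalSpace M] [ChartedSpace (Eu (m + 2)) M] [IsManifold (𝓡 (m + 2)) ∞ M]
  [TopologicalSpace N] [ChartedSpace (Eu (m + 1)) N] [IsManifold (𝓡 (m + 1)) ∞ N]
  {C : RiggedBoundary m M N}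

/-- A family of horizontal forms defined by the truncated series is smooth. -/
lemma smoothFamilyOn_of_primSum [T2Space M] {t : ℕ} {f : ℝ → Eu r → SpForm (m + 1) k N}
    {c : ℤ → ℕ → Eu r → SpForm (m + 1) k N} (h : HasLogExpansion t C.υmax f c) (K : ℕ)
    {A : Eu r → SpForm (m + 2) k M} (hA : ∀ u, IsHorizontalOn C.v C.region (A u))
    (hA' : ∀ s ∈ Ioo 0 C.υmax, ∀ u,
      C.pull s (A u) = primSum t (K : ℤ) (fun i j => c i j u) s) :
    SmoothFamilyOn C.region A := by
  refine smoothFamilyOn_of_isHorizontalOn hA fun u q s hs => ?_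
  obtain ⟨H, hH, hc⟩ := h.exists_primSum_eq C.υmax_pos K u q
  set y := extChartAt (𝓡 (m + 1)) q q
  have h1 : ContDiffAt ℝ ∞ (fun p : Eu r × (ℝ × Eu (m + 1)) =>
      (p.2.1 ^ t)⁻¹ • H (p.2.1, p.2.1 * Real.log p.2.1, (p.1, p.2.2))) (u, (s, y)) := by
    have hs0 : s ≠ 0 := hs.1.ne'
    have e1 : ContDiffAt ℝ ∞ (fun p : Eu r × (ℝ × Eu (m + 1)) => p.2.1) (u, (s, y)) := by fun_prop
    have e2 : ContDiffAt ℝ ∞ (fun p : Eu r × (ℝ × Eu (m + 1)) => (p.1, p.2.2)) (u, (s, y)) := by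
      fun_prop
    -- At a positive time both `s^{-t}` and `log s` are smooth.
    exact ((e1.pow t).inv (pow_ne_zero t hs0)).smul (hH.contDiffAt.comp (u, (s, y))
      (e1.prodMk ((e1.mul (e1.log hs0)).prodMk e2)))
  refine h1.congr_of_eventuallyEq ?_
  have h2 : Tendsto (fun p : Eu r × (ℝ × Eu (m + 1)) => (p.1, p.2.2)) (𝓝 (u, (s, y)))
      (𝓝 (u, y)) := (by fun_prop : Continuous fun p : Eu r × (ℝ × Eu (m + 1)) =>
        (p.1, p.2.2)).tendsto _
  have h3 : Tendsto (fun p : Eu r × (ℝ × Eu (m + 1)) => p.2.1) (𝓝 (u, (s, y)))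
      (𝓝 s) := (by fun_prop : Continuous fun p : Eu r × (ℝ × Eu (m + 1)) => p.2.1).tendsto _
  filter_upwards [h2.eventually hc, h3.eventually (isOpen_Ioo.mem_nhds hs)] with p hp hp'
  rw [hA' _ hp']
  exact hp.1 _ hp'.1

/-- The horizontal one-form on `S` with values in the forms on `M` whose pullback to `N` is the
truncated series with coefficients `c`. -/
def primSumForm (C : RiggedBoundary m M N) (t : ℕ) (K : ℤ)
    (c : ℤ → ℕ → FieldOneForm S (SpForm (m + 1) k N)) : FieldOneForm S (SpForm (m + 2) k M) where
  toFun p hp u := (C.lift k).comp (LinearMap.pi fun s => primSum t K (fun i j => (c i j).toFun p hp u) s)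
  compat p hp f hf u h := by
    simp only [LinearMap.comp_apply]
    congr 1
    funext s
    simp only [LinearMap.pi_apply]
    refine (primSum_map (LinearMap.applyₗ h) t K _ s).trans
      (Eq.trans ?_ (primSum_map (LinearMap.applyₗ (fderiv ℝ f u h)) t K _ s).symm)
    simp only [LinearMap.applyₗ_apply_apply, (c _ _).compat p hp f hf u h]

lemma pull_primSumForm [T2Space M] (t : ℕ) (K : ℤ)
    (c : ℤ → ℕ → FieldOneForm S (SpForm (m + 1) k N)) {p : Eu r → S} (hp : IsPlot p) (u h : Eu r)
    {s : ℝ} (hs : s ∈ Ioo 0 C.υmax) :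
    C.pull s ((C.primSumForm t K c).toFun p hp u h) =
      primSum t K (fun i j => (c i j).toFun p hp u h) s := by
  funext q
  refine (pull_lift _ hs q).trans ?_
  exact congrFun (primSum_map (LinearMap.applyₗ h) t K (fun i j => (c i j).toFun p hp u) s) q

end RiggedBoundary

end

end HolRen

/-! ### The main theorem -/

theorem mainTheorem7 {m : ℕ} {M N S : Type*} [DiffeologicalSpace S]
    [TopologicalSpace M] [T2Space M] [ChartedSpace (Eu (m + 2)) M]
    [IsManifold (𝓡 (m + 2)) ∞ M]
    [TopologicalSpace N] [ChartedSpace (Eu (m + 1)) N] [IsManifold (𝓡 (m + 1)) ∞ N]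
    (C : RiggedBoundary m M N)
    (L : S → SpForm (m + 2) (m + 2) M)
    (θ : FieldOneForm S (SpForm (m + 2) (m + 1) M))
    (hL : SmoothField C.region L) (hθ : SmoothFieldOneForm C.region θ)
    (onShell : ∀ {r : ℕ} (p : Eu r → S) (hp : IsPlot p) (u h : Eu r),
      ∀ x ∈ C.region, delta L p u h x = dExt (θ.toFun p hp u h) x) :
    -- the counterterms given by integrals along the flow of the rigging vector field
    (∀ υ₀ ∈ Ioo 0 C.υmax,
      (∃ (B : S → SpForm (m + 2) (m + 1) M) (Λ : FieldOneForm S (SpForm (m + 2) m M)),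
        C.IsCounterterm υ₀ L θ B Λ) ∧
      (∀ (B B' : S → SpForm (m + 2) (m + 1) M) (Λ Λ' : FieldOneForm S (SpForm (m + 2) m M)),
        C.IsCounterterm υ₀ L θ B Λ → C.IsCounterterm υ₀ L θ B' Λ' →
        (∀ φ, EqOn (B φ) (B' φ) C.region) ∧
        ∀ {r : ℕ} (p : Eu r → S) (hp : IsPlot p) (u h : Eu r),
          EqOn (Λ.toFun p hp u h) (Λ'.toFun p hp u h) C.region) ∧
      ∀ (B : S → SpForm (m + 2) (m + 1) M) (Λ : FieldOneForm S (SpForm (m + 2) m M)),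
        C.IsCounterterm υ₀ L θ B Λ →
        SmoothField C.region B ∧ SmoothFieldOneForm C.region Λ ∧
        (∀ φ, ∀ x ∈ C.region, C.iv (lagRen L B φ) x = 0) ∧
        (∀ {r : ℕ} (p : Eu r → S) (hp : IsPlot p) (u h : Eu r),
          (∀ x ∈ C.region, C.iv (thetaRen θ B Λ p hp u h) x = 0) ∧
          ∀ υ ∈ Ioo 0 C.υmax, ∀ q,
            C.pull υ (thetaRen θ B Λ p hp u h) q =
              C.pull υ₀ (θ.toFun p hp u h) q) ∧
        (∀ φ q, HasLimitAt C.region (lagRen L B φ) (C.flow 0 q) 0) ∧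
        ∀ {r : ℕ} (p : Eu r → S) (hp : IsPlot p) (u h : Eu r) (q : N),
          ∃ α, HasLimitAt C.region (thetaRen θ B Λ p hp u h) (C.flow 0 q) α ∧
            C.ivAt q α = 0 ∧
            C.restrictAt q α =
              C.pull υ₀ (θ.toFun p hp u h) q) ∧
    -- the explicit counterterms for divergences in powers of `Φ` and `Φ log Φ`
    (∀ (t : ℕ) (cL : ℤ → ℕ → S → SpForm (m + 1) (m + 1) N)
      (cI : ℤ → ℕ → FieldOneForm S (SpForm (m + 1) m N))
      (c0 : ℤ → ℕ → FieldOneForm S (SpForm (m + 1) (m + 1) N)),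
      (∀ {r : ℕ} (p : Eu r → S), IsPlot p →
        HasLogExpansion t C.υmax
          (fun υ u => C.pull υ (C.iv (L (p u))))
          (fun i j u => cL i j (p u))) →
      (∀ {r : ℕ} (p : Eu r → S) (hp : IsPlot p) (h : Eu r),
        HasLogExpansion t C.υmax
          (fun υ u => C.pull υ (C.iv (θ.toFun p hp u h)))
          (fun i j u => (cI i j).toFun p hp u h) ∧
        HasLogExpansion t C.υmax
          (fun υ u => C.pull υ (θ.toFun p hp u h))
          (fun i j u => (c0 i j).toFun p hp u h)) →
      ∀ K : ℤ, 1 ≤ K →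
        -- the explicit series, truncated at any order `K`, are the required antiderivatives
        (∀ φ q, ∀ υ > 0, HasDerivAt
          (fun s => -primSum t K (fun i j => cL i j φ q) s)
          (-divSum t K (fun i j => cL i j φ q) υ) υ) ∧
        (∀ {r : ℕ} (p : Eu r → S) (hp : IsPlot p) (u h : Eu r) (q : N),
          ∀ υ > 0, HasDerivAt
            (fun s => primSum t K (fun i j => (cI i j).toFun p hp u h q) s)
            (divSum t K (fun i j => (cI i j).toFun p hp u h q) υ) υ) ∧
        -- the truncated series define counterterms
        (∃ (B : S → SpForm (m + 2) (m + 1) M) (Λ : FieldOneForm S (SpForm (m + 2) m M)),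
          SmoothField C.region B ∧ SmoothFieldOneForm C.region Λ ∧
          (∀ φ, IsHorizontalOn C.v C.region (B φ) ∧ ∀ υ ∈ Ioo 0 C.υmax, ∀ q,
            C.pull υ (B φ) q =
              -primSum t K (fun i j => cL i j φ q) υ) ∧
          (∀ {r : ℕ} (p : Eu r → S) (hp : IsPlot p) (u h : Eu r),
            IsHorizontalOn C.v C.region (Λ.toFun p hp u h) ∧
            ∀ υ ∈ Ioo 0 C.υmax, ∀ q, C.pull υ (Λ.toFun p hp u h) q =
              primSum t K (fun i j => (cI i j).toFun p hp u h q) υ) ∧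
          C.RenormalizesTo L θ B Λ (cL 0 0) (cI 0 0) (c0 0 0)) ∧
        -- and so does every pair with these asymptotic series up to order `K`
        ∀ (B : S → SpForm (m + 2) (m + 1) M) (Λ : FieldOneForm S (SpForm (m + 2) m M)),
          SmoothField C.region B → SmoothFieldOneForm C.region Λ →
          (∀ φ, IsHorizontalOn C.v C.region (B φ)) →
          (∀ {r : ℕ} (p : Eu r → S) (hp : IsPlot p) (u h : Eu r),
            IsHorizontalOn C.v C.region (Λ.toFun p hp u h)) →
          (∀ {r : ℕ} (p : Eu r → S), IsPlot p →
            ∃ bB : ℤ → ℕ → Eu r → SpForm (m + 1) (m + 1) N,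
              (∀ (i : ℤ) (j : ℕ) (u : Eu r), -(t : ℤ) ≤ i → i + j ≤ K →
                bB i j u = -primCoeff t (fun i' j' => cL i' j' (p u)) i j) ∧
              HasLogExpansion t C.υmax
                (fun υ u => C.pull υ (B (p u))) bB) →
          (∀ {r : ℕ} (p : Eu r → S) (hp : IsPlot p) (h : Eu r),
            ∃ bΛ : ℤ → ℕ → Eu r → SpForm (m + 1) m N,
              (∀ (i : ℤ) (j : ℕ) (u : Eu r), -(t : ℤ) ≤ i → i + j ≤ K →
                bΛ i j u = primCoeff t (fun i' j' => (cI i' j').toFun p hp u h) i j) ∧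
              HasLogExpansion t C.υmax
                (fun υ u => C.pull υ (Λ.toFun p hp u h)) bΛ) →
          C.RenormalizesTo L θ B Λ (cL 0 0) (cI 0 0) (c0 0 0)) := by
  refine ⟨fun υ₀ hυ₀ => ⟨RiggedBoundary.exists_isCounterterm hθ hυ₀, fun B B' Λ Λ' h h' => h.eqOn h',
  fun B Λ h => ⟨h.smooth_B hL hυ₀, h.smooth_Λ hθ hυ₀, h.iv_lagRen hL hυ₀,
    fun p hp u δ => ⟨RiggedBoundary.iv_eq_zero_of_norml fun q s hs =>
      h.norml_thetaRen_eq_zero hL hθ hυ₀ hp u δ ⟨hs, mem_extChartAt_target q⟩, fun υ hυ q =>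
        h.pull_thetaRen hL hθ hυ₀ hp u δ (onShell p hp u δ) hυ q⟩,
    fun φ q => hasLimitAt_zero (h.lagRen_eq_zero hL hυ₀ φ) _,
    fun p hp u δ q =>
      h.exists_hasLimitAt_thetaRen hL hθ hυ₀ hp u δ (onShell p hp u δ) q⟩⟩,
    fun t cL cI c0 eL eθ K hK => ?_⟩
  -- A positive order `K` is a natural number, for which the series is a polynomial in `s` and `s
  -- log s` up to the factor `s^{-t}`.
  lift K to ℕ using by omega
  have hK' : 1 ≤ K := by omega
  refine ⟨fun φ q υ hυ => (hasDerivAt_primSum t K _ hυ).neg,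
    fun p hp u h q υ hυ => hasDerivAt_primSum t K _ hυ, ?_, fun B Λ hB hΛ hB' hΛ' eB eΛ =>
    RiggedBoundary.renormalizesTo_of_expansions hL hθ onShell eL eθ hK' hB hΛ hB' hΛ' eB eΛ⟩
  -- The sign is moved onto the coefficients, so that `B` is literally a truncated series, for the
  -- expansion of `-i_v L`.
  let B : S → SpForm (m + 2) (m + 1) M := fun φ =>
    C.lift (m + 1) (fun s => primSum t (K : ℤ) (fun i j => -cL i j φ) s)
  have hB' : ∀ φ, IsHorizontalOn C.v C.region (B φ) := fun φ =>
    RiggedBoundary.isHorizontalOn_lift _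
  have hBp : ∀ φ, ∀ s ∈ Ioo 0 C.υmax,
      C.pull s (B φ) = primSum t (K : ℤ) (fun i j => -cL i j φ) s := fun φ s hs => by
    funext q
    exact RiggedBoundary.pull_lift _ hs q
  have hB : SmoothField C.region B := fun r p hp =>
    RiggedBoundary.smoothFamilyOn_of_primSum (eL p hp).neg K (fun u => hB' (p u))
      fun s hs u => hBp (p u) s hs
  have hΛ' : ∀ {r : ℕ} (p : Eu r → S) (hp : IsPlot p) (u h : Eu r),
      IsHorizontalOn C.v C.region ((C.primSumForm t K cI).toFun p hp u h) := fun p hp u h =>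
    RiggedBoundary.isHorizontalOn_lift _
  have hΛ : SmoothFieldOneForm C.region (C.primSumForm t K cI) := fun r p hp h =>
    RiggedBoundary.smoothFamilyOn_of_primSum (eθ p hp h).1 K (fun u => hΛ' p hp u h)
      fun s hs u => RiggedBoundary.pull_primSumForm t K cI hp u h hs
  refine ⟨B, C.primSumForm t K cI, hB, hΛ, fun φ => ⟨hB' φ, fun υ hυ q => ?_⟩,
    fun p hp u h => ⟨hΛ' p hp u h, fun υ hυ q => ?_⟩,
    RiggedBoundary.renormalizesTo_of_expansions hL hθ onShell eL eθ hK' hB hΛ hB' hΛ'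
      (fun p hp => ⟨_, fun i j u _ hij => ?_, (eL p hp).neg.primSum C.υmax_pos K
        fun s hs u => hBp (p u) s hs⟩)
      (fun p hp h => ⟨_, fun i j u _ hij => if_pos hij, (eθ p hp h).1.primSum C.υmax_pos K
        fun s hs u => RiggedBoundary.pull_primSumForm t K cI hp u h hs⟩)⟩
  · rw [hBp φ υ hυ, primSum_apply, neg_primSum]
    rfl
  · rw [RiggedBoundary.pull_primSumForm t K cI hp u h hυ, primSum_apply]
  · rw [neg_primCoeff]
    exact if_pos hij
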